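/- Let $\beta\ge 0$. On $C_0(\mathbb R_+)$, the continuous functions on $\mathbb R_+=[0,\infty)$ vanishing at infinity, there is a unique Feller semigroup $Q^{(\beta)}=(Q^{(\beta)}_t)_{t\ge0}$ (the squared Bessel semigroup) whose generator acts as $x\partial^2+\beta\partial$ on the smooth compactly supported functions on $[0,\infty)$. On $c_0(\mathbb Z_+)$, the functions on $\mathbb Z_+=\{0,1,2,\dots\}$ vanishing at infinity, there is a unique Feller semigroup $\mathbb Q^{(\beta)}=(\mathbb Q^{(\beta)}_t)_{t\ge0}$ (the linear birth–death semigroup) whose generator acts as $(n+\beta)\partial_++n\partial_-$ on the finitely supported functions, where $\partial_\pm g(n)=g(n\pm1)-g(n)$. (Feller semigroups are understood as given by Markov transition kernels.) Define the Markov kernels $$\Lambda g(x)=\mathbb E[g(\mathrm{Pois}(x))],\quad x\ge 0,\qquad \Lambda^*f(n)=\mathbb E[f(\mathrm{Gam}(n+\beta))],\quad n\in\mathbb Z_+,$$ where $\mathrm{Pois}(x)$ is a Poisson variable of parameter $x$ and $\mathrm{Gam}(a)$ is a standard gamma variable of shape parameter $a$ (with $\mathrm{Gam}(0)=0$). 1.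 $\Lambda$ maps $c_0(\mathbb Z_+)$ to $C_0(\mathbb R_+)$ and $\Lambda^*$ maps $C_0(\mathbb R_+)$ to $c_0(\mathbb Z_+)$, as bounded operators, and for all $t\ge0$ $$Q^{(\beta)}_t\Lambda=\Lambda\,\mathbb Q^{(\beta)}_t\ \text{ on } c_0(\mathbb Z_+),\qquad \mathbb Q^{(\beta)}_t\Lambda^*=\Lambda^*Q^{(\beta)}_t\ \text{ on } C_0(\mathbb R_+).$$ 2. Let $\beta>0$, and put $\mathfrak m_\beta(n)=\frac{(n+\beta-1)(n+\beta-2)\cdots\beta}{n!}$, $n\in\mathbb Z_+$, and $\mu_\beta(dx)=\frac{x^{\beta-1}}{\Gamma(\beta)}\,dx$, $x>0$. Then the kernels $\Lambda$, $\Lambda^*$, $Q^{(\beta)}_t$, $\mathbb Q^{(\beta)}_t$ define, through the same integral formulas (convergent almost everywhere), bounded operators $\ell^2(\mathfrak m_\beta)\to L^2(\mu_\beta)$, $L^2(\mu_\beta)\to\ell^2(\mathfrak m_\beta)$, $L^2(\mu_\beta)\to L^2(\mu_\beta)$ and $\ell^2(\mathfrak m_\beta)\to\ell^2(\mathfrak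 m_\beta)$ respectively, and for all $t\ge 0$, $Q^{(\beta)}_t\Lambda=\Lambda\,\mathbb Q^{(\beta)}_t$ on $\ell^2(\mathfrak m_\beta)$ and $\mathbb Q^{(\beta)}_t\Lambda^*=\Lambda^*Q^{(\beta)}_t$ on $L^2(\mu_\beta)$. Moreover $\Lambda:\ell^2(\mathfrak m_\beta)\to L^2(\mu_\beta)$ is a quasi-affinity (bounded, one-to-one, with dense range), and the two semigroups are unitarily equivalent: there is a surjective linear isometry $U:\ell^2(\mathfrak m_\beta)\to L^2(\mu_\beta)$, not depending on $t$, with $Q^{(\beta)}_tU=U\,\mathbb Q^{(\beta)}_t$ for all $t\ge0$. -/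

import Mathlib

open MeasureTheory ProbabilityTheory Filter Topology
open scoped NNReal ENNReal ContDiff ZeroAtInfty Nat

/-! ### Feller semigroups given by transition kernels -/

/-- `P` is the transition function of a (conservative) Feller semigroup on the space `C₀(E, ℝ)`
of continuous functions vanishing at infinity: Markov kernels satisfying the Chapman-Kolmogorov
equation, preserving `C₀(E, ℝ)` and strongly continuous there. -/
structure IsFellerSemigroup {E : Type*} [TopologicalSpace E] [MeasurableSpace E]
    (P : ℝ≥0 → Kernel E E) : Prop where
  markov : ∀ t, IsMarkovKernel (P t)
  zero : P 0 = Kernel.id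
  add : ∀ s t, P (s + t) = P t ∘ₖ P s
  mapsTo : ∀ (t : ℝ≥0) (f : C₀(E, ℝ)), ∃ g : C₀(E, ℝ), ∀ x, g x = ∫ y, f y ∂(P t x)
  continuous : ∀ f : C₀(E, ℝ),
    TendstoUniformly (fun (t : ℝ≥0) (x : E) => ∫ y, f y ∂(P t x)) (fun x => f x) (𝓝 0)

/-- `f` is in the domain of the infinitesimal generator of `P` (with respect to the uniform
norm) and `g` is its image. -/
def InGenerator {E : Type*} [MeasurableSpace E] (P : ℝ≥0 → Kernel E E) (f g : E → ℝ) : Prop :=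
  TendstoUniformly (fun (t : ℝ≥0) (x : E) => ((∫ y, f y ∂(P t x)) - f x) / (t : ℝ)) g (𝓝[>] 0)

/-- `Q` is the squared Bessel semigroup with parameter `β`: the Feller semigroup on `[0, ∞)`
whose generator is `x ∂² + β ∂` on the smooth compactly supported functions on `[0, ∞)`
(the restrictions to `[0, ∞)` of smooth compactly supported functions on the line, so that
there is no condition at the boundary point `0`). -/
structure IsSquaredBesselSemigroup (β : ℝ) (Q : ℝ≥0 → Kernel ℝ≥0 ℝ≥0) : Prop where
  feller : IsFellerSemigroup Q
  generator : ∀ f : ℝ → ℝ, ContDiff ℝ ∞ f → HasCompactSupport f →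
    InGenerator Q (fun x : ℝ≥0 => f x)
      (fun x : ℝ≥0 => (x : ℝ) * deriv (deriv f) x + β * deriv f x)

/-- `D` is the linear birth-death semigroup with parameter `β`: the Feller semigroup on the
nonnegative integers whose generator is `(n + β) ∂₊ + n ∂₋` on the finitely supported functions,
where `∂± f n = f (n ± 1) - f n`. (At `n = 0` the value of `f (n - 1)` is irrelevant.) -/
structure IsBirthDeathSemigroup (β : ℝ) (D : ℝ≥0 → Kernel ℕ ℕ) : Prop where
  feller : IsFellerSemigroup D
  generator : ∀ f : ℕ → ℝ, f.support.Finite →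
    InGenerator D f
      (fun n : ℕ => ((n : ℝ) + β) * (f (n + 1) - f n) + (n : ℝ) * (f (n - 1) - f n))

/-! ### The two gateway kernels and the reference measures -/

/-- The Markov kernel `Λ` from `[0, ∞)` to the nonnegative integers: `Λ x` is the Poisson
distribution with parameter `x`. -/
noncomputable def poissonGateway : Kernel ℝ≥0 ℕ where
  toFun x := poissonMeasure x
  measurable' := by
    refine Measure.measurable_of_measurable_coe _ fun s hs => ?_
    simp only [poissonMeasure, Measure.sum_apply _ hs, Measure.smul_apply]
    refine Measurable.ennreal_tsum fun n => ?_
    refine Measurable.smul_const ?_ _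
    fun_prop

/-- The standard gamma distribution with shape parameter `a ≥ 0`, as a measure on `[0, ∞)`.
For `a = 0` it is the Dirac mass at `0`. -/
noncomputable def gammaLaw (a : ℝ) : Measure ℝ≥0 :=
  if a = 0 then Measure.dirac 0 else (gammaMeasure a 1).map Real.toNNReal

/-- The Markov kernel `Λ*` from the nonnegative integers to `[0, ∞)`: `Λ* n` is the standard
gamma distribution with shape parameter `n + β`. -/
noncomputable def gammaGateway (β : ℝ) : Kernel ℕ ℝ≥0 where
  toFun n := gammaLaw ((n : ℝ) + β)
  measurable' := measurable_of_countable _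

/-- The measure `μ_β(dx) = x ^ (β - 1) / Γ(β) dx` on `(0, ∞)`, seen as a measure on `[0, ∞)`. -/
noncomputable def besselMeasure (β : ℝ) : Measure ℝ≥0 :=
  ((volume.restrict (Set.Ioi (0 : ℝ))).withDensity
    (fun x => ENNReal.ofReal (x ^ (β - 1) / Real.Gamma β))).map Real.toNNReal

/-- The measure `m_β` on the nonnegative integers, with
`m_β(n) = β (β + 1) ⋯ (β + n - 1) / n!`. -/
noncomputable def birthDeathMeasure (β : ℝ) : Measure ℕ :=
  Measure.sum fun n =>
    ENNReal.ofReal ((∏ k ∈ Finset.range n, (β + (k : ℝ))) / (n ! : ℝ)) • Measure.dirac n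

/-! ### Operators given by kernels -/

/-- `T` is the operator `f ↦ (x ↦ ∫ f dκ(x, ·))` on functions vanishing at infinity. -/
def IsC0Operator {X Y : Type*} [TopologicalSpace X] [MeasurableSpace X] [TopologicalSpace Y]
    [MeasurableSpace Y] (κ : Kernel X Y) (T : C₀(Y, ℝ) →L[ℝ] C₀(X, ℝ)) : Prop :=
  ∀ (f : C₀(Y, ℝ)) (x : X), T f x = ∫ y, f y ∂(κ x)

/-- `T` is the operator `f ↦ (x ↦ ∫ f dκ(x, ·))` from `L²(ν)` to `L²(μ)`: for every square
integrable `f` the integral converges for almost every `x` and defines the class `T f`. -/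
def IsL2Operator {X Y : Type*} [MeasurableSpace X] [MeasurableSpace Y] (κ : Kernel X Y)
    (ν : Measure Y) (μ : Measure X) (T : Lp ℝ 2 ν →L[ℝ] Lp ℝ 2 μ) : Prop :=
  ∀ (f : Y → ℝ) (hf : MemLp f 2 ν),
    (∀ᵐ x ∂μ, Integrable f (κ x)) ∧ T (hf.toLp f) =ᵐ[μ] fun x => ∫ y, f y ∂(κ x)

/-- A quasi-affinity: a bounded linear operator which is one-to-one with dense range. -/
def IsQuasiAffinity {V W : Type*} [NormedAddCommGroup V] [NormedSpace ℝ V]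
    [NormedAddCommGroup W] [NormedSpace ℝ W] (T : V →L[ℝ] W) : Prop :=
  Function.Injective T ∧ DenseRange T

/-!
Finite measures on `[0, ∞)` and on `ℕ` are determined by their Laplace transforms, and both
semigroups are affine: they map an exponential `exp (-p x)`, respectively `s ^ n`, to a constant
multiple of another exponential. The transition kernels are explicit: the Poisson-gamma mixture
`ΛΛ*` is the squared Bessel kernel at time `1`, from which the other times follow by scaling, and
the birth-death kernels are those of a branching process with immigration. As linear combinations
of exponentials are dense in `C₀` and stable under the semigroups, the Feller property can be read
off from them. For uniqueness, graph limits of test functions put the exponentials in the domain of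
the generator, and the derivatives of the exponentials determine the semigroup. The intertwining
relations hold because both sides have the same Laplace transforms.

In the Hilbert spaces the reference measures are invariant, and `Λ*` is the adjoint of `Λ` because
the two are dual on exponentials, which are total. The squared Bessel operators are self-adjoint,
so that `Q_{1/2}` is self-adjoint with square `Q₁ = ΛΛ*`. This makes `Q_{1/2}` the positive part in
the polar decomposition of `Λ`, whose unitary part is `U`.
-/

/-! ### Contraction semigroups -/

section ContractionSemigroup

theorem tendsto_toNNReal_sub_nhdsGT (s : ℝ) :
    Tendsto (fun r : ℝ => (r - s).toNNReal) (𝓝[>] s) (𝓝[>] 0) := by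
  refine tendsto_nhdsWithin_iff.2 ⟨?_, ?_⟩
  · have hcont : Continuous fun r : ℝ => (r - s).toNNReal := by fun_prop
    simpa using (hcont.tendsto s).mono_left nhdsWithin_le_nhds
  · filter_upwards [self_mem_nhdsWithin] with r hr
    simpa using hr

theorem toNNReal_add_toNNReal_sub {s r : ℝ} (hs : 0 ≤ s) (hsr : s ≤ r) :
    s.toNNReal + (r - s).toNNReal = r.toNNReal := by
  rw [← Real.toNNReal_add hs (sub_nonneg.2 hsr), add_sub_cancel]

variable {X : Type*} [NormedAddCommGroup X] [NormedSpace ℝ X]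

/-- A strongly continuous semigroup of contractions of a normed space. -/
structure IsContractionSemigroup (T : ℝ≥0 → X →L[ℝ] X) : Prop where
  norm_le : ∀ t f, ‖T t f‖ ≤ ‖f‖
  zero : ∀ f, T 0 f = f
  add : ∀ s t f, T (s + t) f = T s (T t f)
  continuous : ∀ f, Tendsto (fun t => T t f) (𝓝 0) (𝓝 f)

/-- The graph of the infinitesimal generator of `T`: `f` is in its domain, with image `g`. -/
def IsGenerated (T : ℝ≥0 → X →L[ℝ] X) (f g : X) : Prop :=
  Tendsto (fun t : ℝ≥0 => (t : ℝ)⁻¹ • (T t f - f)) (𝓝[>] 0) (𝓝 g)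

namespace IsGenerated

variable {T : ℝ≥0 → X →L[ℝ] X} {f g f' g' : X}

theorem add (h : IsGenerated T f g) (h' : IsGenerated T f' g') :
    IsGenerated T (f + f') (g + g') := by
  refine (Tendsto.add h h').congr fun t => ?_
  rw [← smul_add, map_add, sub_add_sub_comm]

theorem smul (c : ℝ) (h : IsGenerated T f g) : IsGenerated T (c • f) (c • g) := by
  refine (Tendsto.const_smul h c).congr fun t => ?_
  rw [map_smul, ← smul_sub, smul_comm]

end IsGenerated

namespace IsContractionSemigroup

variable {T T' : ℝ≥0 → X →L[ℝ] X} {f g : X}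

theorem norm_apply_sub_apply_le (hT : IsContractionSemigroup T) (s t : ℝ≥0) (f : X) :
    ‖T s f - T t f‖ ≤ ‖T (nndist s t) f - f‖ := by
  wlog hst : s ≤ t generalizing s t
  · rw [norm_sub_rev, nndist_comm]
    exact this t s (le_of_not_ge hst)
  obtain ⟨h, rfl⟩ := exists_add_of_le hst
  have hdist : nndist s (s + h) = h := by
    rw [NNReal.nndist_eq, tsub_eq_zero_of_le hst, add_tsub_cancel_left, max_eq_right zero_le]
  rw [hdist, hT.add, norm_sub_rev, ← map_sub]
  exact hT.norm_le _ _

theorem continuous_orbit (hT : IsContractionSemigroup T) (f : X) : Continuous fun t => T t f := by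
  refine continuous_iff_continuousAt.2 fun t => tendsto_iff_norm_sub_tendsto_zero.2 ?_
  have hdist : Tendsto (fun s : ℝ≥0 => nndist s t) (𝓝 t) (𝓝 0) :=
    (continuous_id.nndist continuous_const).tendsto' t 0 (nndist_self t)
  exact squeeze_zero (fun _ => norm_nonneg _) (fun s => hT.norm_apply_sub_apply_le s t f)
    ((tendsto_iff_norm_sub_tendsto_zero.1 (hT.continuous f)).comp hdist)

theorem continuous_uncurry (hT : IsContractionSemigroup T) :
    Continuous fun p : ℝ≥0 × X => T p.1 p.2 :=
  continuous_prod_of_continuous_lipschitzWith' _ 1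
    (fun t => LipschitzWith.of_dist_le_mul fun f g => by
      simpa [dist_eq_norm, ← map_sub] using hT.norm_le t (f - g))
    hT.continuous_orbit

theorem hasDerivWithinAt_orbit (hT : IsContractionSemigroup T) (h : IsGenerated T f g) {s : ℝ}
    (hs : 0 ≤ s) :
    HasDerivWithinAt (fun r : ℝ => T r.toNNReal f) (T s.toNNReal g) (Set.Ici s) s := by
  rw [hasDerivWithinAt_iff_tendsto_slope, Set.Ici_sdiff_left]
  refine (((T s.toNNReal).continuous.tendsto g).comp
    (h.comp (tendsto_toNNReal_sub_nhdsGT s))).congr' ?_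
  filter_upwards [self_mem_nhdsWithin] with r (hr : s < r)
  rw [slope, vsub_eq_sub, ← toNNReal_add_toNNReal_sub hs hr.le, hT.add, ← map_sub, ← map_smul,
    Function.comp_apply, Function.comp_apply, Real.coe_toNNReal _ (sub_nonneg.2 hr.le)]

theorem norm_sub_sub_smul_le (hT : IsContractionSemigroup T) (h : IsGenerated T f g) {t : ℝ≥0}
    {δ : ℝ} (hδ : ∀ s ≤ t, ‖T s g - g‖ ≤ δ) : ‖T t f - f - (t : ℝ) • g‖ ≤ δ * t := by
  have hbound := norm_image_sub_le_of_norm_deriv_right_le_segment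
    (f := fun r : ℝ => T r.toNNReal f - r • g) (f' := fun r : ℝ => T r.toNNReal g - g)
    (a := 0) (b := t) (C := δ) ?_ ?_ ?_ t ⟨t.2, le_rfl⟩
  · simpa only [Real.toNNReal_coe, Real.toNNReal_zero, zero_smul, sub_zero, hT.zero,
      sub_right_comm] using hbound
  · exact (((hT.continuous_orbit f).comp continuous_real_toNNReal).sub
      (continuous_id.smul continuous_const)).continuousOn
  · intro r hr
    refine (hT.hasDerivWithinAt_orbit h hr.1).sub ?_
    simpa using ((hasDerivAt_id r).smul_const g).hasDerivWithinAt
  · exact fun r hr => hδ _ (Real.toNNReal_le_iff_le_coe.2 hr.2.le)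

theorem isGenerated_of_norm_sub_sub_smul_le (hT : IsContractionSemigroup T)
    (h : ∀ (t : ℝ≥0) (δ : ℝ), (∀ s ≤ t, ‖T s g - g‖ ≤ δ) →
      ‖T t f - f - (t : ℝ) • g‖ ≤ δ * t) : IsGenerated T f g := by
  rw [IsGenerated, Metric.tendsto_nhds]
  intro ε hε
  obtain ⟨r, hr, hball⟩ := Metric.eventually_nhds_iff.1
    (Metric.tendsto_nhds.1 (hT.continuous g) (ε / 2) (half_pos hε))
  filter_upwards [nhdsWithin_le_nhds (Metric.ball_mem_nhds _ hr), self_mem_nhdsWithin]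
    with t (htr : dist t 0 < r) (ht : 0 < t)
  have ht' : (0 : ℝ) < t := ht
  have hlin : ‖T t f - f - (t : ℝ) • g‖ ≤ ε / 2 * t := h t _ fun s hs => by
    rw [← dist_eq_norm]
    refine (hball (lt_of_le_of_lt ?_ htr)).le
    simpa [NNReal.dist_eq] using hs
  calc dist ((t : ℝ)⁻¹ • (T t f - f)) g
      = (t : ℝ)⁻¹ * ‖T t f - f - (t : ℝ) • g‖ := by
        rw [dist_eq_norm, ← Real.norm_of_nonneg (inv_nonneg.2 t.coe_nonneg), ← norm_smul,
          Real.norm_of_nonneg (inv_nonneg.2 t.coe_nonneg), smul_sub _ _ ((t : ℝ) • g),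
          inv_smul_smul₀ ht'.ne']
    _ ≤ (t : ℝ)⁻¹ * (ε / 2 * t) := by gcongr
    _ = ε / 2 := by field_simp
    _ < ε := half_lt_self hε

theorem isClosed_isGenerated (hT : IsContractionSemigroup T) :
    IsClosed {p : X × X | IsGenerated T p.1 p.2} := by
  refine isClosed_of_closure_subset fun ⟨f, g⟩ hfg =>
    hT.isGenerated_of_norm_sub_sub_smul_le fun t δ hδ => ?_
  have hnear : ∀ p ∈ {p : X × X | IsGenerated T p.1 p.2},
      ‖T t p.1 - p.1 - (t : ℝ) • p.2‖ ≤ (δ + 2 * ‖p.2 - g‖) * t := by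
    refine fun p hp => hT.norm_sub_sub_smul_le hp fun s hs => ?_
    calc ‖T s p.2 - p.2‖ = ‖T s (p.2 - g) + (T s g - g) - (p.2 - g)‖ := by
          rw [map_sub]; congr 1; abel
      _ ≤ ‖T s (p.2 - g)‖ + ‖T s g - g‖ + ‖p.2 - g‖ :=
          (norm_sub_le _ _).trans (add_le_add_left (norm_add_le _ _) _)
      _ ≤ ‖p.2 - g‖ + δ + ‖p.2 - g‖ := by
          gcongr
          exacts [hT.norm_le _ _, hδ s hs]
      _ = δ + 2 * ‖p.2 - g‖ := by ring
  have hlim := le_on_closure hnear (by fun_prop) (by fun_prop) hfg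
  simpa using hlim

theorem hasDerivWithinAt_comp_orbit_eq_zero (hT : IsContractionSemigroup T)
    (hT' : IsContractionSemigroup T') {t : ℝ≥0} {s : ℝ} (hs : s ∈ Set.Ico 0 (t : ℝ))
    (h : IsGenerated T (T s.toNNReal f) g) (h' : IsGenerated T' (T s.toNNReal f) g) :
    HasDerivWithinAt (fun r : ℝ => T' (t - r.toNNReal) (T r.toNNReal f)) 0 (Set.Ici s) s := by
  rw [hasDerivWithinAt_iff_tendsto_slope, Set.Ici_sdiff_left]
  have hdiff := ((Tendsto.sub h h').comp (tendsto_toNNReal_sub_nhdsGT s)).norm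
  rw [sub_self, norm_zero] at hdiff
  refine squeeze_zero_norm' ?_ hdiff
  filter_upwards [self_mem_nhdsWithin, nhdsWithin_le_nhds (Iio_mem_nhds hs.2)]
    with r (hsr : s < r) (hrt : r < t)
  have hr : r.toNNReal = (r - s).toNNReal + s.toNNReal := by
    rw [add_comm, toNNReal_add_toNNReal_sub hs.1 hsr.le]
  have hts : t - s.toNNReal = (t - r.toNNReal) + (r - s).toNNReal := by
    have hrt' : r.toNNReal ≤ t := Real.toNNReal_le_iff_le_coe.2 hrt.le
    rw [← toNNReal_add_toNNReal_sub hs.1 hsr.le] at hrt' ⊢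
    rw [← tsub_tsub, tsub_add_cancel_of_le (le_tsub_of_add_le_left hrt')]
  rw [slope, vsub_eq_sub, hts, hT'.add, ← map_sub, Function.comp_apply, ← smul_sub, norm_smul,
    norm_smul, Real.coe_toNNReal _ (sub_nonneg.2 hsr.le)]
  refine mul_le_mul_of_nonneg_left ((hT'.norm_le _ _).trans_eq ?_) (norm_nonneg _)
  rw [sub_sub_sub_cancel_right, hr, hT.add]

theorem eq_of_isGenerated (hT : IsContractionSemigroup T) (hT' : IsContractionSemigroup T')
    (h : ∀ s, ∃ g, IsGenerated T (T s f) g ∧ IsGenerated T' (T s f) g) (t : ℝ≥0) :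
    T' t f = T t f := by
  have hcont : Continuous fun s : ℝ≥0 => T' (t - s) (T s f) :=
    hT'.continuous_uncurry.comp
      ((continuous_const.sub continuous_id).prodMk (hT.continuous_orbit f))
  have hconst := constant_of_has_deriv_right_zero (hcont.comp continuous_real_toNNReal).continuousOn
    (fun s hs => by
      obtain ⟨g, hg, hg'⟩ := h s.toNNReal
      exact hT.hasDerivWithinAt_comp_orbit_eq_zero hT' hs hg hg') t ⟨t.2, le_rfl⟩
  simpa [hT.zero, hT'.zero] using hconst.symm

end IsContractionSemigroup

end ContractionSemigroup

/-! ### Laplace transforms -/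

section MomentGeneratingFunction

open Complex in
theorem eqOn_complexMGF_of_mgf_eventuallyEq {μ ν : Measure ℝ}
    (hμ : 0 ∈ interior (integrableExpSet id μ)) (hν : 0 ∈ interior (integrableExpSet id ν))
    (h : mgf id μ =ᶠ[𝓝 0] mgf id ν) :
    Set.EqOn (complexMGF id μ) (complexMGF id ν)
      {z : ℂ | z.re ∈ interior (integrableExpSet id μ) ∩ interior (integrableExpSet id ν)} := by
  have hstrip : IsPreconnected
      {z : ℂ | z.re ∈ interior (integrableExpSet id μ) ∩ interior (integrableExpSet id ν)} :=
    ((convex_integrableExpSet.interior.inter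
      convex_integrableExpSet.interior).linear_preimage reLm).isPreconnected
  refine AnalyticOnNhd.eqOn_of_preconnected_of_frequently_eq (z₀ := 0)
    (analyticOnNhd_complexMGF.mono fun z hz => hz.1)
    (analyticOnNhd_complexMGF.mono fun z hz => hz.2) hstrip ⟨hμ, hν⟩ ?_
  have hreal : Tendsto ((↑) : ℝ → ℂ) (𝓝[≠] 0) (𝓝[≠] 0) :=
    tendsto_nhdsWithin_iff.2 ⟨(continuous_ofReal.tendsto' 0 0 ofReal_zero).mono_left
      nhdsWithin_le_nhds, by filter_upwards [self_mem_nhdsWithin] with x hx using by simpa using hx⟩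
  refine hreal.frequently (Eventually.frequently ?_)
  filter_upwards [nhdsWithin_le_nhds h] with t ht
  rw [complexMGF_ofReal, complexMGF_ofReal, ht]

theorem eq_of_mgf_eventuallyEq {μ ν : Measure ℝ} [IsFiniteMeasure μ] [IsFiniteMeasure ν]
    (hμ : 0 ∈ interior (integrableExpSet id μ)) (hν : 0 ∈ interior (integrableExpSet id ν))
    (h : mgf id μ =ᶠ[𝓝 0] mgf id ν) : μ = ν := by
  refine Measure.ext_of_charFun (funext fun t => ?_)
  rw [← complexMGF_id_mul_I, ← complexMGF_id_mul_I]
  exact eqOn_complexMGF_of_mgf_eventuallyEq hμ hν h (by simp [hμ, hν])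

end MomentGeneratingFunction

section Laplace

/-- A coordinate on `E` is a closed embedding into the nonnegative half-line. It allows `ℝ≥0` and
`ℕ` to be treated simultaneously. -/
structure IsCoordinate {E : Type*} [TopologicalSpace E] (ι : E → ℝ) : Prop where
  isClosedEmbedding : IsClosedEmbedding ι
  nonneg : ∀ x, 0 ≤ ι x

theorem isCoordinate_nnreal : IsCoordinate (fun x : ℝ≥0 => (x : ℝ)) :=
  ⟨NNReal.isClosedEmbedding_coe, fun x => x.2⟩

theorem isCoordinate_nat : IsCoordinate (fun n : ℕ => (n : ℝ)) :=
  ⟨Nat.isClosedEmbedding_coe_real, fun n => n.cast_nonneg⟩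

/-- The Laplace transform of a measure with respect to the coordinate `ι`, as an extended
nonnegative number, so that no integrability is presupposed. -/
noncomputable def laplace {E : Type*} [MeasurableSpace E] (ι : E → ℝ) (μ : Measure E) (l : ℝ) :
    ℝ≥0∞ :=
  ∫⁻ x, ENNReal.ofReal (Real.exp (-(l * ι x))) ∂μ

variable {E : Type*} [MeasurableSpace E] {ι : E → ℝ} {μ ν : Measure E}

theorem integral_exp_eq_toReal_laplace (hι : Measurable ι) (l : ℝ) :
    ∫ x, Real.exp (-(l * ι x)) ∂μ = (laplace ι μ l).toReal :=
  integral_eq_lintegral_of_nonneg_ae (ae_of_all _ fun _ => (Real.exp_pos _).le) (by fun_prop)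

theorem withDensity_exp_withDensity_inv (hι : Measurable ι) (l : ℝ) :
    (μ.withDensity fun x => ENNReal.ofReal (Real.exp (-(l * ι x)))).withDensity
      (fun x => ENNReal.ofReal (Real.exp (-(l * ι x))))⁻¹ = μ :=
  withDensity_inv_same (by fun_prop) (ae_of_all _ fun x => by simp [Real.exp_pos])
    (ae_of_all _ fun x => ENNReal.ofReal_ne_top)

theorem sigmaFinite_of_laplace_ne_top (hι : Measurable ι) {l : ℝ} (h : laplace ι μ l ≠ ⊤) :
    SigmaFinite μ := by
  have := isFiniteMeasure_withDensity h
  rw [← withDensity_exp_withDensity_inv (μ := μ) hι l]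
  exact SigmaFinite.withDensity_of_ne_top (ae_of_all _ fun x => by simp [Real.exp_pos])

theorem lintegral_exp_map_withDensity (hι : Measurable ι) (l t : ℝ) :
    ∫⁻ x, ENNReal.ofReal (Real.exp (t * x))
      ∂((μ.withDensity fun x => ENNReal.ofReal (Real.exp (-(l * ι x)))).map ι) =
      laplace ι μ (l - t) := by
  rw [lintegral_map (by fun_prop) hι,
    lintegral_withDensity_eq_lintegral_mul _ (by fun_prop) (by fun_prop), laplace]
  refine lintegral_congr fun x => ?_
  rw [Pi.mul_apply, ← ENNReal.ofReal_mul (Real.exp_pos _).le, ← Real.exp_add]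
  ring_nf

theorem zero_mem_interior_integrableExpSet (hι : Measurable ι) {l : ℝ}
    (h : ∀ᶠ k in 𝓝 l, laplace ι μ k ≠ ⊤) :
    0 ∈ interior (integrableExpSet id
      ((μ.withDensity fun x => ENNReal.ofReal (Real.exp (-(l * ι x)))).map ι)) := by
  have hl : Tendsto (fun t => l - t) (𝓝 0) (𝓝 l) :=
    (continuous_const.sub continuous_id).tendsto' 0 l (sub_zero l)
  refine mem_interior_iff_mem_nhds.2 ((hl.eventually h).mono fun t ht => ⟨by fun_prop, ?_⟩)
  rw [hasFiniteIntegral_iff_ofReal (ae_of_all _ fun _ => (Real.exp_pos _).le)]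
  exact (lintegral_exp_map_withDensity hι l t).trans_lt (lt_top_iff_ne_top.2 ht)

end Laplace

namespace IsCoordinate

variable {E : Type*} [TopologicalSpace E] [MeasurableSpace E] {ι : E → ℝ}
  {μ ν : Measure E}

theorem laplace_ne_top (hι : IsCoordinate ι) [IsFiniteMeasure μ] {l : ℝ} (hl : 0 ≤ l) :
    laplace ι μ l ≠ ⊤ := by
  refine (lt_of_le_of_lt (b := ∫⁻ _, 1 ∂μ) (lintegral_mono fun x => ?_) (by simp)).ne
  rw [← ENNReal.ofReal_one]
  exact ENNReal.ofReal_le_ofReal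
    (Real.exp_le_one_iff.2 (neg_nonpos.2 (mul_nonneg hl (hι.nonneg x))))

variable [BorelSpace E]

theorem measurable (hι : IsCoordinate ι) : Measurable ι :=
  hι.isClosedEmbedding.continuous.measurable

theorem ext_of_laplace (hι : IsCoordinate ι) {l : ℝ}
    (h : ∀ᶠ k in 𝓝 l, laplace ι μ k = laplace ι ν k) (hμ : ∀ᶠ k in 𝓝 l, laplace ι μ k ≠ ⊤) :
    μ = ν := by
  -- Tilting by `exp (-l ι)` turns the Laplace transforms near `l` into moment generating functions
  -- of finite measures near `0`.
  let tilt (ρ : Measure E) : Measure E :=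
    ρ.withDensity fun x => ENNReal.ofReal (Real.exp (-(l * ι x)))
  have hν : ∀ᶠ k in 𝓝 l, laplace ι ν k ≠ ⊤ := by filter_upwards [h, hμ] with k hk hk' using hk ▸ hk'
  have : IsFiniteMeasure (tilt μ) := isFiniteMeasure_withDensity hμ.self_of_nhds
  have : IsFiniteMeasure (tilt ν) := isFiniteMeasure_withDensity hν.self_of_nhds
  have hmgf (ρ : Measure E) (t : ℝ) :
      mgf id ((tilt ρ).map ι) t = (laplace ι ρ (l - t)).toReal := by
    rw [← lintegral_exp_map_withDensity hι.measurable]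
    exact integral_eq_lintegral_of_nonneg_ae (ae_of_all _ fun _ => (Real.exp_pos _).le)
      (by fun_prop)
  have hl : Tendsto (fun t => l - t) (𝓝 0) (𝓝 l) :=
    (continuous_const.sub continuous_id).tendsto' 0 l (sub_zero l)
  have hmap : (tilt μ).map ι = (tilt ν).map ι :=
    eq_of_mgf_eventuallyEq (zero_mem_interior_integrableExpSet hι.measurable hμ)
      (zero_mem_interior_integrableExpSet hι.measurable hν)
      ((hl.eventually h).mono fun t ht => by rw [hmgf, hmgf, ht])
  have hemb := hι.isClosedEmbedding.measurableEmbedding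
  have htilt : tilt μ = tilt ν := by rw [← hemb.comap_map (tilt μ), hmap, hemb.comap_map]
  rw [← withDensity_exp_withDensity_inv (μ := μ) hι.measurable l, ← withDensity_exp_withDensity_inv
    (μ := ν) hι.measurable l]
  exact congrArg (Measure.withDensity · _) htilt

theorem kernel_ext (hι : IsCoordinate ι) {Y : Type*} [MeasurableSpace Y] {κ η : Kernel Y E}
    [IsFiniteKernel κ] (h : ∀ y, ∀ l > 0, laplace ι (κ y) l = laplace ι (η y) l) : κ = η := by
  ext1 y
  have hpos : ∀ᶠ l : ℝ in 𝓝 1, 0 < l := Ioi_mem_nhds one_pos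
  exact hι.ext_of_laplace (hpos.mono (h y)) (hpos.mono fun l hl => hι.laplace_ne_top hl.le)

end IsCoordinate

/-! ### Exponentials in the space of functions vanishing at infinity -/

section StoneWeierstrass

open Polynomial

variable {X : Type*} [TopologicalSpace X] [R1Space X]

/-- The continuous extension by `0` of a function vanishing at infinity to the one-point
compactification. It serves to apply the Stone-Weierstrass theorem on noncompact spaces. -/
def onePointExtension (f : C₀(X, ℝ)) : C(OnePoint X, ℝ) :=
  OnePoint.continuousMapMk f 0 (Filter.coclosedCompact_eq_cocompact (X := X) ▸ f.zero_at_infty')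

theorem onePointExtension_infty (f : C₀(X, ℝ)) : onePointExtension f OnePoint.infty = 0 := rfl

theorem onePointExtension_injective {f : C₀(X, ℝ)} (hf : Function.Injective f)
    (hf0 : ∀ x, f x ≠ 0) : Function.Injective (onePointExtension f) := by
  intro x y hxy
  induction x using OnePoint.rec <;> induction y using OnePoint.rec
  · rfl
  · exact absurd hxy.symm (hf0 _)
  · exact absurd hxy (hf0 _)
  · exact congrArg _ (hf hxy)

theorem exists_polynomial_onePointExtension_near {z : C₀(X, ℝ)} (hz : Function.Injective z)
    (hz0 : ∀ x, z x ≠ 0) (f : C₀(X, ℝ)) {ε : ℝ} (hε : 0 < ε) :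
    ∃ p : ℝ[X], ∀ y, |p.eval (onePointExtension z y) - onePointExtension f y| < ε := by
  have hsep : (Algebra.adjoin ℝ {onePointExtension z}).SeparatesPoints := fun x y hxy =>
    ⟨_, ⟨onePointExtension z, Algebra.subset_adjoin rfl, rfl⟩,
      (onePointExtension_injective hz hz0).ne hxy⟩
  obtain ⟨⟨g, hg⟩, hgf⟩ := ContinuousMap.exists_mem_subalgebra_near_continuousMap_of_separatesPoints
    _ hsep (onePointExtension f) ε hε
  rw [Algebra.adjoin_singleton_eq_range_aeval] at hg
  obtain ⟨p, rfl⟩ := hg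
  refine ⟨p, fun y => ?_⟩
  simpa [Polynomial.aeval_continuousMap_apply] using
    (ContinuousMap.norm_coe_le_norm _ y).trans_lt hgf

theorem exists_polynomial_mul_near {z : C₀(X, ℝ)} (hz : Function.Injective z)
    (hz0 : ∀ x, z x ≠ 0) (f : C₀(X, ℝ)) {ε : ℝ} (hε : 0 < ε) :
    ∃ q : ℝ[X], ∀ x, |z x * q.eval (z x) - f x| ≤ ε := by
  obtain ⟨p, hp⟩ := exists_polynomial_onePointExtension_near hz hz0 f (half_pos hε)
  refine ⟨p.divX, fun x => ?_⟩
  have hconst : |p.eval 0| < ε / 2 := by simpa [onePointExtension_infty] using hp OnePoint.infty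
  have hdiv : z x * p.divX.eval (z x) = p.eval (z x) - p.eval 0 := by
    conv_rhs => enter [1]; rw [← p.divX_mul_X_add]
    rw [eval_add, eval_mul, eval_X, eval_C, p.coeff_zero_eq_eval_zero, add_sub_cancel_right,
      mul_comm]
  calc |z x * p.divX.eval (z x) - f x| = |(p.eval (z x) - f x) - p.eval 0| := by
        rw [hdiv, sub_right_comm]
    _ ≤ |p.eval (z x) - f x| + |p.eval 0| := abs_sub _ _
    _ ≤ ε / 2 + ε / 2 := add_le_add (hp x).le hconst.le
    _ = ε := add_halves ε

end StoneWeierstrass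

section C0Norm

variable {X : Type*} [TopologicalSpace X]

theorem C0_norm_le {f : C₀(X, ℝ)} {C : ℝ} (hC : 0 ≤ C) (h : ∀ x, |f x| ≤ C) : ‖f‖ ≤ C := by
  rw [← ZeroAtInftyContinuousMap.norm_toBCF_eq_norm]
  exact (BoundedContinuousFunction.norm_le hC).2 h

theorem C0_abs_le_norm (f : C₀(X, ℝ)) (x : X) : |f x| ≤ ‖f‖ := by
  rw [← ZeroAtInftyContinuousMap.norm_toBCF_eq_norm]
  exact f.toBCF.norm_coe_le_norm x

/-- A continuous function with compact support, as a function vanishing at infinity. -/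
def compactSupportC0 (f : X → ℝ) (hf : Continuous f) (hc : HasCompactSupport f) : C₀(X, ℝ) where
  toFun := f
  continuous_toFun := hf
  zero_at_infty' := hc.is_zero_at_infty

end C0Norm

namespace IsCoordinate

open Polynomial

variable {E : Type*} [TopologicalSpace E] {ι : E → ℝ}

/-- The function `x ↦ exp (-l * ι x)`, as a function vanishing at infinity. These exponentials are
the test functions on which kernels and generators are compared. -/
noncomputable def expC0 (hι : IsCoordinate ι) (l : ℝ) (hl : 0 < l) : C₀(E, ℝ) where
  toFun x := Real.exp (-(l * ι x))
  continuous_toFun := by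
    have := hι.isClosedEmbedding.continuous
    fun_prop
  zero_at_infty' := by
    have habs : Tendsto (fun x => |ι x|) (cocompact E) atTop :=
      (tendsto_norm_cocompact_atTop (E := ℝ)).comp hι.isClosedEmbedding.tendsto_cocompact
    simp only [abs_of_nonneg (hι.nonneg _)] at habs
    exact Real.tendsto_exp_neg_atTop_nhds_zero.comp (habs.const_mul_atTop hl)

@[simp]
theorem expC0_apply (hι : IsCoordinate ι) (l : ℝ) (hl : 0 < l) (x : E) :
    hι.expC0 l hl x = Real.exp (-(l * ι x)) := rfl

theorem expC0_injective (hι : IsCoordinate ι) {l : ℝ} (hl : 0 < l) :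
    Function.Injective (hι.expC0 l hl) := fun _ _ hxy =>
  hι.isClosedEmbedding.injective
    (mul_left_cancel₀ hl.ne' (neg_injective (Real.exp_injective hxy)))

theorem exists_mem_eq_exp_mul_eval (hι : IsCoordinate ι) {M : Submodule ℝ C₀(E, ℝ)}
    (hM : ∀ l hl, hι.expC0 l hl ∈ M) (q : ℝ[X]) :
    ∃ g ∈ M, ∀ x, g x = hι.expC0 1 one_pos x * q.eval (hι.expC0 1 one_pos x) := by
  induction q using Polynomial.induction_on' with
  | add p q hp hq =>
    obtain ⟨g, hg, hgp⟩ := hp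
    obtain ⟨k, hk, hkq⟩ := hq
    exact ⟨g + k, M.add_mem hg hk, fun x => by simp [hgp, hkq, mul_add]⟩
  | monomial n a =>
    refine ⟨a • hι.expC0 (n + 1) (by positivity), M.smul_mem _ (hM _ _), fun x => ?_⟩
    simp only [ZeroAtInftyContinuousMap.smul_apply, expC0_apply, smul_eq_mul, eval_monomial]
    rw [← Real.exp_nat_mul, mul_left_comm, ← Real.exp_add]
    ring_nf

theorem eq_top_of_expC0_mem (hι : IsCoordinate ι) {M : Submodule ℝ C₀(E, ℝ)}
    (hclosed : IsClosed (M : Set C₀(E, ℝ))) (hM : ∀ l hl, hι.expC0 l hl ∈ M) : M = ⊤ := by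
  have : T2Space E := hι.isClosedEmbedding.isEmbedding.t2Space
  refine eq_top_iff.2 fun f _ => hclosed.closure_subset (Metric.mem_closure_iff.2 fun ε hε => ?_)
  obtain ⟨q, hq⟩ := exists_polynomial_mul_near (hι.expC0_injective one_pos)
    (fun x => (Real.exp_pos _).ne') f (half_pos hε)
  obtain ⟨g, hg, hgq⟩ := hι.exists_mem_eq_exp_mul_eval hM q
  refine ⟨g, hg, ?_⟩
  rw [dist_comm, dist_eq_norm]
  refine (C0_norm_le (half_pos hε).le fun x => ?_).trans_lt (half_lt_self hε)
  rw [ZeroAtInftyContinuousMap.sub_apply, hgq]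
  exact hq x

end IsCoordinate

/-! ### Markov kernels acting on functions vanishing at infinity -/

section KernelOperator

theorem exists_C0_eq_of_approx {X : Type*} [TopologicalSpace X] {F : X → ℝ}
    (h : ∀ ε > 0, ∃ g : C₀(X, ℝ), ∀ x, |g x - F x| ≤ ε) : ∃ g : C₀(X, ℝ), ∀ x, g x = F x := by
  have hcont : Continuous F := by
    refine continuous_of_uniform_approx_of_continuous fun u hu => ?_
    obtain ⟨ε, hε, hu⟩ := Metric.uniformity_basis_dist_le.mem_iff.1 hu
    obtain ⟨g, hg⟩ := h ε hε
    exact ⟨g, g.continuous, fun x => hu ((dist_comm _ _).trans_le (hg x))⟩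
  refine ⟨⟨⟨F, hcont⟩, Metric.tendsto_nhds.2 fun ε hε => ?_⟩, fun x => rfl⟩
  obtain ⟨g, hg⟩ := h (ε / 2) (half_pos hε)
  filter_upwards [Metric.tendsto_nhds.1 g.zero_at_infty' (ε / 2) (half_pos hε)] with x hx
  calc dist (F x) 0 ≤ dist (g x) (F x) + dist (g x) 0 := dist_triangle_left _ _ _
    _ < ε / 2 + ε / 2 := add_lt_add_of_le_of_lt (hg x) hx
    _ = ε := add_halves ε

theorem C0_integrable {X : Type*} [TopologicalSpace X] [MeasurableSpace X]
    [OpensMeasurableSpace X] (f : C₀(X, ℝ)) (μ : Measure X) [IsFiniteMeasure μ] :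
    Integrable f μ :=
  f.toBCF.integrable μ

theorem abs_integral_C0_le {X : Type*} [TopologicalSpace X] [MeasurableSpace X] (f : C₀(X, ℝ))
    (μ : Measure X) [IsProbabilityMeasure μ] : |∫ x, f x ∂μ| ≤ ‖f‖ := by
  simpa using norm_integral_le_of_norm_le_const (μ := μ) (f := f)
    (ae_of_all _ fun x => C0_abs_le_norm f x)

variable {X Y Z : Type*} [TopologicalSpace X] [MeasurableSpace X] [TopologicalSpace Y]
  [MeasurableSpace Y] [TopologicalSpace Z] [MeasurableSpace Z]

theorem IsC0Operator.eq {κ : Kernel X Y} {S T : C₀(Y, ℝ) →L[ℝ] C₀(X, ℝ)} (hS : IsC0Operator κ S)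
    (hT : IsC0Operator κ T) : S = T := by
  ext f x
  rw [hS f x, hT f x]

theorem IsC0Operator.comp [OpensMeasurableSpace Z] {κ : Kernel X Y} {η : Kernel Y Z}
    [IsFiniteKernel κ] [IsFiniteKernel η] {S : C₀(Y, ℝ) →L[ℝ] C₀(X, ℝ)}
    {T : C₀(Z, ℝ) →L[ℝ] C₀(Y, ℝ)} (hS : IsC0Operator κ S) (hT : IsC0Operator η T) :
    IsC0Operator (η ∘ₖ κ) (S ∘L T) := fun f x => by
  rw [Kernel.integral_comp (C0_integrable f _), ContinuousLinearMap.comp_apply, hS]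
  simp only [hT f _]

theorem IsC0Operator.norm_apply_le {κ : Kernel X Y} [IsMarkovKernel κ]
    {T : C₀(Y, ℝ) →L[ℝ] C₀(X, ℝ)} (hT : IsC0Operator κ T) (f : C₀(Y, ℝ)) : ‖T f‖ ≤ ‖f‖ :=
  C0_norm_le (norm_nonneg f) fun x => by
    rw [hT]
    exact abs_integral_C0_le f _

variable [OpensMeasurableSpace Y]

/-- The functions vanishing at infinity which the kernel `κ` maps to functions vanishing at
infinity. -/
def C0Preimage (κ : Kernel X Y) [IsFiniteKernel κ] : Submodule ℝ C₀(Y, ℝ) where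
  carrier := {f | ∃ g : C₀(X, ℝ), ∀ x, g x = ∫ y, f y ∂(κ x)}
  add_mem' := by
    rintro f f' ⟨g, hg⟩ ⟨g', hg'⟩
    refine ⟨g + g', fun x => ?_⟩
    rw [ZeroAtInftyContinuousMap.add_apply, hg, hg',
      ← integral_add (C0_integrable f _) (C0_integrable f' _)]
    rfl
  zero_mem' := ⟨0, fun x => by simp⟩
  smul_mem' := by
    rintro c f ⟨g, hg⟩
    refine ⟨c • g, fun x => ?_⟩
    rw [ZeroAtInftyContinuousMap.smul_apply, hg, smul_eq_mul, ← integral_const_mul]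
    rfl

theorem isClosed_C0Preimage (κ : Kernel X Y) [IsMarkovKernel κ] :
    IsClosed (C0Preimage κ : Set C₀(Y, ℝ)) := by
  refine isClosed_of_closure_subset fun f hf => exists_C0_eq_of_approx fun ε hε => ?_
  obtain ⟨f', ⟨g, hg⟩, hdist⟩ := Metric.mem_closure_iff.1 hf ε hε
  refine ⟨g, fun x => ?_⟩
  rw [hg, ← integral_sub (C0_integrable _ _) (C0_integrable _ _)]
  refine (abs_integral_C0_le (f' - f) (κ x)).trans ?_
  rw [← dist_eq_norm, dist_comm]
  exact hdist.le

theorem IsCoordinate.C0Preimage_eq_top {ι : Y → ℝ} (hι : IsCoordinate ι) {κ : Kernel X Y}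
    [IsMarkovKernel κ] (h : ∀ l hl, hι.expC0 l hl ∈ C0Preimage κ) : C0Preimage κ = ⊤ :=
  hι.eq_top_of_expC0_mem (isClosed_C0Preimage κ) h

/-- The operator on functions vanishing at infinity given by a Markov kernel. -/
noncomputable def C0Operator {κ : Kernel X Y} [IsMarkovKernel κ] (hκ : C0Preimage κ = ⊤) :
    C₀(Y, ℝ) →L[ℝ] C₀(X, ℝ) :=
  have hex (f : C₀(Y, ℝ)) : f ∈ C0Preimage κ := hκ ▸ Submodule.mem_top
  LinearMap.mkContinuous
    { toFun := fun f => (hex f).choose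
      map_add' := fun f g => by
        ext x
        rw [ZeroAtInftyContinuousMap.add_apply, (hex _).choose_spec, (hex _).choose_spec,
          (hex _).choose_spec, ← integral_add (C0_integrable f _) (C0_integrable g _)]
        rfl
      map_smul' := fun c f => by
        ext x
        rw [RingHom.id_apply, ZeroAtInftyContinuousMap.smul_apply, (hex _).choose_spec,
          (hex _).choose_spec, smul_eq_mul, ← integral_const_mul]
        rfl } 1
    fun f => by
      rw [one_mul]
      refine C0_norm_le (norm_nonneg f) fun x => ?_
      change |(hex f).choose x| ≤ _
      rw [(hex f).choose_spec]
      exact abs_integral_C0_le f _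

theorem isC0Operator_C0Operator {κ : Kernel X Y} [IsMarkovKernel κ] (hκ : C0Preimage κ = ⊤) :
    IsC0Operator κ (C0Operator hκ) := fun f =>
  (show f ∈ C0Preimage κ from hκ ▸ Submodule.mem_top).choose_spec

end KernelOperator

theorem isClosed_setOf_tendsto_of_norm_apply_le {X ι : Type*} [NormedAddCommGroup X]
    [NormedSpace ℝ X] {T : ι → X →L[ℝ] X} (hT : ∀ i f, ‖T i f‖ ≤ ‖f‖) (𝓕 : Filter ι) :
    IsClosed {f | Tendsto (T · f) 𝓕 (𝓝 f)} :=
  (LipschitzWith.uniformEquicontinuous (fun i => T i) 1 fun i => LipschitzWith.of_dist_le_mul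
    fun f g => by simpa [dist_eq_norm] using hT i (f - g)).equicontinuous
      |>.isClosed_setOfPred_tendsto continuous_id

theorem IsCoordinate.tendsto_apply_of_tendsto_apply_expC0 {E α : Type*}
    [TopologicalSpace E] {ι : E → ℝ} (hι : IsCoordinate ι) {𝓕 : Filter α}
    {T : α → C₀(E, ℝ) →L[ℝ] C₀(E, ℝ)} (hT : ∀ t f, ‖T t f‖ ≤ ‖f‖)
    (h : ∀ l hl, Tendsto (fun t => T t (hι.expC0 l hl)) 𝓕 (𝓝 (hι.expC0 l hl))) (f : C₀(E, ℝ)) :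
    Tendsto (fun t => T t f) 𝓕 (𝓝 f) := by
  let M : Submodule ℝ C₀(E, ℝ) :=
    { carrier := {f | Tendsto (fun t => T t f) 𝓕 (𝓝 f)}
      add_mem' := fun hf hg => by simpa using Tendsto.add hf hg
      zero_mem' := by simp [tendsto_const_nhds]
      smul_mem' := fun c f hf => by simpa using Tendsto.const_smul hf c }
  have hM : M = ⊤ :=
    hι.eq_top_of_expC0_mem (isClosed_setOf_tendsto_of_norm_apply_le hT 𝓕) h
  exact (hM ▸ Submodule.mem_top : f ∈ M)

section Feller

variable {E : Type*} [TopologicalSpace E] [MeasurableSpace E] [BorelSpace E]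
  {P P' : ℝ≥0 → Kernel E E}

namespace IsFellerSemigroup

/-- The contraction semigroup on functions vanishing at infinity of a Feller semigroup. -/
noncomputable def op (hP : IsFellerSemigroup P) (t : ℝ≥0) : C₀(E, ℝ) →L[ℝ] C₀(E, ℝ) :=
  haveI := hP.markov t
  C0Operator (κ := P t) (eq_top_iff.2 fun f _ => hP.mapsTo t f)

theorem isC0Operator_op (hP : IsFellerSemigroup P) (t : ℝ≥0) : IsC0Operator (P t) (hP.op t) :=
  haveI := hP.markov t
  isC0Operator_C0Operator _

theorem op_apply (hP : IsFellerSemigroup P) (t : ℝ≥0) (f : C₀(E, ℝ)) (x : E) :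
    hP.op t f x = ∫ y, f y ∂(P t x) :=
  hP.isC0Operator_op t f x

theorem isContractionSemigroup (hP : IsFellerSemigroup P) : IsContractionSemigroup hP.op where
  norm_le t :=
    haveI := hP.markov t
    (hP.isC0Operator_op t).norm_apply_le
  zero f := by
    ext x
    rw [hP.op_apply, hP.zero, Kernel.id_apply,
      integral_dirac' (fun y => f y) x f.continuous.stronglyMeasurable]
  add s t f := by
    have := hP.markov
    have hop := hP.isC0Operator_op (s + t)
    rw [hP.add] at hop
    exact DFunLike.congr_fun (hop.eq ((hP.isC0Operator_op s).comp (hP.isC0Operator_op t))) f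
  continuous f := by
    rw [ZeroAtInftyContinuousMap.tendsto_iff_tendstoUniformly]
    simpa only [← hP.op_apply] using hP.continuous f

theorem inGenerator_iff (hP : IsFellerSemigroup P) (f g : C₀(E, ℝ)) :
    InGenerator P f g ↔ IsGenerated hP.op f g := by
  rw [IsGenerated, ZeroAtInftyContinuousMap.tendsto_iff_tendstoUniformly, InGenerator]
  refine tendstoUniformly_congr (Eventually.of_forall fun t => funext fun x => ?_)
  simp [hP.op_apply, div_eq_inv_mul]

end IsFellerSemigroup

namespace IsCoordinate

theorem isFellerSemigroup {ι : E → ℝ} (hι : IsCoordinate ι)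
    (hP : ∀ t, IsMarkovKernel (P t)) (h0 : P 0 = Kernel.id) (hadd : ∀ s t, P (s + t) = P t ∘ₖ P s)
    (hmaps : ∀ t l hl, hι.expC0 l hl ∈ C0Preimage (P t))
    (hcont : ∀ l hl, TendstoUniformly (fun (t : ℝ≥0) (x : E) => ∫ y, hι.expC0 l hl y ∂(P t x))
      (hι.expC0 l hl) (𝓝 0)) : IsFellerSemigroup P := by
  have hpre (t : ℝ≥0) : C0Preimage (P t) = ⊤ := hι.C0Preimage_eq_top (hmaps t)
  have hop (t : ℝ≥0) : IsC0Operator (P t) (C0Operator (hpre t)) := isC0Operator_C0Operator _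
  have huniform (f : C₀(E, ℝ)) :
      Tendsto (fun t => C0Operator (hpre t) f) (𝓝 0) (𝓝 f) ↔
        TendstoUniformly (fun (t : ℝ≥0) (x : E) => ∫ y, f y ∂(P t x)) f (𝓝 0) := by
    rw [ZeroAtInftyContinuousMap.tendsto_iff_tendstoUniformly]
    exact tendstoUniformly_congr (Eventually.of_forall fun t => funext (hop t f))
  exact ⟨hP, h0, hadd, fun t f => ⟨_, hop t f⟩, fun f => (huniform f).1
    (hι.tendsto_apply_of_tendsto_apply_expC0 (fun t => (hop t).norm_apply_le)
      (fun l hl => (huniform _).2 (hcont l hl)) f)⟩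

theorem fellerSemigroup_eq {ι : E → ℝ} (hι : IsCoordinate ι) (hP : IsFellerSemigroup P)
    (hP' : IsFellerSemigroup P')
    (h : ∀ l hl s, ∃ g, IsGenerated hP.op (hP.op s (hι.expC0 l hl)) g ∧
      IsGenerated hP'.op (hP.op s (hι.expC0 l hl)) g) : P' = P := by
  have := hP.markov
  have := hP'.markov
  refine funext fun t => hι.kernel_ext fun x l hl => ?_
  have hop := DFunLike.congr_fun (hP.isContractionSemigroup.eq_of_isGenerated
    hP'.isContractionSemigroup (h l hl) t) x
  rw [hP.op_apply, hP'.op_apply] at hop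
  simp only [expC0_apply, integral_exp_eq_toReal_laplace hι.measurable] at hop
  exact (ENNReal.toReal_eq_toReal_iff' (hι.laplace_ne_top hl.le) (hι.laplace_ne_top hl.le)).1 hop

end IsCoordinate

end Feller

/-! ### Laplace transforms of the gateway kernels -/

section GammaGateway

theorem gammaLaw_zero : gammaLaw 0 = Measure.dirac 0 := if_pos rfl

theorem gammaLaw_eq_withDensity {a : ℝ} (ha : a ≠ 0) : gammaLaw a =
    (besselMeasure a).withDensity fun x : ℝ≥0 => ENNReal.ofReal (Real.exp (-x)) := by
  have hdensity : gammaPDF a 1 = (Set.Ici 0).indicator fun x => ENNReal.ofReal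
      (x ^ (a - 1) / Real.Gamma a) * ENNReal.ofReal (Real.exp (-(x.toNNReal : ℝ))) := by
    ext x
    rcases le_or_gt 0 x with hx | hx
    · rw [Set.indicator_of_mem (Set.mem_Ici.2 hx), gammaPDF_of_nonneg hx, Real.coe_toNNReal x hx,
        ← ENNReal.ofReal_mul' (Real.exp_pos _).le, Real.one_rpow, one_mul]
      ring_nf
    · rw [Set.indicator_of_notMem (by simpa using hx), gammaPDF_of_neg hx]
  refine Measure.ext_of_lintegral _ fun g hg => ?_
  rw [gammaLaw, if_neg ha, gammaMeasure, hdensity, withDensity_indicator measurableSet_Ici,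
    Measure.restrict_congr_set Ioi_ae_eq_Ici.symm, besselMeasure, lintegral_map hg (by fun_prop),
    lintegral_withDensity_eq_lintegral_mul _ (by fun_prop) (by fun_prop),
    lintegral_withDensity_eq_lintegral_mul _ (by fun_prop) hg,
    lintegral_map (by fun_prop) (by fun_prop),
    lintegral_withDensity_eq_lintegral_mul _ (by fun_prop) (by fun_prop)]
  simp only [Pi.mul_apply, mul_assoc]

theorem lintegral_rpow_mul_exp {a r : ℝ} (ha : 0 < a) (hr : 0 < r) :
    ∫⁻ x in Set.Ioi (0 : ℝ), ENNReal.ofReal (x ^ (a - 1) * Real.exp (-(r * x))) =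
      ENNReal.ofReal (r ^ (-a) * Real.Gamma a) := by
  have := Real.Gamma_pos_of_pos ha
  have h := Real.integral_rpow_mul_exp_neg_mul_Ioi ha hr
  rw [one_div, Real.inv_rpow hr.le, ← Real.rpow_neg hr.le] at h
  rw [← h, ofReal_integral_eq_lintegral_ofReal]
  · refine Integrable.of_integral_ne_zero ?_
    rw [h]
    positivity
  · refine (ae_restrict_iff' measurableSet_Ioi).2 (ae_of_all _ fun x (hx : 0 < x) => ?_)
    exact mul_nonneg (Real.rpow_nonneg hx.le _) (Real.exp_pos _).le

theorem lintegral_rpow_mul_exp_besselMeasure {β : ℝ} (hβ : 0 < β) {l : ℝ} (hl : 0 < l) {k : ℝ}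
    (hk : 0 ≤ k) :
    ∫⁻ x, ENNReal.ofReal ((x : ℝ) ^ k * Real.exp (-(l * x))) ∂(besselMeasure β) =
      ENNReal.ofReal (Real.Gamma (β + k) / Real.Gamma β * l ^ (-(β + k))) := by
  have := Real.Gamma_pos_of_pos hβ
  rw [besselMeasure, lintegral_map (by fun_prop) (by fun_prop),
    lintegral_withDensity_eq_lintegral_mul _ (by fun_prop) (by fun_prop)]
  calc _ = ∫⁻ x in Set.Ioi (0 : ℝ), ENNReal.ofReal (1 / Real.Gamma β) *
        ENNReal.ofReal (x ^ (β + k - 1) * Real.exp (-(l * x))) := by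
        refine setLIntegral_congr_fun measurableSet_Ioi fun x (hx : 0 < x) => ?_
        simp only [Pi.mul_apply, Real.coe_toNNReal x hx.le]
        rw [← ENNReal.ofReal_mul (by positivity), ← ENNReal.ofReal_mul (by positivity),
          show β + k - 1 = (β - 1) + k by ring, Real.rpow_add hx]
        ring_nf
    _ = _ := by
        rw [lintegral_const_mul _ (by fun_prop), lintegral_rpow_mul_exp (by linarith) hl,
          ← ENNReal.ofReal_mul (by positivity)]
        ring_nf

theorem lintegral_rpow_mul_exp_gammaLaw {a : ℝ} (ha : 0 < a) {l : ℝ} (hl : -1 < l) {k : ℝ}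
    (hk : 0 ≤ k) :
    ∫⁻ x, ENNReal.ofReal ((x : ℝ) ^ k * Real.exp (-(l * x))) ∂(gammaLaw a) =
      ENNReal.ofReal (Real.Gamma (a + k) / Real.Gamma a * (1 + l) ^ (-(a + k))) := by
  rw [gammaLaw_eq_withDensity ha.ne', ← lintegral_rpow_mul_exp_besselMeasure ha (by linarith) hk,
    lintegral_withDensity_eq_lintegral_mul _ (by fun_prop) (by fun_prop)]
  refine lintegral_congr fun x => ?_
  rw [Pi.mul_apply, ← ENNReal.ofReal_mul (Real.exp_pos _).le, mul_left_comm, ← Real.exp_add]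
  ring_nf

theorem laplace_besselMeasure {β : ℝ} (hβ : 0 < β) {l : ℝ} (hl : 0 < l) :
    laplace (fun x : ℝ≥0 => (x : ℝ)) (besselMeasure β) l = ENNReal.ofReal (l ^ (-β)) := by
  have h := lintegral_rpow_mul_exp_besselMeasure hβ hl le_rfl
  simpa [laplace, (Real.Gamma_pos_of_pos hβ).ne'] using h

theorem laplace_gammaLaw {a : ℝ} (ha : 0 ≤ a) {l : ℝ} (hl : -1 < l) :
    laplace (fun x : ℝ≥0 => (x : ℝ)) (gammaLaw a) l = ENNReal.ofReal ((1 + l) ^ (-a)) := by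
  rcases ha.eq_or_lt with rfl | ha
  · simp [laplace, gammaLaw_zero]
  · have h := lintegral_rpow_mul_exp_gammaLaw ha hl le_rfl
    simpa [laplace, (Real.Gamma_pos_of_pos ha).ne'] using h

theorem isProbabilityMeasure_gammaLaw {a : ℝ} (ha : 0 ≤ a) : IsProbabilityMeasure (gammaLaw a) :=
  ⟨by simpa [laplace] using laplace_gammaLaw ha (l := 0) (by norm_num)⟩

theorem isMarkovKernel_gammaGateway {β : ℝ} (hβ : 0 ≤ β) : IsMarkovKernel (gammaGateway β) :=
  ⟨fun n => isProbabilityMeasure_gammaLaw (add_nonneg n.cast_nonneg hβ)⟩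

theorem rpow_neg_natCast_add {c : ℝ} (hc : 0 < c) (n : ℕ) (β : ℝ) :
    c ^ (-((n : ℝ) + β)) = c ^ (-β) * c⁻¹ ^ n := by
  rw [neg_add, Real.rpow_add hc, Real.rpow_neg hc.le, Real.rpow_natCast, inv_pow, mul_comm]

theorem laplace_gammaGateway {β : ℝ} (hβ : 0 ≤ β) (n : ℕ) {l : ℝ} (hl : -1 < l) :
    laplace (fun x : ℝ≥0 => (x : ℝ)) (gammaGateway β n) l =
      ENNReal.ofReal ((1 + l) ^ (-β) * (1 + l)⁻¹ ^ n) := by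
  change laplace _ (gammaLaw (n + β)) l = _
  rw [laplace_gammaLaw (by positivity) hl, rpow_neg_natCast_add (by linarith)]

end GammaGateway

section PoissonGateway

theorem isMarkovKernel_poissonGateway : IsMarkovKernel poissonGateway :=
  ⟨fun x => inferInstanceAs (IsProbabilityMeasure (poissonMeasure x))⟩

theorem lintegral_pow_poissonGateway (x : ℝ≥0) {s : ℝ} (hs : 0 ≤ s) :
    ∫⁻ n, ENNReal.ofReal (s ^ n) ∂(poissonGateway x) =
      ENNReal.ofReal (Real.exp (-((1 - s) * x))) := by
  change ∫⁻ n, ENNReal.ofReal (s ^ n) ∂(poissonMeasure x) = _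
  have h : HasSum (fun n : ℕ => Real.exp (-x) * (x : ℝ) ^ n / n ! * s ^ n)
      (Real.exp (-((1 - s) * x))) := by
    have := (NormedSpace.expSeries_div_hasSum_exp ((x : ℝ) * s)).mul_left (Real.exp (-x))
    rw [← Real.exp_eq_exp_ℝ, ← Real.exp_add] at this
    rw [show -((1 - s) * x) = -x + x * s by ring]
    exact this.congr_fun fun n => by ring
  rw [poissonMeasure, lintegral_sum_measure, ← h.tsum_eq,
    ENNReal.ofReal_tsum_of_nonneg (fun n => by positivity) h.summable]
  refine tsum_congr fun n => ?_
  rw [lintegral_smul_measure, lintegral_dirac, smul_eq_mul, ← ENNReal.ofReal_mul (by positivity)]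

theorem laplace_natCast (μ : Measure ℕ) (l : ℝ) :
    laplace (fun n : ℕ => (n : ℝ)) μ l = ∫⁻ n, ENNReal.ofReal (Real.exp (-l) ^ n) ∂μ := by
  refine lintegral_congr fun n => ?_
  rw [← Real.exp_nat_mul]
  ring_nf

theorem laplace_map_mul (μ : Measure ℝ≥0) (t : ℝ≥0) (l : ℝ) :
    laplace (fun x : ℝ≥0 => (x : ℝ)) (μ.map (t * ·)) l =
      laplace (fun x : ℝ≥0 => (x : ℝ)) μ (l * t) := by
  rw [laplace, lintegral_map (by fun_prop) (by fun_prop), laplace]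
  simp only [NNReal.coe_mul, mul_assoc]

theorem laplace_bind {X E : Type*} [MeasurableSpace X] [MeasurableSpace E] {ι : E → ℝ}
    (hι : Measurable ι) (κ : Kernel X E) (μ : Measure X) (l : ℝ) :
    laplace ι (κ ∘ₘ μ) l = ∫⁻ x, laplace ι (κ x) l ∂μ :=
  Measure.lintegral_bind κ.measurable.aemeasurable (by fun_prop)

theorem laplace_gammaGateway_comp_poissonGateway {β : ℝ} (hβ : 0 ≤ β) (x : ℝ≥0) {l : ℝ}
    (hl : 0 ≤ l) :
    laplace (fun x : ℝ≥0 => (x : ℝ)) ((gammaGateway β ∘ₖ poissonGateway) x) l =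
      ENNReal.ofReal ((1 + l) ^ (-β) * Real.exp (-(l / (1 + l) * x))) := by
  rw [Kernel.comp_apply, laplace_bind (by fun_prop)]
  simp only [laplace_gammaGateway hβ _ (by linarith : -1 < l),
    ENNReal.ofReal_mul (by positivity : 0 ≤ (1 + l) ^ (-β))]
  rw [lintegral_const_mul _ (by fun_prop), lintegral_pow_poissonGateway _ (by positivity),
    show 1 - (1 + l)⁻¹ = l / (1 + l) by field_simp; ring]

end PoissonGateway

/-! ### The transition kernels -/

section Transition

/-- The transition kernels of the squared Bessel semigroup: at time `1` the Poisson kernel followed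
by the gamma kernel, and at time `t` the same kernel conjugated by the dilation by `t`. -/
noncomputable def besselKernel (β : ℝ) (t : ℝ≥0) : Kernel ℝ≥0 ℝ≥0 :=
  if t = 0 then Kernel.id
  else ((gammaGateway β ∘ₖ poissonGateway).comap (fun x => x / t) (by fun_prop)).map (t * ·)

theorem besselKernel_zero (β : ℝ) : besselKernel β 0 = Kernel.id := if_pos rfl

theorem isMarkovKernel_besselKernel {β : ℝ} (hβ : 0 ≤ β) (t : ℝ≥0) :
    IsMarkovKernel (besselKernel β t) := by
  have := isMarkovKernel_gammaGateway hβ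
  have := isMarkovKernel_poissonGateway
  rw [besselKernel]
  split_ifs with h
  · infer_instance
  · exact Kernel.IsMarkovKernel.map _ (by fun_prop)

theorem laplace_besselKernel {β : ℝ} (hβ : 0 ≤ β) (t x : ℝ≥0) {l : ℝ} (hl : 0 ≤ l) :
    laplace (fun x : ℝ≥0 => (x : ℝ)) (besselKernel β t x) l =
      ENNReal.ofReal ((1 + l * t) ^ (-β) * Real.exp (-(l / (1 + l * t) * x))) := by
  rcases eq_or_ne t 0 with rfl | ht
  · rw [besselKernel_zero, Kernel.id_apply, laplace, lintegral_dirac' _ (by fun_prop)]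
    simp
  · have ht' : (t : ℝ) ≠ 0 := by exact_mod_cast ht
    rw [besselKernel, if_neg ht, Kernel.map_apply _ (by fun_prop), laplace_map_mul,
      Kernel.comap_apply, laplace_gammaGateway_comp_poissonGateway hβ _ (by positivity)]
    congr 4
    push_cast
    field_simp

/-- The transition kernels of the linear birth-death semigroup. Each of the `n` initial individuals
has living descendants at time `t` with probability `1 / (1 + t)`, independently of the others;
given that `k` of them do, the population is `k` plus a Poisson variable whose parameter is `t`
times a gamma variable of shape parameter `k + β`. -/
noncomputable def birthDeathKernel (β : ℝ) (t : ℝ≥0) : Kernel ℕ ℕ where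
  toFun n := ∑ k ∈ Finset.range (n + 1),
    ENNReal.ofReal ((1 / (1 + t : ℝ)) ^ k * (t / (1 + t : ℝ)) ^ (n - k) * n.choose k) •
      (poissonGateway ∘ₘ ((gammaLaw (k + β)).map (t * ·))).map (k + ·)
  measurable' := measurable_of_countable _

theorem lintegral_pow_poissonGateway_map_gammaLaw {a : ℝ} (ha : 0 ≤ a) (t : ℝ≥0) {s : ℝ}
    (hs : s ∈ Set.Icc 0 1) :
    ∫⁻ m, ENNReal.ofReal (s ^ m) ∂(poissonGateway ∘ₘ ((gammaLaw a).map (t * ·))) =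
      ENNReal.ofReal ((1 + t * (1 - s)) ^ (-a)) := by
  have hs' : 0 ≤ 1 - s := sub_nonneg.2 hs.2
  rw [Measure.lintegral_bind poissonGateway.measurable.aemeasurable (by fun_prop)]
  simp only [lintegral_pow_poissonGateway _ hs.1]
  change laplace (fun x : ℝ≥0 => (x : ℝ)) _ (1 - s) = _
  rw [laplace_map_mul, laplace_gammaLaw ha (neg_one_lt_zero.trans_le (by positivity)), mul_comm]

theorem lintegral_pow_birthDeathKernel {β : ℝ} (hβ : 0 ≤ β) (t : ℝ≥0) (n : ℕ) {s : ℝ}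
    (hs : s ∈ Set.Icc 0 1) : ∫⁻ m, ENNReal.ofReal (s ^ m) ∂(birthDeathKernel β t n) =
      ENNReal.ofReal ((1 + t * (1 - s)) ^ (-β) * (1 - (1 - s) / (1 + t * (1 - s))) ^ n) := by
  have hs0 : 0 ≤ s := hs.1
  have hs' : 0 ≤ 1 - s := sub_nonneg.2 hs.2
  have hancestors (k : ℕ) : ∫⁻ m, ENNReal.ofReal (s ^ m)
      ∂((poissonGateway ∘ₘ ((gammaLaw (k + β)).map (t * ·))).map (k + ·)) =
      ENNReal.ofReal (s ^ k * (1 + t * (1 - s)) ^ (-(k + β))) := by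
    rw [lintegral_map (by fun_prop) (by fun_prop)]
    simp only [pow_add, ENNReal.ofReal_mul (pow_nonneg hs0 k)]
    rw [lintegral_const_mul _ (by fun_prop),
      lintegral_pow_poissonGateway_map_gammaLaw (by positivity) t hs]
  change ∫⁻ m, ENNReal.ofReal (s ^ m) ∂(∑ k ∈ Finset.range (n + 1), _) = _
  rw [lintegral_finsetSum_measure]
  simp only [lintegral_smul_measure, hancestors, smul_eq_mul]
  calc _ = ∑ k ∈ Finset.range (n + 1), ENNReal.ofReal ((1 + t * (1 - s)) ^ (-β) *
        ((s * (1 / (1 + t)) * (1 + t * (1 - s))⁻¹) ^ k * (t / (1 + t : ℝ)) ^ (n - k)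
          * n.choose k)) := by
        refine Finset.sum_congr rfl fun k _ => ?_
        rw [← ENNReal.ofReal_mul (by positivity), rpow_neg_natCast_add (by positivity)]
        ring_nf
    _ = _ := by
        rw [← ENNReal.ofReal_sum_of_nonneg (fun k _ => by positivity), ← Finset.mul_sum, ← add_pow]
        congr 3
        field_simp
        ring

theorem isMarkovKernel_birthDeathKernel {β : ℝ} (hβ : 0 ≤ β) (t : ℝ≥0) :
    IsMarkovKernel (birthDeathKernel β t) :=
  ⟨fun n => ⟨by simpa using lintegral_pow_birthDeathKernel hβ t n (s := 1) (by simp)⟩⟩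

end Transition

/-! ### Affine semigroups -/

section AffineSemigroup

theorem pow_mul_exp_neg_le {m : ℝ} (hm : 0 < m) (k : ℕ) {x : ℝ} (hx : 0 ≤ x) :
    x ^ k * Real.exp (-(m * x)) ≤ k ! / m ^ k := by
  have h := Real.pow_div_factorial_le_exp (m * x) (by positivity) k
  rw [Real.exp_neg, ← div_eq_mul_inv, div_le_div_iff₀ (Real.exp_pos _) (by positivity)]
  rw [div_le_iff₀ (by positivity), mul_pow] at h
  linarith

theorem abs_exp_sub_one_sub_le (u : ℝ) :
    |Real.exp u - 1 - u| ≤ u ^ 2 * Real.exp |u| := by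
  rw [sub_sub, ← Real.norm_eq_abs, ← Complex.norm_real]
  simpa [Finset.sum_range_succ] using Complex.norm_exp_sub_sum_le_norm_mul_exp u 2

theorem abs_exp_sub_exp_add_le {k l x : ℝ} (hk : |k - l| ≤ l / 2) (hx : 0 ≤ x) :
    |Real.exp (-(k * x)) - Real.exp (-(l * x)) + (k - l) * (x * Real.exp (-(l * x)))| ≤
      (k - l) ^ 2 * (x ^ 2 * Real.exp (-(l / 2 * x))) := by
  set u := -((k - l) * x) with hu
  have hexp : Real.exp (-(k * x)) = Real.exp (-(l * x)) * Real.exp u := by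
    rw [← Real.exp_add, hu]
    ring_nf
  have habs : |u| ≤ l / 2 * x := by
    rw [hu, abs_neg, abs_mul, abs_of_nonneg hx]
    gcongr
  calc _ = Real.exp (-(l * x)) * |Real.exp u - 1 - u| := by
        rw [← abs_of_pos (Real.exp_pos (-(l * x))), ← abs_mul, abs_of_pos (Real.exp_pos _), hexp]
        congr 1
        ring
    _ ≤ Real.exp (-(l * x)) * (u ^ 2 * Real.exp (l / 2 * x)) := by
        gcongr
        exact (abs_exp_sub_one_sub_le u).trans (by gcongr)
    _ = (k - l) ^ 2 * (x ^ 2 * (Real.exp (-(l * x)) * Real.exp (l / 2 * x))) := by ring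
    _ = _ := by
        rw [← Real.exp_add]
        ring_nf

variable {E : Type*} [TopologicalSpace E] {ι : E → ℝ}

namespace IsCoordinate

/-- The function `x ↦ ι x * exp (-l * ι x)`, as a function vanishing at infinity. It is minus the
derivative of `x ↦ exp (-l * ι x)` with respect to `l`. -/
noncomputable def mulExpC0 (hι : IsCoordinate ι) (l : ℝ) (hl : 0 < l) : C₀(E, ℝ) where
  toFun x := ι x * Real.exp (-(l * ι x))
  continuous_toFun := by
    have := hι.isClosedEmbedding.continuous
    fun_prop
  zero_at_infty' := by
    have hlim := (hι.expC0 (l / 2) (half_pos hl)).zero_at_infty'.const_mul (1 ! / (l / 2) ^ 1)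
    rw [mul_zero] at hlim
    refine squeeze_zero (fun x => mul_nonneg (hι.nonneg x) (Real.exp_pos _).le) (fun x => ?_) hlim
    calc ι x * Real.exp (-(l * ι x))
        = ι x ^ 1 * Real.exp (-(l / 2 * ι x)) * Real.exp (-(l / 2 * ι x)) := by
          rw [mul_assoc, ← Real.exp_add]
          ring_nf
      _ ≤ _ := mul_le_mul_of_nonneg_right (pow_mul_exp_neg_le (half_pos hl) 1 (hι.nonneg x))
          (Real.exp_pos _).le

@[simp]
theorem mulExpC0_apply (hι : IsCoordinate ι) (l : ℝ) (hl : 0 < l) (x : E) :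
    hι.mulExpC0 l hl x = ι x * Real.exp (-(l * ι x)) := rfl

/-- The curve `l ↦ (x ↦ exp (-l * ι x))` of functions vanishing at infinity, with the junk value
`0` for `l ≤ 0`. -/
noncomputable def expCurve (hι : IsCoordinate ι) (l : ℝ) : C₀(E, ℝ) :=
  if hl : 0 < l then hι.expC0 l hl else 0

theorem expCurve_of_pos (hι : IsCoordinate ι) {l : ℝ} (hl : 0 < l) :
    hι.expCurve l = hι.expC0 l hl := dif_pos hl

theorem hasDerivAt_expCurve (hι : IsCoordinate ι) {l : ℝ} (hl : 0 < l) :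
    HasDerivAt hι.expCurve (-hι.mulExpC0 l hl) l := by
  have hsq : (fun k => (k - l) ^ 2) =o[𝓝 l] fun k => k - l := by
    simpa using Asymptotics.isLittleO_pow_sub_sub l one_lt_two
  refine hasDerivAt_iff_isLittleO.2 (Asymptotics.IsBigO.trans_isLittleO
    (.of_bound (2 ! / (l / 2) ^ 2) ?_) hsq)
  filter_upwards [Metric.closedBall_mem_nhds l (half_pos hl)] with k hk
  rw [Metric.mem_closedBall, Real.dist_eq] at hk
  have hk0 : 0 < k := by linarith [(abs_le.1 hk).1]
  rw [hι.expCurve_of_pos hk0, hι.expCurve_of_pos hl]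
  refine C0_norm_le (by positivity) fun x => ?_
  calc |(hι.expC0 k hk0 - hι.expC0 l hl - (k - l) • -hι.mulExpC0 l hl) x|
      = |Real.exp (-(k * ι x)) - Real.exp (-(l * ι x))
          + (k - l) * (ι x * Real.exp (-(l * ι x)))| := by
        simp
    _ ≤ (k - l) ^ 2 * (ι x ^ 2 * Real.exp (-(l / 2 * ι x))) :=
        abs_exp_sub_exp_add_le hk (hι.nonneg x)
    _ ≤ (k - l) ^ 2 * (2 ! / (l / 2) ^ 2) := by
        gcongr
        exact pow_mul_exp_neg_le (half_pos hl) 2 (hι.nonneg x)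
    _ = 2 ! / (l / 2) ^ 2 * ‖(k - l) ^ 2‖ := by
        rw [Real.norm_of_nonneg (by positivity), mul_comm]

end IsCoordinate

variable [MeasurableSpace E] {P P' : ℝ≥0 → Kernel E E} {c k : ℝ → ℝ → ℝ} {c' k' : ℝ → ℝ}

/-- `P` is the transition function of an affine process: the Laplace transform at `l` of `P t x` is
`c l t * exp (-(k l t) * ι x)`, where `c l` and `k l` satisfy the corresponding cocycle equations
and have derivatives `c' l` and `k' l` at time `0`. The squared Bessel and the linear birth-death
semigroups are both of this kind. -/
structure IsAffineSemigroup (ι : E → ℝ) (P : ℝ≥0 → Kernel E E) (c k : ℝ → ℝ → ℝ)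
    (c' k' : ℝ → ℝ) : Prop where
  markov : ∀ t, IsMarkovKernel (P t)
  coeff_nonneg : ∀ l > 0, ∀ t : ℝ≥0, 0 ≤ c l t
  rate_pos : ∀ l > 0, ∀ t : ℝ≥0, 0 < k l t
  laplace_eq : ∀ l > 0, ∀ (t : ℝ≥0) (x : E),
    laplace ι (P t x) l = ENNReal.ofReal (c l t * Real.exp (-(k l t * ι x)))
  coeff_zero : ∀ l > 0, c l 0 = 1
  rate_zero : ∀ l > 0, k l 0 = l
  coeff_add : ∀ l > 0, ∀ s t : ℝ≥0, c l (s + t) = c l t * c (k l t) s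
  rate_add : ∀ l > 0, ∀ s t : ℝ≥0, k l (s + t) = k (k l t) s
  hasDerivAt_coeff : ∀ l > 0, HasDerivAt (c l) (c' l) 0
  hasDerivAt_rate : ∀ l > 0, HasDerivAt (k l) (k' l) 0

namespace IsAffineSemigroup

theorem integral_expC0 [BorelSpace E] (hP : IsAffineSemigroup ι P c k c' k') (hι : IsCoordinate ι)
    {l : ℝ} (hl : 0 < l) (t : ℝ≥0) (x : E) :
    ∫ y, hι.expC0 l hl y ∂(P t x) = (c l t • hι.expC0 (k l t) (hP.rate_pos l hl t)) x := by
  simp only [IsCoordinate.expC0_apply]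
  rw [integral_exp_eq_toReal_laplace hι.measurable, hP.laplace_eq l hl, ENNReal.toReal_ofReal
    (mul_nonneg (hP.coeff_nonneg l hl t) (Real.exp_pos _).le)]
  rfl

theorem zero [BorelSpace E] (hP : IsAffineSemigroup ι P c k c' k') (hι : IsCoordinate ι) :
    P 0 = Kernel.id := by
  have := hP.markov
  have := hι.measurable
  refine hι.kernel_ext fun x l hl => ?_
  rw [hP.laplace_eq l hl, NNReal.coe_zero, hP.coeff_zero l hl, hP.rate_zero l hl, one_mul,
    Kernel.id_apply, laplace, lintegral_dirac' _ (by fun_prop)]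

theorem add [BorelSpace E] (hP : IsAffineSemigroup ι P c k c' k') (hι : IsCoordinate ι)
    (s t : ℝ≥0) : P (s + t) = P t ∘ₖ P s := by
  have := hP.markov
  have := hι.measurable
  refine hι.kernel_ext fun x l hl => ?_
  have hrate := hP.rate_pos l hl t
  calc laplace ι (P (s + t) x) l = ENNReal.ofReal (c l t)
        * ENNReal.ofReal (c (k l t) s * Real.exp (-(k (k l t) s * ι x))) := by
        rw [hP.laplace_eq l hl, NNReal.coe_add, hP.coeff_add l hl, hP.rate_add l hl, mul_assoc,
          ENNReal.ofReal_mul (hP.coeff_nonneg l hl t)]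
    _ = ENNReal.ofReal (c l t) * ∫⁻ y, ENNReal.ofReal (Real.exp (-(k l t * ι y))) ∂(P s x) := by
        rw [← hP.laplace_eq _ hrate, laplace]
    _ = laplace ι ((P t ∘ₖ P s) x) l := by
        rw [Kernel.comp_apply, laplace_bind this, ← lintegral_const_mul _ (by fun_prop)]
        simp only [hP.laplace_eq l hl, ENNReal.ofReal_mul (hP.coeff_nonneg l hl t)]

theorem hasDerivAt_smul_expCurve (hP : IsAffineSemigroup ι P c k c' k') (hι : IsCoordinate ι)
    {l : ℝ} (hl : 0 < l) : HasDerivAt (fun t => c l t • hι.expCurve (k l t))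
      (c' l • hι.expC0 l hl - k' l • hι.mulExpC0 l hl) 0 := by
  have hcurve : HasDerivAt hι.expCurve (-hι.mulExpC0 l hl) (k l 0) := by
    rw [hP.rate_zero l hl]
    exact hι.hasDerivAt_expCurve hl
  refine ((hP.hasDerivAt_coeff l hl).smul
    (hcurve.scomp 0 (hP.hasDerivAt_rate l hl))).congr_deriv ?_
  rw [Function.comp_apply, hP.rate_zero l hl, hP.coeff_zero l hl, hι.expCurve_of_pos hl, one_smul,
    smul_neg, add_comm, sub_eq_add_neg]

variable [BorelSpace E]

theorem isFellerSemigroup (hP : IsAffineSemigroup ι P c k c' k') (hι : IsCoordinate ι) :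
    IsFellerSemigroup P := by
  refine hι.isFellerSemigroup hP.markov (hP.zero hι) (hP.add hι)
    (fun t l hl => ⟨_, fun x => (hP.integral_expC0 hι hl t x).symm⟩) fun l hl => ?_
  have hlim := ((hP.hasDerivAt_smul_expCurve hι hl).continuousAt.tendsto.comp
    (NNReal.continuous_coe.tendsto' 0 0 NNReal.coe_zero))
  rw [hP.coeff_zero l hl, hP.rate_zero l hl, one_smul, hι.expCurve_of_pos hl,
    ZeroAtInftyContinuousMap.tendsto_iff_tendstoUniformly] at hlim
  refine (tendstoUniformly_congr (Eventually.of_forall fun t => funext fun x => ?_)).1 hlim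
  rw [hP.integral_expC0 hι, Function.comp_apply, hι.expCurve_of_pos (hP.rate_pos l hl t)]

theorem op_expC0 (hP : IsAffineSemigroup ι P c k c' k') (hι : IsCoordinate ι) {l : ℝ} (hl : 0 < l)
    (t : ℝ≥0) : (hP.isFellerSemigroup hι).op t (hι.expC0 l hl) =
      c l t • hι.expC0 (k l t) (hP.rate_pos l hl t) := by
  ext x
  rw [IsFellerSemigroup.op_apply, hP.integral_expC0 hι]

theorem isGenerated_expC0 (hP : IsAffineSemigroup ι P c k c' k') (hι : IsCoordinate ι) {l : ℝ}
    (hl : 0 < l) : IsGenerated (hP.isFellerSemigroup hι).op (hι.expC0 l hl)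
      (c' l • hι.expC0 l hl - k' l • hι.mulExpC0 l hl) := by
  have hcoe : Tendsto ((↑) : ℝ≥0 → ℝ) (𝓝[>] 0) (𝓝[>] 0) :=
    tendsto_nhdsWithin_iff.2 ⟨(NNReal.continuous_coe.tendsto' 0 0 NNReal.coe_zero).mono_left
      nhdsWithin_le_nhds, eventually_mem_nhdsWithin⟩
  refine ((hP.hasDerivAt_smul_expCurve hι hl).tendsto_slope_zero_right.comp hcoe).congr fun t => ?_
  rw [Function.comp_apply, zero_add, hP.coeff_zero l hl, hP.rate_zero l hl, one_smul,
    hι.expCurve_of_pos hl, hι.expCurve_of_pos (hP.rate_pos l hl t), hP.op_expC0 hι]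

theorem eq_of_isGenerated_expC0 (hP : IsAffineSemigroup ι P c k c' k') (hι : IsCoordinate ι)
    (hP' : IsFellerSemigroup P') (h : ∀ l hl, IsGenerated hP'.op (hι.expC0 l hl)
      (c' l • hι.expC0 l hl - k' l • hι.mulExpC0 l hl)) : P' = P := by
  refine hι.fellerSemigroup_eq (hP.isFellerSemigroup hι) hP' fun l hl s => ?_
  rw [hP.op_expC0 hι]
  exact ⟨_, (hP.isGenerated_expC0 hι _).smul _, (h _ _).smul _⟩

end IsAffineSemigroup

end AffineSemigroup

/-! ### The affine structure of the transition kernels and the intertwinings -/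

section Intertwining

variable {β : ℝ}

theorem hasDerivAt_one_add_mul_rpow_neg (u β : ℝ) :
    HasDerivAt (fun t => (1 + u * t) ^ (-β)) (-(β * u)) 0 := by
  have hlin : HasDerivAt (fun t => 1 + u * t) u 0 := by
    simpa using ((hasDerivAt_id (0 : ℝ)).const_mul u).const_add 1
  refine (hlin.rpow_const (Or.inl (by simp))).congr_deriv ?_
  simp [mul_comm]

theorem hasDerivAt_div_one_add_mul (u : ℝ) :
    HasDerivAt (fun t => u / (1 + u * t)) (-u ^ 2) 0 := by
  have hlin : HasDerivAt (fun t => 1 + u * t) u 0 := by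
    simpa using ((hasDerivAt_id (0 : ℝ)).const_mul u).const_add 1
  refine ((hasDerivAt_const _ u).div hlin (by simp)).congr_deriv ?_
  simp [sq]

theorem isAffineSemigroup_besselKernel (hβ : 0 ≤ β) :
    IsAffineSemigroup (fun x : ℝ≥0 => (x : ℝ)) (besselKernel β)
      (fun l t => (1 + l * t) ^ (-β)) (fun l t => l / (1 + l * t))
      (fun l => -(β * l)) (fun l => -l ^ 2) where
  markov := isMarkovKernel_besselKernel hβ
  coeff_nonneg l hl t := by positivity
  rate_pos l hl t := by positivity
  laplace_eq l hl t x := laplace_besselKernel hβ t x hl.le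
  coeff_zero l _ := by simp
  rate_zero l _ := by simp
  coeff_add l hl s t := by
    rw [← Real.mul_rpow (by positivity) (by positivity)]
    congr 1
    field_simp
    ring
  rate_add l hl s t := by
    field_simp
    ring
  hasDerivAt_coeff l _ := hasDerivAt_one_add_mul_rpow_neg l β
  hasDerivAt_rate l _ := hasDerivAt_div_one_add_mul l

theorem div_one_add_mul_lt_one {u t : ℝ} (hu0 : 0 ≤ u) (hu : u < 1) (ht : 0 ≤ t) :
    u / (1 + t * u) < 1 :=
  (div_le_self hu0 (le_add_of_nonneg_right (mul_nonneg ht hu0))).trans_lt hu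

theorem one_sub_exp_neg_mem_Ioo {l : ℝ} (hl : 0 < l) : 1 - Real.exp (-l) ∈ Set.Ioo (0 : ℝ) 1 :=
  ⟨sub_pos.2 (Real.exp_lt_one_iff.2 (neg_lt_zero.2 hl)), sub_lt_self 1 (Real.exp_pos _)⟩

theorem isAffineSemigroup_birthDeathKernel (hβ : 0 ≤ β) :
    IsAffineSemigroup (fun n : ℕ => (n : ℝ)) (birthDeathKernel β)
      (fun l t => (1 + t * (1 - Real.exp (-l))) ^ (-β))
      (fun l t => -Real.log (1 - (1 - Real.exp (-l)) / (1 + t * (1 - Real.exp (-l)))))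
      (fun l => -(β * (1 - Real.exp (-l)))) (fun l => -((1 - Real.exp (-l)) ^ 2 / Real.exp (-l)))
    where
  markov := isMarkovKernel_birthDeathKernel hβ
  coeff_nonneg l hl t := by
    have := (one_sub_exp_neg_mem_Ioo hl).1
    positivity
  rate_pos l hl t := by
    obtain ⟨hu0, hu1⟩ := one_sub_exp_neg_mem_Ioo hl
    exact neg_pos.2 (Real.log_neg (sub_pos.2 (div_one_add_mul_lt_one hu0.le hu1 t.coe_nonneg))
      (sub_lt_self 1 (by positivity)))
  laplace_eq l hl t n := by
    obtain ⟨hu0, hu1⟩ := one_sub_exp_neg_mem_Ioo hl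
    rw [laplace_natCast, lintegral_pow_birthDeathKernel hβ t n
      ⟨(Real.exp_pos _).le, (sub_pos.1 hu0).le⟩, neg_mul, neg_neg, mul_comm _ (n : ℝ),
      Real.exp_nat_mul, Real.exp_log (sub_pos.2 (div_one_add_mul_lt_one hu0.le hu1 t.coe_nonneg))]
  coeff_zero l _ := by simp
  rate_zero l _ := by simp
  coeff_add l hl s t := by
    obtain ⟨hu0, hu1⟩ := one_sub_exp_neg_mem_Ioo hl
    rw [neg_neg, Real.exp_log (sub_pos.2 (div_one_add_mul_lt_one hu0.le hu1 t.coe_nonneg)),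
      sub_sub_cancel, ← Real.mul_rpow (by positivity) (by positivity)]
    congr 1
    field_simp
    ring
  rate_add l hl s t := by
    obtain ⟨hu0, hu1⟩ := one_sub_exp_neg_mem_Ioo hl
    rw [neg_neg, Real.exp_log (sub_pos.2 (div_one_add_mul_lt_one hu0.le hu1 t.coe_nonneg)),
      sub_sub_cancel]
    congr 3
    field_simp
    ring
  hasDerivAt_coeff l _ := by
    simpa only [mul_comm] using hasDerivAt_one_add_mul_rpow_neg (1 - Real.exp (-l)) β
  hasDerivAt_rate l _ := by
    have hrate := hasDerivAt_div_one_add_mul (1 - Real.exp (-l))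
    simp only [mul_comm (1 - Real.exp (-l))] at hrate
    refine ((hrate.const_sub 1).log (by simp)).neg.congr_deriv ?_
    simp

theorem laplace_poissonGateway (x : ℝ≥0) (l : ℝ) :
    laplace (fun n : ℕ => (n : ℝ)) (poissonGateway x) l =
      ENNReal.ofReal (Real.exp (-((1 - Real.exp (-l)) * x))) := by
  rw [laplace_natCast, lintegral_pow_poissonGateway x (Real.exp_pos _).le]

theorem laplace_besselKernel_comp_gammaGateway (hβ : 0 ≤ β) (t : ℝ≥0) (n : ℕ) {l : ℝ}
    (hl : 0 ≤ l) :
    laplace (fun x : ℝ≥0 => (x : ℝ)) ((besselKernel β t ∘ₖ gammaGateway β) n) l =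
      ENNReal.ofReal ((1 + l * t) ^ (-β) *
        ((1 + l / (1 + l * t)) ^ (-β) * (1 + l / (1 + l * t))⁻¹ ^ n)) := by
  have hrate : 0 ≤ l / (1 + l * t) := by positivity
  rw [Kernel.comp_apply, laplace_bind (by fun_prop)]
  simp only [laplace_besselKernel hβ _ _ hl,
    ENNReal.ofReal_mul (by positivity : 0 ≤ (1 + l * (t : ℝ)) ^ (-β))]
  rw [lintegral_const_mul _ (by fun_prop), ← laplace_gammaGateway hβ n (by linarith), laplace]

theorem laplace_gammaGateway_comp_birthDeathKernel (hβ : 0 ≤ β) (t : ℝ≥0) (n : ℕ) {l : ℝ}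
    (hl : 0 ≤ l) :
    laplace (fun x : ℝ≥0 => (x : ℝ)) ((gammaGateway β ∘ₖ birthDeathKernel β t) n) l =
      ENNReal.ofReal ((1 + l) ^ (-β) * ((1 + t * (1 - (1 + l)⁻¹)) ^ (-β) *
        (1 - (1 - (1 + l)⁻¹) / (1 + t * (1 - (1 + l)⁻¹))) ^ n)) := by
  rw [Kernel.comp_apply, laplace_bind (by fun_prop)]
  simp only [laplace_gammaGateway hβ _ (by linarith : -1 < l),
    ENNReal.ofReal_mul (by positivity : 0 ≤ (1 + l) ^ (-β))]
  rw [lintegral_const_mul _ (by fun_prop), lintegral_pow_birthDeathKernel hβ t n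
    ⟨by positivity, inv_le_one_of_one_le₀ (by linarith)⟩]

theorem besselKernel_comp_gammaGateway (hβ : 0 ≤ β) (t : ℝ≥0) :
    besselKernel β t ∘ₖ gammaGateway β = gammaGateway β ∘ₖ birthDeathKernel β t := by
  have := isMarkovKernel_gammaGateway hβ
  have := isMarkovKernel_besselKernel hβ t
  refine isCoordinate_nnreal.kernel_ext fun n l hl => ?_
  have hden : 1 + (t : ℝ) * (1 - (1 + l)⁻¹) = (1 + l * t + l) / (1 + l) := by
    field_simp
    ring
  rw [laplace_besselKernel_comp_gammaGateway hβ t n hl.le,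
    laplace_gammaGateway_comp_birthDeathKernel hβ t n hl.le, hden, ← mul_assoc, ← mul_assoc,
    ← Real.mul_rpow (by positivity) (by positivity),
    ← Real.mul_rpow (by positivity) (by positivity)]
  congr 3
  · field_simp
  · field_simp
    ring

theorem birthDeathKernel_comp_poissonGateway (hβ : 0 ≤ β) (t : ℝ≥0) :
    birthDeathKernel β t ∘ₖ poissonGateway = poissonGateway ∘ₖ besselKernel β t := by
  have := isMarkovKernel_poissonGateway
  have := isMarkovKernel_birthDeathKernel hβ t
  refine isCoordinate_nat.kernel_ext fun x l hl => ?_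
  obtain ⟨hu0, hu1⟩ := one_sub_exp_neg_mem_Ioo hl
  have hleft : laplace (fun n : ℕ => (n : ℝ)) ((birthDeathKernel β t ∘ₖ poissonGateway) x) l =
      ENNReal.ofReal ((1 + t * (1 - Real.exp (-l))) ^ (-β) *
        Real.exp (-((1 - Real.exp (-l)) / (1 + t * (1 - Real.exp (-l))) * x))) := by
    rw [Kernel.comp_apply, laplace_bind (by fun_prop)]
    simp only [laplace_natCast, lintegral_pow_birthDeathKernel hβ t _
      ⟨(Real.exp_pos _).le, (sub_pos.1 hu0).le⟩,
      ENNReal.ofReal_mul (by positivity : 0 ≤ (1 + t * (1 - Real.exp (-l))) ^ (-β))]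
    rw [lintegral_const_mul _ (by fun_prop), lintegral_pow_poissonGateway _
      (sub_pos.2 (div_one_add_mul_lt_one hu0.le hu1 t.coe_nonneg)).le, sub_sub_cancel]
  rw [hleft, Kernel.comp_apply, laplace_bind (by fun_prop)]
  simp only [laplace_poissonGateway]
  rw [mul_comm (t : ℝ)]
  exact (laplace_besselKernel hβ t x hu0.le).symm

theorem gammaGateway_comp_poissonGateway (hβ : 0 ≤ β) :
    gammaGateway β ∘ₖ poissonGateway = besselKernel β 1 := by
  have := isMarkovKernel_poissonGateway
  have := isMarkovKernel_gammaGateway hβ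
  refine isCoordinate_nnreal.kernel_ext fun x l hl => ?_
  rw [laplace_gammaGateway_comp_poissonGateway hβ x hl.le, laplace_besselKernel hβ _ _ hl.le,
    NNReal.coe_one, mul_one]

theorem C0Preimage_poissonGateway :
    haveI := isMarkovKernel_poissonGateway
    C0Preimage poissonGateway = ⊤ := by
  have := isMarkovKernel_poissonGateway
  refine isCoordinate_nat.C0Preimage_eq_top fun l hl =>
    ⟨isCoordinate_nnreal.expC0 (1 - Real.exp (-l)) (one_sub_exp_neg_mem_Ioo hl).1, fun x => ?_⟩
  simp only [IsCoordinate.expC0_apply]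
  rw [integral_exp_eq_toReal_laplace (by fun_prop), laplace_poissonGateway,
    ENNReal.toReal_ofReal (Real.exp_pos _).le]

theorem C0Preimage_gammaGateway (hβ : 0 ≤ β) :
    haveI := isMarkovKernel_gammaGateway hβ
    C0Preimage (gammaGateway β) = ⊤ := by
  have := isMarkovKernel_gammaGateway hβ
  refine isCoordinate_nnreal.C0Preimage_eq_top fun l hl =>
    ⟨(1 + l) ^ (-β) • isCoordinate_nat.expC0 (Real.log (1 + l)) (Real.log_pos (by linarith)),
      fun n => ?_⟩
  simp only [IsCoordinate.expC0_apply, ZeroAtInftyContinuousMap.smul_apply, smul_eq_mul]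
  rw [integral_exp_eq_toReal_laplace (by fun_prop), laplace_gammaGateway hβ _ (by linarith),
    ENNReal.toReal_ofReal (by positivity), mul_comm (Real.log _), ← mul_neg, Real.exp_nat_mul,
    Real.exp_neg, Real.exp_log (by positivity)]

end Intertwining

/-! ### The birth-death semigroup -/

section BirthDeath

/-- The operator `(n + β) ∂₊ + n ∂₋` on all functions on the nonnegative integers. -/
def birthDeathGen (β : ℝ) : (ℕ → ℝ) →ₗ[ℝ] ℕ → ℝ where
  toFun f n := ((n : ℝ) + β) * (f (n + 1) - f n) + (n : ℝ) * (f (n - 1) - f n)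
  map_add' f g := by
    ext n
    simp only [Pi.add_apply]
    ring
  map_smul' a f := by
    ext n
    simp only [Pi.smul_apply, smul_eq_mul, RingHom.id_apply]
    ring

theorem birthDeathGen_apply (β : ℝ) (f : ℕ → ℝ) (n : ℕ) : birthDeathGen β f n =
    ((n : ℝ) + β) * (f (n + 1) - f n) + (n : ℝ) * (f (n - 1) - f n) := rfl

theorem birthDeathGen_exp (β l : ℝ) (n : ℕ) :
    birthDeathGen β (fun n : ℕ => Real.exp (-(l * n))) n =
      -(β * (1 - Real.exp (-l))) * Real.exp (-(l * n)) +
        (1 - Real.exp (-l)) ^ 2 / Real.exp (-l) * (n * Real.exp (-(l * n))) := by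
  have hpow (m : ℕ) : Real.exp (-(l * m)) = Real.exp (-l) ^ m := by
    rw [← Real.exp_nat_mul, mul_neg, mul_comm]
  have hne := (Real.exp_pos (-l)).ne'
  simp only [birthDeathGen_apply, hpow]
  rcases n with _ | n
  · simp only [CharP.cast_eq_zero]
    ring
  · rw [Nat.add_sub_cancel]
    field_simp
    ring

theorem finite_support_birthDeathGen (β : ℝ) {f : ℕ → ℝ} (hf : f.support.Finite) :
    (birthDeathGen β f).support.Finite := by
  have hzero : ∀ᶠ n in atTop, f n = 0 := by
    rw [← Nat.cofinite_eq_atTop]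
    exact hf
  have hgen : ∀ᶠ n in atTop, birthDeathGen β f n = 0 := by
    filter_upwards [hzero, (tendsto_add_atTop_nat 1).eventually hzero,
      (tendsto_sub_atTop_nat 1).eventually hzero] with n h h_succ h_pred
    rw [birthDeathGen_apply, h, h_succ, h_pred, sub_zero, mul_zero, mul_zero, add_zero]
  rw [← Nat.cofinite_eq_atTop] at hgen
  exact hgen

theorem exists_abs_birthDeathGen_le {β m : ℝ} (hβ : 0 ≤ β) (hm : 0 < m) :
    ∃ K ≥ 0, ∀ (ε : ℝ) (d : ℕ → ℝ), (∀ n : ℕ, |d n| ≤ ε * Real.exp (-(m * n))) →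
      ∀ n, |birthDeathGen β d n| ≤ ε * K := by
  refine ⟨(Real.exp m + 3) * (1 ! / m ^ 1) + 2 * β, by positivity, fun ε d hd n => ?_⟩
  have hε : 0 ≤ ε := by simpa using (abs_nonneg _).trans (hd 0)
  have hn : (0 : ℝ) ≤ n := n.cast_nonneg
  set w := Real.exp (-(m * n)) with hw
  have hsucc : |d (n + 1)| ≤ ε * w := by
    refine (hd _).trans ?_
    rw [hw]
    gcongr
    exact n.le_succ
  have hpred : |d (n - 1)| ≤ ε * (Real.exp m * w) := by
    refine (hd _).trans ?_
    rw [hw, ← Real.exp_add]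
    gcongr
    have : (n : ℝ) ≤ (n - 1 : ℕ) + 1 := by exact_mod_cast (by omega : n ≤ n - 1 + 1)
    nlinarith
  have hw1 : w ≤ 1 := Real.exp_le_one_iff.2 (neg_nonpos.2 (by positivity))
  have hnw : n * w ≤ 1 ! / m ^ 1 := by simpa using pow_mul_exp_neg_le hm 1 hn
  calc |birthDeathGen β d n|
      ≤ (n + β) * (|d (n + 1)| + |d n|) + n * (|d (n - 1)| + |d n|) := by
        rw [birthDeathGen_apply]
        refine (abs_add_le _ _).trans ?_
        rw [abs_mul, abs_mul, abs_of_nonneg hn, abs_of_nonneg (add_nonneg hn hβ)]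
        gcongr <;> exact abs_sub _ _
    _ ≤ (n + β) * (ε * w + ε * w) + n * (ε * (Real.exp m * w) + ε * w) := by
        gcongr <;> exact hd n
    _ = ε * ((Real.exp m + 3) * (n * w) + 2 * β * w) := by ring
    _ ≤ ε * ((Real.exp m + 3) * (1 ! / m ^ 1) + 2 * β * 1) := by gcongr
    _ = _ := by rw [mul_one]

variable {β : ℝ} {T : ℝ≥0 → C₀(ℕ, ℝ) →L[ℝ] C₀(ℕ, ℝ)}

/-- The functions in the domain of the generator of `T` on which it acts as `birthDeathGen β`. -/
def birthDeathDomain (β : ℝ) (T : ℝ≥0 → C₀(ℕ, ℝ) →L[ℝ] C₀(ℕ, ℝ)) : Submodule ℝ C₀(ℕ, ℝ) where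
  carrier := {f | ∃ g, IsGenerated T f g ∧ ⇑g = birthDeathGen β f}
  zero_mem' := ⟨0, by simp [IsGenerated], by simp⟩
  add_mem' := by
    rintro f f' ⟨g, hg, hgf⟩ ⟨g', hg', hgf'⟩
    exact ⟨g + g', hg.add hg', by simp [hgf, hgf']⟩
  smul_mem' := by
    rintro c f ⟨g, hg, hgf⟩
    exact ⟨c • g, hg.smul c, by simp [hgf]⟩

theorem mem_birthDeathDomain {f g : C₀(ℕ, ℝ)} (hg : ⇑g = birthDeathGen β f) :
    f ∈ birthDeathDomain β T ↔ IsGenerated T f g := by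
  refine ⟨?_, fun h => ⟨g, h, hg⟩⟩
  rintro ⟨g', h, hg'⟩
  rwa [DFunLike.coe_injective (hg.trans hg'.symm)]

theorem expC0_mem_birthDeathDomain {l : ℝ} (hl : 0 < l) :
    isCoordinate_nat.expC0 l hl ∈ birthDeathDomain β T ↔
      IsGenerated T (isCoordinate_nat.expC0 l hl)
        (-(β * (1 - Real.exp (-l))) • isCoordinate_nat.expC0 l hl -
          -((1 - Real.exp (-l)) ^ 2 / Real.exp (-l)) • isCoordinate_nat.mulExpC0 l hl) := by
  refine mem_birthDeathDomain (funext fun n => ?_)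
  rw [neg_smul _ (isCoordinate_nat.mulExpC0 l hl), sub_neg_eq_add]
  exact (birthDeathGen_exp β l n).symm

theorem mem_birthDeathDomain_of_approx (hβ : 0 ≤ β) (hT : IsContractionSemigroup T)
    {f g : C₀(ℕ, ℝ)} (hg : ⇑g = birthDeathGen β f) {m : ℝ} (hm : 0 < m)
    (h : ∀ ε > 0, ∃ f' ∈ birthDeathDomain β T,
      ∀ n : ℕ, |f' n - f n| ≤ ε * Real.exp (-(m * n))) :
    f ∈ birthDeathDomain β T := by
  obtain ⟨K, hK0, hK⟩ := exists_abs_birthDeathGen_le hβ hm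
  suffices hfg : (f, g) ∈ {p : C₀(ℕ, ℝ) × C₀(ℕ, ℝ) | IsGenerated T p.1 p.2} from ⟨g, hfg, hg⟩
  refine hT.isClosed_isGenerated.closure_subset (Metric.mem_closure_iff.2 fun ε hε => ?_)
  obtain ⟨f', ⟨g', hfg', hg'⟩, hnear⟩ := h (ε / 2 / (1 + K)) (by positivity)
  refine ⟨(f', g'), hfg', max_lt ?_ ?_⟩ <;> rw [dist_comm, dist_eq_norm] <;>
    refine (C0_norm_le (half_pos hε).le fun n => ?_).trans_lt (half_lt_self hε)
  · refine (hnear n).trans (mul_le_of_le_one_right (by positivity) ?_ |>.trans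
      (div_le_self (half_pos hε).le (le_add_of_nonneg_right hK0)))
    exact Real.exp_le_one_iff.2 (neg_nonpos.2 (by positivity))
  · calc |(g' - g) n| = |birthDeathGen β (⇑f' - ⇑f) n| := by
          rw [map_sub, ← hg', ← hg]
          rfl
      _ ≤ ε / 2 / (1 + K) * K := hK _ _ hnear n
      _ ≤ ε / 2 / (1 + K) * (1 + K) := by
          gcongr
          linarith
      _ = ε / 2 := div_mul_cancel₀ _ (by positivity)

/-- A finitely supported function on the nonnegative integers, as a function vanishing at
infinity. -/
def finiteSupportC0 (f : ℕ → ℝ) (hf : f.support.Finite) : C₀(ℕ, ℝ) :=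
  compactSupportC0 f continuous_of_discreteTopology
    (.intro hf.isCompact fun _ hx => Function.notMem_support.1 hx)

-- Approximating `exp n * f n`, instead of `f`, by a polynomial in `exp (-n)` without constant term
-- gives the exponential weight in the error.
theorem finiteSupportC0_mem_birthDeathDomain (hβ : 0 ≤ β) (hT : IsContractionSemigroup T)
    (hexp : ∀ l hl, isCoordinate_nat.expC0 l hl ∈ birthDeathDomain β T) {f : ℕ → ℝ}
    (hf : f.support.Finite) : finiteSupportC0 f hf ∈ birthDeathDomain β T := by
  refine mem_birthDeathDomain_of_approx (g := finiteSupportC0 _ (finite_support_birthDeathGen β hf))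
    hβ hT rfl one_pos fun ε hε => ?_
  have hf' : (fun n : ℕ => Real.exp n * f n).support.Finite :=
    hf.subset (Function.support_mul_subset_right _ _)
  obtain ⟨q, hq⟩ := exists_polynomial_mul_near (isCoordinate_nat.expC0_injective one_pos)
    (fun x => (Real.exp_pos _).ne') (finiteSupportC0 _ hf') hε
  obtain ⟨g, hg, hgq⟩ := isCoordinate_nat.exists_mem_eq_exp_mul_eval hexp (Polynomial.X * q)
  refine ⟨g, hg, fun n => ?_⟩
  set z := Real.exp (-(1 * n)) with hz
  have hinv : z * Real.exp n = 1 := by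
    rw [hz, ← Real.exp_add, one_mul, neg_add_cancel, Real.exp_zero]
  calc |g n - f n| = |z * (z * q.eval z - Real.exp n * f n)| := by
        rw [mul_sub, ← mul_assoc z (Real.exp n), hinv, one_mul, hgq, Polynomial.eval_mul,
          Polynomial.eval_X]
        rfl
    _ = z * |z * q.eval z - Real.exp n * f n| := by rw [abs_mul, abs_of_pos (Real.exp_pos _)]
    _ ≤ z * ε := by
        gcongr
        exact hq n
    _ = _ := mul_comm _ _

theorem expC0_mem_birthDeathDomain_of_finiteSupport (hβ : 0 ≤ β) (hT : IsContractionSemigroup T)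
    (hfin : ∀ f hf, finiteSupportC0 f hf ∈ birthDeathDomain β T) {l : ℝ} (hl : 0 < l) :
    isCoordinate_nat.expC0 l hl ∈ birthDeathDomain β T := by
  refine mem_birthDeathDomain_of_approx hβ hT (m := l / 2)
    (g := -(β * (1 - Real.exp (-l))) • isCoordinate_nat.expC0 l hl +
      ((1 - Real.exp (-l)) ^ 2 / Real.exp (-l)) • isCoordinate_nat.mulExpC0 l hl)
    (funext fun n => (birthDeathGen_exp β l n).symm) (half_pos hl) fun ε hε => ?_
  have hsmall : ∀ᶠ n : ℕ in atTop, Real.exp (-(l / 2 * n)) < ε :=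
    (Real.tendsto_exp_neg_atTop_nhds_zero.comp
      (tendsto_natCast_atTop_atTop.const_mul_atTop (half_pos hl))).eventually_lt_const hε
  obtain ⟨N, hN⟩ := eventually_atTop.1 hsmall
  refine ⟨_, hfin ((Set.Iio N).indicator (isCoordinate_nat.expC0 l hl))
    ((Set.finite_Iio N).subset Set.support_indicator_subset), fun n => ?_⟩
  change |(Set.Iio N).indicator (isCoordinate_nat.expC0 l hl) n - Real.exp (-(l * n))| ≤ _
  rcases lt_or_ge n N with hn | hn
  · rw [Set.indicator_of_mem (Set.mem_Iio.2 hn), IsCoordinate.expC0_apply, sub_self, abs_zero]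
    positivity
  · rw [Set.indicator_of_notMem (Set.notMem_Iio.2 hn), zero_sub, abs_neg,
      abs_of_pos (Real.exp_pos _)]
    calc Real.exp (-(l * n)) = Real.exp (-(l / 2 * n)) * Real.exp (-(l / 2 * n)) := by
          rw [← Real.exp_add]
          ring_nf
      _ ≤ _ := by
          gcongr
          exact (hN n hn).le

theorem isBirthDeathSemigroup_birthDeathKernel (hβ : 0 ≤ β) :
    IsBirthDeathSemigroup β (birthDeathKernel β) where
  feller := (isAffineSemigroup_birthDeathKernel hβ).isFellerSemigroup isCoordinate_nat
  generator f hf := by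
    have hP := isAffineSemigroup_birthDeathKernel hβ
    have hmem := finiteSupportC0_mem_birthDeathDomain hβ
      (hP.isFellerSemigroup isCoordinate_nat).isContractionSemigroup
      (fun l hl => (expC0_mem_birthDeathDomain hl).2 (hP.isGenerated_expC0 isCoordinate_nat hl)) hf
    exact (IsFellerSemigroup.inGenerator_iff _ (finiteSupportC0 f hf)
      (finiteSupportC0 _ (finite_support_birthDeathGen β hf))).2 ((mem_birthDeathDomain rfl).1 hmem)

theorem IsBirthDeathSemigroup.eq_birthDeathKernel (hβ : 0 ≤ β) {D : ℝ≥0 → Kernel ℕ ℕ}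
    (hD : IsBirthDeathSemigroup β D) : D = birthDeathKernel β := by
  refine (isAffineSemigroup_birthDeathKernel hβ).eq_of_isGenerated_expC0 isCoordinate_nat
    hD.feller fun l hl => (expC0_mem_birthDeathDomain hl).1 ?_
  refine expC0_mem_birthDeathDomain_of_finiteSupport hβ hD.feller.isContractionSemigroup
    (fun f hf => ?_) hl
  exact (mem_birthDeathDomain (g := finiteSupportC0 _ (finite_support_birthDeathGen β hf)) rfl).2
    ((hD.feller.inGenerator_iff (finiteSupportC0 f hf) _).1 (hD.generator f hf))

end BirthDeath

/-! ### Approximation by polynomials in `exp (-x)` and by compactly supported functions -/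

section Approximation

open Polynomial

theorem exists_polynomial_antiderivative (p : ℝ[X]) :
    ∃ q : ℝ[X], derivative q = p ∧ q.eval 0 = 0 := by
  induction p using Polynomial.induction_on' with
  | add p r hp hr =>
    obtain ⟨q, hq, hq0⟩ := hp
    obtain ⟨s, hs, hs0⟩ := hr
    exact ⟨q + s, by rw [derivative_add, hq, hs], by rw [eval_add, hq0, hs0, add_zero]⟩
  | monomial n a =>
    refine ⟨monomial (n + 1) (a / (n + 1)), ?_, by simp⟩
    rw [derivative_monomial, Nat.add_sub_cancel, Nat.cast_add_one,
      div_mul_cancel₀ a n.cast_add_one_ne_zero]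

/-- The function whose value at `exp (-x)` is `f x`, extended by zero to the nonpositive
half-line. -/
noncomputable def compNegLog (f : ℝ → ℝ) (z : ℝ) : ℝ :=
  if 0 < z then f (-Real.log z) else 0

theorem compNegLog_exp (f : ℝ → ℝ) (x : ℝ) : compNegLog f (Real.exp (-x)) = f x := by
  simp [compNegLog, Real.exp_pos]

theorem compNegLog_eventuallyEq_zero {f : ℝ → ℝ} (hc : HasCompactSupport f) {z : ℝ}
    (hz : z ≤ 0) : compNegLog f =ᶠ[𝓝 z] 0 := by
  have hf : ∀ᶠ x in atTop, f x = 0 :=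
    (_root_.hasCompactSupport_iff_eventuallyEq.1 hc).filter_mono
      (by rw [coclosedCompact_eq_cocompact]; exact atTop_le_cocompact)
  obtain ⟨R, hR⟩ := eventually_atTop.1 hf
  filter_upwards [Iio_mem_nhds (hz.trans_lt (Real.exp_pos (-R)))] with y hy
  rw [compNegLog]
  split_ifs with hy0
  · exact hR _ (le_neg_of_le_neg ((Real.log_lt_iff_lt_exp hy0).2 hy).le)
  · rfl

theorem contDiff_compNegLog {f : ℝ → ℝ} {n : ℕ∞} (hf : ContDiff ℝ n f)
    (hc : HasCompactSupport f) : ContDiff ℝ n (compNegLog f) := by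
  refine contDiff_iff_contDiffAt.2 fun z => ?_
  rcases le_or_gt z 0 with hz | hz
  · exact contDiffAt_const.congr_of_eventuallyEq (compNegLog_eventuallyEq_zero hc hz)
  · have hcomp : ContDiffAt ℝ n (fun y => f (-Real.log y)) z :=
      hf.contDiffAt.comp z (Real.contDiffAt_log.2 hz.ne').neg
    refine hcomp.congr_of_eventuallyEq ?_
    filter_upwards [Ioi_mem_nhds hz] with y hy
    exact if_pos hy

theorem abs_le_mul_of_abs_deriv_le {G : ℝ → ℝ} (hG : Differentiable ℝ G) (h0 : G 0 = 0) {ε : ℝ}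
    (h : ∀ z ∈ Set.Icc (0 : ℝ) 1, |deriv G z| ≤ ε) {z : ℝ} (hz : z ∈ Set.Icc (0 : ℝ) 1) :
    |G z| ≤ ε * z := by
  have := (convex_Icc (0 : ℝ) 1).norm_image_sub_le_of_norm_deriv_le (fun x _ => hG x) h
    (Set.left_mem_Icc.2 zero_le_one) hz
  rwa [h0, sub_zero, sub_zero, Real.norm_eq_abs, Real.norm_of_nonneg hz.1] at this

theorem abs_iteratedDeriv_le_of_abs_iteratedDeriv_two_le {G : ℝ → ℝ} (hG : ContDiff ℝ 2 G)
    (h0 : G 0 = 0) (h0' : deriv G 0 = 0) {ε : ℝ}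
    (h : ∀ z ∈ Set.Icc (0 : ℝ) 1, |iteratedDeriv 2 G z| ≤ ε) {k : ℕ} (hk : k ≤ 2) {z : ℝ}
    (hz : z ∈ Set.Icc (0 : ℝ) 1) : |iteratedDeriv k G z| ≤ ε := by
  have hε : 0 ≤ ε := (abs_nonneg _).trans (h z hz)
  have bound_one : ∀ z ∈ Set.Icc (0 : ℝ) 1, |deriv G z| ≤ ε := fun z hz => by
    refine (abs_le_mul_of_abs_deriv_le ?_ h0' (fun z hz => ?_) hz).trans
      (mul_le_of_le_one_right hε hz.2)
    · exact (ContDiff.deriv' (n := 1) hG).differentiable one_ne_zero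
    · rw [← iteratedDeriv_one (f := G), ← iteratedDeriv_succ]
      exact h z hz
  interval_cases k
  · rw [iteratedDeriv_zero]
    exact (abs_le_mul_of_abs_deriv_le (hG.differentiable two_ne_zero) h0 bound_one hz).trans
      (mul_le_of_le_one_right hε hz.2)
  · rw [iteratedDeriv_one]
    exact bound_one z hz
  · exact h z hz

theorem exists_polynomial_abs_iteratedDeriv_le {F : ℝ → ℝ} (hF : ContDiff ℝ 2 F) (h0 : F 0 = 0)
    (h0' : deriv F 0 = 0) {ε : ℝ} (hε : 0 < ε) :
    ∃ q : ℝ[X], ∀ k ≤ 2, ∀ z ∈ Set.Icc (0 : ℝ) 1,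
      |iteratedDeriv k (fun z => z * q.eval z - F z) z| ≤ ε := by
  obtain ⟨p, hp⟩ := exists_polynomial_near_of_continuousOn 0 1 _
    (hF.continuous_iteratedDeriv 2 le_rfl).continuousOn ε hε
  obtain ⟨q', hq', hq'0⟩ := exists_polynomial_antiderivative p
  obtain ⟨q, hq, hq0⟩ := exists_polynomial_antiderivative q'
  have hX (z : ℝ) : z * q.divX.eval z = q.eval z := by
    have := congrArg (eval z) q.X_mul_divX_add
    rwa [q.coeff_zero_eq_eval_zero, hq0, C_0, add_zero, eval_mul, eval_X] at this
  have hqsmooth : ContDiff ℝ 2 fun z => q.eval z := by simpa using q.contDiff_aeval (𝕜 := ℝ) 2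
  have hderiv : deriv (fun z => q.eval z) = fun z => q'.eval z :=
    funext fun z => hq ▸ q.deriv
  have hderiv_two : iteratedDeriv 2 (fun z => q.eval z) = fun z => p.eval z := by
    rw [iteratedDeriv_succ, iteratedDeriv_one, hderiv]
    exact funext fun z => hq' ▸ q'.deriv
  refine ⟨q.divX, fun k hk z hz => ?_⟩
  simp only [hX]
  refine abs_iteratedDeriv_le_of_abs_iteratedDeriv_two_le (hqsmooth.sub hF) ?_ ?_
    (fun z hz => ?_) hk hz
  · rw [hq0, h0, sub_zero]
  · rw [deriv_fun_sub q.differentiableAt (hF.differentiable two_ne_zero 0), hderiv]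
    exact sub_eq_zero_of_eq (hq'0.trans h0'.symm)
  · rw [iteratedDeriv_fun_sub hqsmooth.contDiffAt hF.contDiffAt, hderiv_two]
    exact (hp z hz).le

theorem iteratedDeriv_exp_neg_mul (l : ℝ) (k : ℕ) (x : ℝ) :
    iteratedDeriv k (fun x => Real.exp (-(l * x))) x = (-l) ^ k * Real.exp (-(l * x)) := by
  simpa only [neg_mul] using congrFun (iteratedDeriv_exp_const_mul k (-l)) x

theorem abs_iteratedDeriv_comp_exp_neg_le {G : ℝ → ℝ} (hG : ContDiff ℝ 2 G) (h0 : G 0 = 0) {ε : ℝ}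
    (h : ∀ k ≤ 2, ∀ z ∈ Set.Icc (0 : ℝ) 1, |iteratedDeriv k G z| ≤ ε) {k : ℕ} (hk : k ≤ 2)
    {x : ℝ} (hx : 0 ≤ x) :
    |iteratedDeriv k (fun x => G (Real.exp (-x))) x| ≤ 2 * ε * Real.exp (-x) := by
  have hexp (k : ℕ) :
      iteratedDeriv k (fun x => Real.exp (-x)) x = (-1) ^ k * Real.exp (-x) := by
    simpa only [one_mul] using iteratedDeriv_exp_neg_mul 1 k x
  have hexp' : deriv (fun x => Real.exp (-x)) x = -Real.exp (-x) := by
    simpa [iteratedDeriv_one] using hexp 1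
  have hsmooth : ContDiff ℝ 2 fun x => Real.exp (-x) := contDiff_neg.exp
  set z := Real.exp (-x) with hz
  have hz0 : 0 < z := Real.exp_pos _
  have hz1 : z ≤ 1 := Real.exp_le_one_iff.2 (neg_nonpos.2 hx)
  have hzmem : z ∈ Set.Icc (0 : ℝ) 1 := ⟨hz0.le, hz1⟩
  have hε : 0 ≤ ε := (abs_nonneg _).trans (h 0 zero_le_two z hzmem)
  have hderiv : ∀ z ∈ Set.Icc (0 : ℝ) 1, |deriv G z| ≤ ε := by
    simpa only [iteratedDeriv_one] using h 1 one_le_two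
  have hdiff := hG.differentiable two_ne_zero
  interval_cases k
  · rw [iteratedDeriv_zero]
    exact (abs_le_mul_of_abs_deriv_le hdiff h0 hderiv hzmem).trans
      (by nlinarith [mul_nonneg hε hz0.le])
  · rw [iteratedDeriv_one, show (fun x => G (Real.exp (-x))) = G ∘ fun x => Real.exp (-x) from rfl,
      deriv_comp x (hdiff _) (hsmooth.differentiable two_ne_zero x), hexp', ← hz, abs_mul, abs_neg,
      abs_of_pos hz0]
    nlinarith [hderiv z hzmem]
  · rw [show (fun x => G (Real.exp (-x))) = G ∘ fun x => Real.exp (-x) from rfl,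
      iteratedDeriv_comp_two hG.contDiffAt hsmooth.contDiffAt, hexp', hexp, ← hz]
    calc |iteratedDeriv 2 G z * (-z) ^ 2 + deriv G z * ((-1) ^ 2 * z)|
        = |iteratedDeriv 2 G z * z + deriv G z| * z := by
          rw [← abs_of_pos hz0, ← abs_mul, abs_of_pos hz0]
          ring_nf
      _ ≤ (ε * 1 + ε) * z := by
          gcongr
          refine (abs_add_le _ _).trans ?_
          rw [abs_mul, abs_of_pos hz0]
          gcongr
          · exact h 2 le_rfl z hzmem
          · exact hderiv z hzmem
      _ = _ := by ring

theorem exists_polynomial_exp_near {f : ℝ → ℝ} (hf : ContDiff ℝ 2 f) (hc : HasCompactSupport f)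
    {ε : ℝ} (hε : 0 < ε) :
    ∃ q : ℝ[X], ∀ k ≤ 2, ∀ x ≥ 0,
      |iteratedDeriv k (fun x => Real.exp (-x) * q.eval (Real.exp (-x)) - f x) x| ≤
        ε * Real.exp (-x) := by
  have hF : ContDiff ℝ 2 (compNegLog f) := contDiff_compNegLog (n := 2) hf hc
  have hzero := compNegLog_eventuallyEq_zero hc le_rfl
  have hzero' : deriv (compNegLog f) 0 = 0 := hzero.deriv_eq.trans (deriv_const _ _)
  obtain ⟨q, hq⟩ :=
    exists_polynomial_abs_iteratedDeriv_le hF hzero.eq_of_nhds hzero' (half_pos hε)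
  refine ⟨q, fun k hk x hx => ?_⟩
  have hG : ContDiff ℝ 2 fun z => z * q.eval z - compNegLog f z :=
    (contDiff_id.mul (by simpa using q.contDiff_aeval (𝕜 := ℝ) 2)).sub hF
  have := abs_iteratedDeriv_comp_exp_neg_le hG (by simp [hzero.eq_of_nhds]) hq hk hx
  simpa only [compNegLog_exp, mul_div_cancel₀ ε two_ne_zero] using this

theorem exists_abs_iteratedDeriv_sub_one_le {χ : ℝ → ℝ} (hχ : ContDiff ℝ ∞ χ)
    (hχc : HasCompactSupport χ) (hone : χ =ᶠ[𝓝 0] 1) (k : ℕ) :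
    ∃ C ≥ 0, ∀ y, |iteratedDeriv k (fun y => χ y - 1) y| ≤ C * |y| := by
  have hsub : ContDiff ℝ ∞ fun y => χ y - 1 := hχ.sub contDiff_const
  obtain ⟨C, hC⟩ : ∃ C, ∀ y, ‖iteratedDeriv (k + 1) χ y‖ ≤ C := by
    obtain ⟨C, hC⟩ := (hχc.iteratedFDeriv (k + 1)).exists_bound_of_continuous
      (hχ.continuous_iteratedFDeriv (by exact_mod_cast le_top))
    exact ⟨C, fun y => norm_iteratedFDeriv_eq_norm_iteratedDeriv.symm.trans_le (hC y)⟩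
  have hderiv (y : ℝ) :
      deriv (iteratedDeriv k fun y => χ y - 1) y = iteratedDeriv (k + 1) χ y := by
    rw [← iteratedDeriv_succ, iteratedDeriv_fun_sub
      (hχ.of_le (by exact_mod_cast le_top)).contDiffAt contDiffAt_const, iteratedDeriv_const,
      if_neg k.succ_ne_zero, sub_zero]
  have hzero : iteratedDeriv k (fun y => χ y - 1) 0 = 0 := by
    have : (fun y => χ y - 1) =ᶠ[𝓝 0] fun _ => 0 := by
      filter_upwards [hone] with y hy
      rw [hy, Pi.one_apply, sub_self]
    rw [this.iteratedDeriv_eq, iteratedDeriv_fun_const_zero]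
  refine ⟨C, (norm_nonneg _).trans (hC 0), fun y => ?_⟩
  have := convex_univ.norm_image_sub_le_of_norm_deriv_le
    (fun x _ => hsub.differentiable_iteratedDeriv k (by exact_mod_cast ENat.natCast_lt_top k) x)
    (fun x _ => (hderiv x).symm ▸ hC x) (Set.mem_univ 0) (Set.mem_univ y)
  rwa [hzero, sub_zero, sub_zero] at this

theorem exists_smooth_cutoff (n : ℕ) : ∃ χ : ℝ → ℝ, ContDiff ℝ ∞ χ ∧ HasCompactSupport χ ∧
    ∃ C ≥ 0, ∀ k ≤ n, ∀ y, |iteratedDeriv k (fun y => χ y - 1) y| ≤ C * |y| := by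
  let χ : ContDiffBump (0 : ℝ) := ⟨1, 2, one_pos, one_lt_two⟩
  choose C hC0 hC using
    exists_abs_iteratedDeriv_sub_one_le χ.contDiff χ.hasCompactSupport χ.eventuallyEq_one
  refine ⟨χ, χ.contDiff, χ.hasCompactSupport, ∑ k ∈ Finset.range (n + 1), C k,
    Finset.sum_nonneg fun k _ => hC0 k, fun k hk y => (hC k y).trans ?_⟩
  gcongr
  exact Finset.single_le_sum (fun k _ => hC0 k) (Finset.mem_range_succ_iff.2 hk)

theorem abs_iteratedDeriv_exp_mul_comp_div_le {ψ : ℝ → ℝ} {n : ℕ} (hψ : ContDiff ℝ n ψ) {C : ℝ}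
    (hC : ∀ k ≤ n, ∀ y, |iteratedDeriv k ψ y| ≤ C * |y|) {l R : ℝ} (hl : 0 ≤ l) (hR : 1 ≤ R)
    {x : ℝ} (hx : 0 ≤ x) :
    |iteratedDeriv n (fun x => Real.exp (-(l * x)) * ψ (x / R)) x| ≤
      (l + 1) ^ n * (C * (x / R)) * Real.exp (-(l * x)) := by
  have hdiv (k : ℕ) (hk : k ≤ n) :
      iteratedDeriv k (fun x => ψ (x / R)) x = R⁻¹ ^ k * iteratedDeriv k ψ (x / R) := by
    simpa only [div_eq_inv_mul] using
      congrFun (iteratedDeriv_comp_const_mul (hψ.of_le (by exact_mod_cast hk)) R⁻¹) x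
  have hxR : 0 ≤ x / R := by positivity
  rw [iteratedDeriv_fun_mul (by fun_prop) (by fun_prop), add_pow, Finset.sum_mul, Finset.sum_mul]
  refine (Finset.abs_sum_le_sum_abs _ _).trans (Finset.sum_le_sum fun i _ => ?_)
  have hψi : |R⁻¹ ^ (n - i) * iteratedDeriv (n - i) ψ (x / R)| ≤ C * (x / R) := by
    rw [abs_mul, abs_of_nonneg (by positivity)]
    have := hC (n - i) (n.sub_le i) (x / R)
    rw [abs_of_nonneg hxR] at this
    exact (mul_le_of_le_one_left (abs_nonneg _)
      (pow_le_one₀ (by positivity) (inv_le_one_of_one_le₀ hR))).trans this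
  rw [hdiv _ (n.sub_le i), iteratedDeriv_exp_neg_mul, abs_mul, abs_mul, abs_mul, abs_pow, abs_neg,
    abs_of_nonneg hl, Nat.abs_cast, Real.abs_exp, one_pow, mul_one]
  calc n.choose i * (l ^ i * Real.exp (-(l * x))) *
        |R⁻¹ ^ (n - i) * iteratedDeriv (n - i) ψ (x / R)|
      ≤ n.choose i * (l ^ i * Real.exp (-(l * x))) * (C * (x / R)) := by gcongr
    _ = _ := by ring

theorem exists_hasCompactSupport_exp_near {l : ℝ} (hl : 0 < l) (n : ℕ) {ε : ℝ} (hε : 0 < ε) :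
    ∃ f : ℝ → ℝ, ContDiff ℝ ∞ f ∧ HasCompactSupport f ∧ ∀ k ≤ n, ∀ x ≥ 0,
      |iteratedDeriv k (fun x => f x - Real.exp (-(l * x))) x| ≤
        ε * Real.exp (-(l / 2 * x)) := by
  obtain ⟨χ, hχ, hχc, C, hC0, hC⟩ := exists_smooth_cutoff n
  set K := (l + 1) ^ n * C * (1 ! / (l / 2) ^ 1) with hK
  have : 0 ≤ K := by positivity
  set R := max 1 (K / ε)
  have hR : 1 ≤ R := le_max_left _ _
  have hR0 : 0 < R := one_pos.trans_le hR
  refine ⟨fun x => Real.exp (-(l * x)) * χ (x / R), by fun_prop, ?_, fun k hk x hx => ?_⟩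
  · exact (hχc.comp_isClosedEmbedding
      (Homeomorph.mulRight₀ R⁻¹ (inv_pos.2 hR0).ne').isClosedEmbedding).mul_left
  have hψ : ContDiff ℝ k fun y => χ y - 1 :=
    (hχ.of_le (by exact_mod_cast le_top)).sub contDiff_const
  have hexp : Real.exp (-(l * x)) = Real.exp (-(l / 2 * x)) * Real.exp (-(l / 2 * x)) := by
    rw [← Real.exp_add]
    ring_nf
  have hxexp : x * Real.exp (-(l / 2 * x)) ≤ 1 ! / (l / 2) ^ 1 := by
    simpa only [pow_one] using pow_mul_exp_neg_le (half_pos hl) 1 hx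
  simp only [← mul_sub_one]
  calc _ ≤ (l + 1) ^ k * (C * (x / R)) * Real.exp (-(l * x)) :=
        abs_iteratedDeriv_exp_mul_comp_div_le hψ (fun j hj => hC j (hj.trans hk)) hl.le hR hx
    _ = (l + 1) ^ k * C * (x * Real.exp (-(l / 2 * x))) / R * Real.exp (-(l / 2 * x)) := by
        rw [hexp]
        ring
    _ ≤ K / R * Real.exp (-(l / 2 * x)) := by
        rw [hK]
        gcongr
        linarith
    _ ≤ ε * Real.exp (-(l / 2 * x)) := by
        gcongr
        exact (div_le_comm₀ hR0 hε).2 (le_max_right _ _)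

end Approximation

/-! ### The squared Bessel semigroup -/

section SquaredBessel

/-- The operator `x ∂² + β ∂` on functions on the line. -/
noncomputable def besselGen (β : ℝ) (f : ℝ → ℝ) (x : ℝ) : ℝ :=
  x * iteratedDeriv 2 f x + β * iteratedDeriv 1 f x

theorem besselGen_apply (β : ℝ) (f : ℝ → ℝ) (x : ℝ) :
    besselGen β f x = x * deriv (deriv f) x + β * deriv f x := by
  rw [besselGen, iteratedDeriv_succ, iteratedDeriv_one]

theorem besselGen_add (β : ℝ) {f g : ℝ → ℝ} (hf : ContDiff ℝ 2 f) (hg : ContDiff ℝ 2 g) :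
    besselGen β (f + g) = besselGen β f + besselGen β g := by
  ext x
  simp only [besselGen, Pi.add_apply, iteratedDeriv_add hf.contDiffAt hg.contDiffAt,
    iteratedDeriv_add (hf.of_le one_le_two).contDiffAt (hg.of_le one_le_two).contDiffAt]
  ring

theorem besselGen_smul (β c : ℝ) (f : ℝ → ℝ) : besselGen β (c • f) = c • besselGen β f := by
  ext x
  simp only [besselGen, Pi.smul_apply, iteratedDeriv_const_smul_field, smul_eq_mul]
  ring

theorem besselGen_exp (β l x : ℝ) : besselGen β (fun x => Real.exp (-(l * x))) x =
    -(β * l) * Real.exp (-(l * x)) - -l ^ 2 * (x * Real.exp (-(l * x))) := by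
  rw [besselGen, iteratedDeriv_exp_neg_mul, iteratedDeriv_exp_neg_mul]
  ring

theorem continuous_besselGen (β : ℝ) {f : ℝ → ℝ} (hf : ContDiff ℝ 2 f) :
    Continuous (besselGen β f) :=
  (continuous_id.mul (hf.continuous_iteratedDeriv 2 le_rfl)).add
    (continuous_const.mul (hf.continuous_iteratedDeriv 1 one_le_two))

theorem hasCompactSupport_besselGen (β : ℝ) {f : ℝ → ℝ} (hc : HasCompactSupport f) :
    HasCompactSupport (besselGen β f) := by
  rw [funext (besselGen_apply β f)]
  exact (hc.deriv.deriv.mul_left (f := fun x => x)).add (hc.deriv.mul_left (f := fun _ => β))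

theorem abs_besselGen_le {β m : ℝ} (hβ : 0 ≤ β) (hm : 0 < m) {ε : ℝ} {d : ℝ → ℝ} {x : ℝ}
    (hx : 0 ≤ x) (hd : ∀ k ≤ 2, |iteratedDeriv k d x| ≤ ε * Real.exp (-(m * x))) :
    |besselGen β d x| ≤ ε * (1 / m + β) := by
  have hε : 0 ≤ ε :=
    nonneg_of_mul_nonneg_left ((abs_nonneg _).trans (hd 0 zero_le_two)) (Real.exp_pos _)
  have hexp : Real.exp (-(m * x)) ≤ 1 := Real.exp_le_one_iff.2 (neg_nonpos.2 (by positivity))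
  have hxexp : x * Real.exp (-(m * x)) ≤ 1 / m := by simpa using pow_mul_exp_neg_le hm 1 hx
  calc |besselGen β d x| ≤ x * |iteratedDeriv 2 d x| + β * |iteratedDeriv 1 d x| := by
        refine (abs_add_le _ _).trans_eq ?_
        rw [abs_mul, abs_mul, abs_of_nonneg hx, abs_of_nonneg hβ]
    _ ≤ x * (ε * Real.exp (-(m * x))) + β * (ε * Real.exp (-(m * x))) := by
        gcongr
        exacts [hd 2 le_rfl, hd 1 one_le_two]
    _ = ε * (x * Real.exp (-(m * x)) + β * Real.exp (-(m * x))) := by ring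
    _ ≤ ε * (1 / m + β * 1) := by gcongr
    _ = _ := by rw [mul_one]

variable {β : ℝ} {T : ℝ≥0 → C₀(ℝ≥0, ℝ) →L[ℝ] C₀(ℝ≥0, ℝ)}

/-- The smooth functions whose restriction to the half-line is in the domain of the generator
of `T`, with image the restriction of `besselGen β`. -/
def besselDomain (β : ℝ) (T : ℝ≥0 → C₀(ℝ≥0, ℝ) →L[ℝ] C₀(ℝ≥0, ℝ)) : Submodule ℝ (ℝ → ℝ) where
  carrier := {F | ContDiff ℝ 2 F ∧ ∃ f g, IsGenerated T f g ∧ (∀ x, f x = F x) ∧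
    ∀ x, g x = besselGen β F x}
  zero_mem' := ⟨contDiff_const, 0, 0, by simp [IsGenerated], fun _ => rfl, fun x => by
    simpa using (congrFun (besselGen_smul β 0 0) x).symm⟩
  add_mem' := by
    rintro F F' ⟨hF, f, g, hfg, hf, hg⟩ ⟨hF', f', g', hfg', hf', hg'⟩
    exact ⟨hF.add hF', f + f', g + g', hfg.add hfg', fun x => by simp [hf, hf'],
      fun x => by simp [hg, hg', besselGen_add β hF hF']⟩
  smul_mem' := by
    rintro c F ⟨hF, f, g, hfg, hf, hg⟩
    exact ⟨contDiff_const.smul hF, c • f, c • g, hfg.smul c, fun x => by simp [hf],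
      fun x => by simp [hg, besselGen_smul]⟩

theorem mem_besselDomain {F : ℝ → ℝ} (hF : ContDiff ℝ 2 F) {f g : C₀(ℝ≥0, ℝ)}
    (hf : ∀ x, f x = F x) (hg : ∀ x, g x = besselGen β F x) :
    F ∈ besselDomain β T ↔ IsGenerated T f g := by
  refine ⟨?_, fun h => ⟨hF, f, g, h, hf, hg⟩⟩
  rintro ⟨-, f', g', h, hf', hg'⟩
  rwa [show f = f' from DFunLike.ext _ _ fun x => (hf x).trans (hf' x).symm,
    show g = g' from DFunLike.ext _ _ fun x => (hg x).trans (hg' x).symm]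

theorem exp_mem_besselDomain {l : ℝ} (hl : 0 < l) :
    (fun x => Real.exp (-(l * x))) ∈ besselDomain β T ↔
      IsGenerated T (isCoordinate_nnreal.expC0 l hl)
        (-(β * l) • isCoordinate_nnreal.expC0 l hl - -l ^ 2 • isCoordinate_nnreal.mulExpC0 l hl) :=
  mem_besselDomain (by fun_prop) (fun _ => rfl) fun x => (besselGen_exp β l x).symm

theorem mem_besselDomain_of_approx (hβ : 0 ≤ β) (hT : IsContractionSemigroup T) {F : ℝ → ℝ}
    (hF : ContDiff ℝ 2 F) {f g : C₀(ℝ≥0, ℝ)} (hf : ∀ x, f x = F x)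
    (hg : ∀ x, g x = besselGen β F x) {m : ℝ} (hm : 0 < m)
    (h : ∀ ε > 0, ∃ F' ∈ besselDomain β T, ∀ k ≤ 2, ∀ x ≥ 0,
      |iteratedDeriv k (fun x => F' x - F x) x| ≤ ε * Real.exp (-(m * x))) :
    F ∈ besselDomain β T := by
  suffices hfg : (f, g) ∈ {p : C₀(ℝ≥0, ℝ) × C₀(ℝ≥0, ℝ) | IsGenerated T p.1 p.2} from
    ⟨hF, f, g, hfg, hf, hg⟩
  refine hT.isClosed_isGenerated.closure_subset (Metric.mem_closure_iff.2 fun ε hε => ?_)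
  obtain ⟨F', ⟨hF', f', g', hfg', hf', hg'⟩, hnear⟩ :=
    h (ε / 2 / (1 + (1 / m + β))) (by positivity)
  refine ⟨(f', g'), hfg', max_lt ?_ ?_⟩ <;> rw [dist_comm, dist_eq_norm] <;>
    refine (C0_norm_le (half_pos hε).le fun x => ?_).trans_lt (half_lt_self hε)
  · rw [ZeroAtInftyContinuousMap.sub_apply, hf', hf]
    have := hnear 0 zero_le_two x x.coe_nonneg
    rw [iteratedDeriv_zero] at this
    refine this.trans (mul_le_of_le_one_right (by positivity) ?_ |>.trans
      (div_le_self (half_pos hε).le (le_add_of_nonneg_right (by positivity))))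
    exact Real.exp_le_one_iff.2 (neg_nonpos.2 (by positivity))
  · have hsub : besselGen β (fun x => F' x - F x) = besselGen β F' - besselGen β F := by
      rw [eq_sub_iff_add_eq, ← besselGen_add β (hF'.sub hF) hF]
      exact congrArg _ (funext fun x => sub_add_cancel _ _)
    calc |(g' - g) x| = |besselGen β (fun x => F' x - F x) x| := by
          rw [ZeroAtInftyContinuousMap.sub_apply, hg', hg, hsub, Pi.sub_apply]
      _ ≤ ε / 2 / (1 + (1 / m + β)) * (1 / m + β) :=
          abs_besselGen_le hβ hm x.coe_nonneg fun k hk => hnear k hk x x.coe_nonneg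
      _ ≤ ε / 2 / (1 + (1 / m + β)) * (1 + (1 / m + β)) :=
          mul_le_mul_of_nonneg_left (le_add_of_nonneg_left zero_le_one) (by positivity)
      _ = ε / 2 := div_mul_cancel₀ _ (by positivity)

/-- The restriction to the half-line of a compactly supported continuous function on the line. -/
def restrictC0 (f : ℝ → ℝ) (hf : Continuous f) (hc : HasCompactSupport f) : C₀(ℝ≥0, ℝ) :=
  compactSupportC0 (fun x : ℝ≥0 => f x) (by fun_prop)
    (hc.comp_isClosedEmbedding isCoordinate_nnreal.isClosedEmbedding)

theorem mem_besselDomain_of_hasCompactSupport (hβ : 0 ≤ β) (hT : IsContractionSemigroup T)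
    (hexp : ∀ l > 0, (fun x => Real.exp (-(l * x))) ∈ besselDomain β T) {f : ℝ → ℝ}
    (hf : ContDiff ℝ 2 f) (hc : HasCompactSupport f) : f ∈ besselDomain β T := by
  refine mem_besselDomain_of_approx hβ hT hf (f := restrictC0 f hf.continuous hc)
    (g := restrictC0 _ (continuous_besselGen β hf) (hasCompactSupport_besselGen β hc))
    (fun _ => rfl) (fun _ => rfl) one_pos fun ε hε => ?_
  obtain ⟨q, hq⟩ := exists_polynomial_exp_near hf hc hε
  refine ⟨_, ?_, fun k hk x hx => (hq k hk x hx).trans_eq (by rw [one_mul])⟩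
  have hsum : (fun x => Real.exp (-x) * q.eval (Real.exp (-x))) =
      ∑ n ∈ q.support, q.coeff n • fun x => Real.exp (-((n + 1 : ℕ) * x)) := by
    ext x
    simp only [Polynomial.eval_eq_sum, Polynomial.sum, Finset.mul_sum, Finset.sum_apply,
      Pi.smul_apply, smul_eq_mul, ← mul_neg, Real.exp_nat_mul]
    exact Finset.sum_congr rfl fun n _ => by ring
  rw [hsum]
  exact Submodule.sum_mem _ fun n _ => Submodule.smul_mem _ _ (hexp _ (by positivity))

theorem exp_mem_besselDomain_of_hasCompactSupport (hβ : 0 ≤ β) (hT : IsContractionSemigroup T)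
    (htest : ∀ f, ContDiff ℝ ∞ f → HasCompactSupport f → f ∈ besselDomain β T) {l : ℝ}
    (hl : 0 < l) : (fun x => Real.exp (-(l * x))) ∈ besselDomain β T := by
  refine mem_besselDomain_of_approx hβ hT (by fun_prop) (f := isCoordinate_nnreal.expC0 l hl)
    (g := -(β * l) • isCoordinate_nnreal.expC0 l hl - -l ^ 2 • isCoordinate_nnreal.mulExpC0 l hl)
    (fun _ => rfl) (fun x => (besselGen_exp β l x).symm) (half_pos hl) fun ε hε => ?_
  obtain ⟨f, hf, hc, hnear⟩ := exists_hasCompactSupport_exp_near hl 2 hε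
  exact ⟨f, htest f hf hc, hnear⟩

theorem inGenerator_iff_mem_besselDomain {Q : ℝ≥0 → Kernel ℝ≥0 ℝ≥0} (hQ : IsFellerSemigroup Q)
    {f : ℝ → ℝ} (hf : ContDiff ℝ 2 f) (hc : HasCompactSupport f) :
    InGenerator Q (fun x : ℝ≥0 => f x)
        (fun x : ℝ≥0 => (x : ℝ) * deriv (deriv f) x + β * deriv f x) ↔
      f ∈ besselDomain β hQ.op := by
  simp only [← besselGen_apply]
  exact (hQ.inGenerator_iff (restrictC0 f hf.continuous hc) (restrictC0 _
    (continuous_besselGen β hf) (hasCompactSupport_besselGen β hc))).trans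
    (mem_besselDomain hf (fun _ => rfl) fun _ => rfl).symm

theorem isSquaredBesselSemigroup_besselKernel (hβ : 0 ≤ β) :
    IsSquaredBesselSemigroup β (besselKernel β) where
  feller := (isAffineSemigroup_besselKernel hβ).isFellerSemigroup isCoordinate_nnreal
  generator f hf hc := by
    have hP := isAffineSemigroup_besselKernel hβ
    have hF := hP.isFellerSemigroup isCoordinate_nnreal
    have hf2 : ContDiff ℝ 2 f := contDiff_infty.1 hf 2
    refine (inGenerator_iff_mem_besselDomain hF hf2 hc).2 ?_
    exact mem_besselDomain_of_hasCompactSupport hβ hF.isContractionSemigroup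
      (fun l hl => (exp_mem_besselDomain hl).2 (hP.isGenerated_expC0 isCoordinate_nnreal hl)) hf2 hc

theorem IsSquaredBesselSemigroup.eq_besselKernel (hβ : 0 ≤ β) {Q : ℝ≥0 → Kernel ℝ≥0 ℝ≥0}
    (hQ : IsSquaredBesselSemigroup β Q) : Q = besselKernel β := by
  refine (isAffineSemigroup_besselKernel hβ).eq_of_isGenerated_expC0 isCoordinate_nnreal
    hQ.feller fun l hl => (exp_mem_besselDomain hl).1 ?_
  refine exp_mem_besselDomain_of_hasCompactSupport hβ hQ.feller.isContractionSemigroup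
    (fun f hf hc => ?_) hl
  exact (inGenerator_iff_mem_besselDomain _ (contDiff_infty.1 hf 2) hc).1
    (hQ.generator f hf hc)

end SquaredBessel

/-! ### Kernels acting on square integrable functions -/

section LpContraction

variable {X Y : Type*} [MeasurableSpace X] [MeasurableSpace Y] {κ : Kernel X Y} {μ : Measure X}
  {F : Type*} [NormedAddCommGroup F] {f : Y → F} {p : ℝ≥0∞}

theorem eLpNorm_rpow_toReal (hp : p ≠ 0) (hp' : p ≠ ⊤) (g : X → F) :
    eLpNorm g p μ ^ p.toReal = ∫⁻ x, ‖g x‖ₑ ^ p.toReal ∂μ := by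
  rw [eLpNorm_eq_lintegral_rpow_enorm_toReal hp hp', one_div,
    ENNReal.rpow_inv_rpow (ENNReal.toReal_pos hp hp').ne']

theorem ae_aestronglyMeasurable_of_comp (hf : AEStronglyMeasurable f (κ ∘ₘ μ)) :
    ∀ᵐ x ∂μ, AEStronglyMeasurable f (κ x) := by
  filter_upwards [Measure.ae_ae_of_ae_comp hf.ae_eq_mk] with x hx
  exact ⟨_, hf.stronglyMeasurable_mk, hx⟩

theorem ae_memLp_of_memLp_comp (hp : p ≠ 0) (hp' : p ≠ ⊤) (hf : MemLp f p (κ ∘ₘ μ)) :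
    ∀ᵐ x ∂μ, MemLp f p (κ x) := by
  filter_upwards [ae_aestronglyMeasurable_of_comp hf.1,
    Measure.ae_integrable_of_integrable_comp (hf.integrable_norm_rpow hp hp')] with x hx hx'
  exact (integrable_norm_rpow_iff hx hp hp').1 hx'

variable [NormedSpace ℝ F]

theorem aestronglyMeasurable_integral_of_comp (hf : AEStronglyMeasurable f (κ ∘ₘ μ)) :
    AEStronglyMeasurable (fun x => ∫ y, f y ∂(κ x)) μ := by
  refine ⟨_, hf.stronglyMeasurable_mk.integral_kernel (κ := κ), ?_⟩
  filter_upwards [Measure.ae_ae_of_ae_comp hf.ae_eq_mk] with x hx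
  exact integral_congr_ae hx

theorem enorm_integral_le_eLpNorm (hp : 1 ≤ p) {ν : Measure Y} [IsProbabilityMeasure ν]
    (hf : AEStronglyMeasurable f ν) : ‖∫ y, f y ∂ν‖ₑ ≤ eLpNorm f p ν :=
  calc ‖∫ y, f y ∂ν‖ₑ ≤ ∫⁻ y, ‖f y‖ₑ ∂ν := enorm_integral_le_lintegral_enorm _
    _ = eLpNorm f 1 ν := eLpNorm_one_eq_lintegral_enorm.symm
    _ ≤ eLpNorm f p ν := eLpNorm_le_eLpNorm_of_exponent_le hp hf

theorem eLpNorm_integral_kernel_le [IsMarkovKernel κ] (hp : 1 ≤ p) (hp' : p ≠ ⊤)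
    (hf : AEStronglyMeasurable f (κ ∘ₘ μ)) :
    eLpNorm (fun x => ∫ y, f y ∂(κ x)) p μ ≤ eLpNorm f p (κ ∘ₘ μ) := by
  have hp0 : p ≠ 0 := (zero_lt_one.trans_le hp).ne'
  rw [← ENNReal.rpow_le_rpow_iff (ENNReal.toReal_pos hp0 hp'), eLpNorm_rpow_toReal hp0 hp',
    eLpNorm_rpow_toReal hp0 hp', Measure.lintegral_bind κ.measurable.aemeasurable
      (hf.enorm.pow_const _)]
  refine lintegral_mono_ae ?_
  filter_upwards [ae_aestronglyMeasurable_of_comp hf] with x hx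
  rw [← eLpNorm_rpow_toReal hp0 hp']
  exact ENNReal.rpow_le_rpow (enorm_integral_le_eLpNorm hp hx) ENNReal.toReal_nonneg

theorem memLp_integral_kernel [IsMarkovKernel κ] (hp : 1 ≤ p) (hp' : p ≠ ⊤)
    (hf : MemLp f p (κ ∘ₘ μ)) : MemLp (fun x => ∫ y, f y ∂(κ x)) p μ :=
  ⟨aestronglyMeasurable_integral_of_comp hf.1,
    (eLpNorm_integral_kernel_le hp hp' hf.1).trans_lt hf.2⟩

end LpContraction

section L2Operator

variable {X Y Z : Type*} [MeasurableSpace X] [MeasurableSpace Y] [MeasurableSpace Z]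

/-- The contraction from `L²(κ ∘ₘ μ)` to `L²(μ)` defined by a Markov kernel `κ`. -/
noncomputable def kernelL2 (κ : Kernel X Y) [IsMarkovKernel κ] (μ : Measure X) :
    Lp ℝ 2 (κ ∘ₘ μ) →L[ℝ] Lp ℝ 2 μ :=
  have h_int (f : Lp ℝ 2 (κ ∘ₘ μ)) : ∀ᵐ x ∂μ, Integrable f (κ x) :=
    (ae_memLp_of_memLp_comp two_ne_zero ENNReal.ofNat_ne_top (Lp.memLp f)).mono fun _ hx =>
      hx.integrable one_le_two
  have hmem (f : Lp ℝ 2 (κ ∘ₘ μ)) : MemLp (fun x => ∫ y, f y ∂(κ x)) 2 μ :=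
    memLp_integral_kernel one_le_two ENNReal.ofNat_ne_top (Lp.memLp f)
  LinearMap.mkContinuous
    { toFun := fun f => (hmem f).toLp
      map_add' := fun f g => by
        rw [← MemLp.toLp_add]
        refine MemLp.toLp_congr _ _ ?_
        filter_upwards [h_int f, h_int g, Measure.ae_ae_of_ae_comp (Lp.coeFn_add f g)]
          with x hf hg hfg
        exact (integral_congr_ae hfg).trans (integral_add hf hg)
      map_smul' := fun c f => by
        rw [RingHom.id_apply, ← MemLp.toLp_const_smul]
        refine MemLp.toLp_congr _ _ ?_
        filter_upwards [Measure.ae_ae_of_ae_comp (Lp.coeFn_smul c f)] with x hf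
        exact (integral_congr_ae hf).trans (integral_const_mul _ _) }
    1 fun f => by
      rw [one_mul, LinearMap.coe_mk, AddHom.coe_mk, Lp.norm_toLp, Lp.norm_def]
      exact ENNReal.toReal_mono (Lp.eLpNorm_ne_top f)
        (eLpNorm_integral_kernel_le one_le_two ENNReal.ofNat_ne_top (Lp.memLp f).1)

theorem isL2Operator_kernelL2 (κ : Kernel X Y) [IsMarkovKernel κ] (μ : Measure X) :
    IsL2Operator κ (κ ∘ₘ μ) μ (kernelL2 κ μ) := by
  refine fun f hf => ⟨?_, (MemLp.coeFn_toLp <| memLp_integral_kernel one_le_two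
    ENNReal.ofNat_ne_top <| Lp.memLp (hf.toLp f)).trans ?_⟩
  · filter_upwards [ae_memLp_of_memLp_comp two_ne_zero ENNReal.ofNat_ne_top hf] with x hx
    exact hx.integrable one_le_two
  · filter_upwards [Measure.ae_ae_of_ae_comp hf.coeFn_toLp] with x hx
    exact integral_congr_ae hx

theorem exists_isL2Operator (κ : Kernel X Y) [IsMarkovKernel κ] {μ : Measure X} {ν : Measure Y}
    (h : κ ∘ₘ μ = ν) : ∃ T, IsL2Operator κ ν μ T :=
  h ▸ ⟨_, isL2Operator_kernelL2 κ μ⟩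

namespace IsL2Operator

variable {κ : Kernel X Y} {η : Kernel Y Z} {μ : Measure X} {ν : Measure Y} {ρ : Measure Z}
  {T T' : Lp ℝ 2 ν →L[ℝ] Lp ℝ 2 μ}

theorem eq (hT : IsL2Operator κ ν μ T) (hT' : IsL2Operator κ ν μ T') : T = T' := by
  ext1 f
  rw [← Lp.toLp_coeFn f (Lp.memLp f)]
  exact Lp.ext ((hT _ _).2.trans (hT' _ _).2.symm)

theorem absolutelyContinuous (hT : IsL2Operator κ ν μ T) : κ ∘ₘ μ ≪ ν := by
  refine Measure.AbsolutelyContinuous.mk fun s hs hνs => ?_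
  have hzero : s.indicator (fun _ => (1 : ℝ)) =ᵐ[ν] 0 := indicator_meas_zero hνs
  have hmem : MemLp (s.indicator fun _ => (1 : ℝ)) 2 ν := MemLp.zero.ae_eq hzero.symm
  obtain ⟨h_int, hT⟩ := hT _ hmem
  rw [(MemLp.toLp_eq_toLp_iff hmem MemLp.zero).2 hzero, MemLp.toLp_zero, map_zero] at hT
  rw [Measure.bind_apply hs κ.measurable.aemeasurable,
    lintegral_eq_zero_iff (κ.measurable_coe hs)]
  filter_upwards [h_int, hT, Lp.coeFn_zero ℝ 2 μ] with x hx hTx h0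
  have hfin : κ x s ≠ ⊤ := by
    simpa [integrable_indicator_iff hs, integrableOn_const_iff, lt_top_iff_ne_top] using hx
  rw [h0, integral_indicator_const 1 hs, smul_eq_mul, mul_one, Pi.zero_apply] at hTx
  exact (measureReal_eq_zero_iff hfin).1 hTx.symm

theorem comp {T' : Lp ℝ 2 ρ →L[ℝ] Lp ℝ 2 ν} (hT : IsL2Operator κ ν μ T)
    (hT' : IsL2Operator η ρ ν T') : IsL2Operator (η ∘ₖ κ) ρ μ (T ∘L T') := by
  intro f hf
  obtain ⟨h_int, hT'f⟩ := hT' f hf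
  obtain ⟨-, hT'n⟩ := hT' _ hf.norm
  have hmem := (Lp.memLp (T' (hf.toLp f))).ae_eq hT'f
  have hmem' := (Lp.memLp (T' (hf.norm.toLp _))).ae_eq hT'n
  have hm : AEStronglyMeasurable f ((η ∘ₖ κ) ∘ₘ μ) := by
    rw [← Measure.comp_assoc]
    exact hf.1.mono_ac ((hT.absolutelyContinuous.comp_right η).trans hT'.absolutelyContinuous)
  have hintegrable : ∀ᵐ x ∂μ, Integrable f ((η ∘ₖ κ) x) := by
    filter_upwards [ae_aestronglyMeasurable_of_comp hm, (hT _ hmem').1,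
      Measure.ae_ae_of_ae_comp (hT.absolutelyContinuous.ae_le h_int)] with x hx hx' hx''
    exact (integrable_comp_iff hx).2 ⟨hx'', hx'⟩
  refine ⟨hintegrable, ?_⟩
  have hlp : T' (hf.toLp f) = hmem.toLp _ := Lp.ext (hT'f.trans hmem.coeFn_toLp.symm)
  rw [ContinuousLinearMap.comp_apply, hlp]
  filter_upwards [(hT _ hmem).2, hintegrable] with x hx hx'
  rw [hx, Kernel.integral_comp hx']

end IsL2Operator

end L2Operator

/-! ### Exponentials in `L²` -/

section Total

variable {E : Type*} [MeasurableSpace E] {ι : E → ℝ} {ρ : Measure E} {f : E → ℝ} {l k : ℝ}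

theorem ae_eq_zero_of_withDensity_ofReal_eq_neg [SigmaFinite ρ] (hf : AEMeasurable f ρ)
    (h : ρ.withDensity (fun x => ENNReal.ofReal (f x)) =
      ρ.withDensity fun x => ENNReal.ofReal (-f x)) : f =ᵐ[ρ] 0 := by
  filter_upwards [(withDensity_eq_iff_of_sigmaFinite (g := fun x => ENNReal.ofReal (-f x))
    hf.ennreal_ofReal hf.neg.ennreal_ofReal).1 h] with x hx
  rcases le_total 0 (f x) with h0 | h0
  · rw [ENNReal.ofReal_of_nonpos (neg_nonpos.2 h0), ENNReal.ofReal_eq_zero] at hx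
    exact le_antisymm hx h0
  · rw [ENNReal.ofReal_of_nonpos h0, eq_comm, ENNReal.ofReal_eq_zero] at hx
    exact le_antisymm h0 (neg_nonpos.1 hx)

theorem laplace_withDensity_ofReal (hι : Measurable ι) (hf : AEMeasurable f ρ) (l : ℝ) :
    laplace ι (ρ.withDensity fun x => ENNReal.ofReal (f x)) l =
      ∫⁻ x, ENNReal.ofReal (f x * Real.exp (-(l * ι x))) ∂ρ := by
  rw [laplace, lintegral_withDensity_eq_lintegral_mul₀ hf.ennreal_ofReal (by fun_prop)]
  exact lintegral_congr fun x => (ENNReal.ofReal_mul' (Real.exp_pos _).le).symm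

theorem laplace_withDensity_ofReal_ne_top (hι : Measurable ι) (hf : AEMeasurable f ρ)
    (h_int : Integrable (fun x => f x * Real.exp (-(l * ι x))) ρ) :
    laplace ι (ρ.withDensity fun x => ENNReal.ofReal (f x)) l ≠ ⊤ := by
  rw [laplace_withDensity_ofReal hι hf]
  exact h_int.lintegral_lt_top.ne

theorem laplace_withDensity_ofReal_neg (hι : Measurable ι) (hf : AEMeasurable f ρ)
    (h_int : Integrable (fun x => f x * Real.exp (-(l * ι x))) ρ)
    (h : ∫ x, f x * Real.exp (-(l * ι x)) ∂ρ = 0) :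
    laplace ι (ρ.withDensity fun x => ENNReal.ofReal (f x)) l =
      laplace ι (ρ.withDensity fun x => ENNReal.ofReal (-f x)) l := by
  rw [integral_eq_lintegral_pos_part_sub_lintegral_neg_part h_int, sub_eq_zero] at h
  rw [laplace_withDensity_ofReal hι hf, laplace_withDensity_ofReal (f := fun x => -f x) hι hf.neg]
  simp only [neg_mul]
  exact (ENNReal.toReal_eq_toReal_iff' h_int.lintegral_lt_top.ne h_int.neg.lintegral_lt_top.ne).1 h

theorem IsCoordinate.ae_eq_zero_of_integral_mul_exp [TopologicalSpace E] [BorelSpace E]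
    [SigmaFinite ρ] (hι : IsCoordinate ι) (hf : AEMeasurable f ρ)
    (h_int : ∀ᶠ k in 𝓝 l, Integrable (fun x => f x * Real.exp (-(k * ι x))) ρ)
    (h : ∀ᶠ k in 𝓝 l, ∫ x, f x * Real.exp (-(k * ι x)) ∂ρ = 0) : f =ᵐ[ρ] 0 := by
  refine ae_eq_zero_of_withDensity_ofReal_eq_neg hf (hι.ext_of_laplace (l := l) ?_ ?_)
  · filter_upwards [h_int, h] with k hk hk' using
      laplace_withDensity_ofReal_neg hι.measurable hf hk hk'
  · filter_upwards [h_int] with k hk using laplace_withDensity_ofReal_ne_top hι.measurable hf hk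

theorem memLp_exp (hι : Measurable ι) (hl : laplace ι ρ (2 * l) ≠ ⊤) :
    MemLp (fun x => Real.exp (-(l * ι x))) 2 ρ := by
  refine (memLp_two_iff_integrable_sq (by fun_prop)).2 ⟨by fun_prop, ?_⟩
  rw [hasFiniteIntegral_iff_ofReal (ae_of_all _ fun x => sq_nonneg _)]
  refine lt_of_eq_of_lt (lintegral_congr fun x => ?_) hl.lt_top
  rw [← Real.exp_nat_mul, Nat.cast_ofNat, mul_neg, mul_assoc]

open Classical in
/-- The class of `x ↦ exp (-l * ι x)` in `L²(ρ)`, and `0` if this function is not square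
integrable. -/
noncomputable def expL2 (ι : E → ℝ) (ρ : Measure E) (l : ℝ) : Lp ℝ 2 ρ :=
  if h : MemLp (fun x => Real.exp (-(l * ι x))) 2 ρ then h.toLp else 0

theorem expL2_eq_toLp (hι : Measurable ι) (hl : laplace ι ρ (2 * l) ≠ ⊤) :
    expL2 ι ρ l = (memLp_exp hι hl).toLp :=
  dif_pos _

theorem coeFn_expL2 (hι : Measurable ι) (hl : laplace ι ρ (2 * l) ≠ ⊤) :
    expL2 ι ρ l =ᵐ[ρ] fun x => Real.exp (-(l * ι x)) := by
  rw [expL2_eq_toLp hι hl]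
  exact MemLp.coeFn_toLp _

theorem inner_expL2 (hι : Measurable ι) (hl : laplace ι ρ (2 * l) ≠ ⊤) (g : Lp ℝ 2 ρ) :
    inner ℝ (expL2 ι ρ l) g = ∫ x, g x * Real.exp (-(l * ι x)) ∂ρ := by
  rw [L2.inner_def]
  refine integral_congr_ae ?_
  filter_upwards [coeFn_expL2 hι hl] with x hx
  rw [hx, RCLike.inner_apply, conj_trivial]

theorem inner_expL2_expL2 (hι : Measurable ι) (hl : laplace ι ρ (2 * l) ≠ ⊤)
    (hk : laplace ι ρ (2 * k) ≠ ⊤) :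
    inner ℝ (expL2 ι ρ l) (expL2 ι ρ k) = (laplace ι ρ (l + k)).toReal := by
  rw [inner_expL2 hι hl, ← integral_exp_eq_toReal_laplace hι]
  refine integral_congr_ae ?_
  filter_upwards [coeFn_expL2 hι hk] with x hx
  rw [hx, ← Real.exp_add]
  ring_nf

theorem IsL2Operator.apply_expL2 {E' : Type*} [MeasurableSpace E'] {ι' : E' → ℝ}
    {ρ' : Measure E'} {κ : Kernel E' E} {T : Lp ℝ 2 ρ →L[ℝ] Lp ℝ 2 ρ'}
    (hT : IsL2Operator κ ρ ρ' T) (hι : Measurable ι) (hι' : Measurable ι') {c : ℝ} (hc : 0 ≤ c)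
    (hl : laplace ι ρ (2 * l) ≠ ⊤) (hk : laplace ι' ρ' (2 * k) ≠ ⊤)
    (h : ∀ x, laplace ι (κ x) l = ENNReal.ofReal (c * Real.exp (-(k * ι' x)))) :
    T (expL2 ι ρ l) = c • expL2 ι' ρ' k := by
  rw [expL2_eq_toLp hι hl]
  refine Lp.ext ((hT _ (memLp_exp hι hl)).2.trans
    (EventuallyEq.trans ?_ (Lp.coeFn_smul c (expL2 ι' ρ' k)).symm))
  filter_upwards [coeFn_expL2 hι' hk] with x hx
  rw [Pi.smul_apply, hx, smul_eq_mul, integral_exp_eq_toReal_laplace hι, h,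
    ENNReal.toReal_ofReal (by positivity)]

end Total

section Coordinates

variable {E E' : Type*} [TopologicalSpace E] [MeasurableSpace E] [BorelSpace E]
  [TopologicalSpace E'] [MeasurableSpace E'] [BorelSpace E'] {ι : E → ℝ} {ι' : E' → ℝ}
  {ρ : Measure E} {ρ' : Measure E'} {l k : ℝ}

theorem IsCoordinate.eq_zero_of_inner_expL2 (hι : IsCoordinate ι)
    (hρ : ∀ᶠ k in 𝓝 l, laplace ι ρ (2 * k) ≠ ⊤) {f : Lp ℝ 2 ρ}
    (h : ∀ᶠ k in 𝓝 l, inner ℝ (expL2 ι ρ k) f = 0) : f = 0 := by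
  have := sigmaFinite_of_laplace_ne_top hι.measurable hρ.self_of_nhds
  refine (Lp.eq_zero_iff_ae_eq_zero).2
    (hι.ae_eq_zero_of_integral_mul_exp (l := l) (Lp.aestronglyMeasurable f).aemeasurable ?_ ?_)
  · filter_upwards [hρ] with k hk using (Lp.memLp f).integrable_mul (memLp_exp hι.measurable hk)
  · filter_upwards [hρ, h] with k hk hk' using (inner_expL2 hι.measurable hk f).symm.trans hk'

theorem IsCoordinate.adjoint_eq (hι : IsCoordinate ι) (hι' : IsCoordinate ι')
    (hρ : ∀ᶠ m in 𝓝 l, laplace ι ρ (2 * m) ≠ ⊤) (hρ' : ∀ᶠ m in 𝓝 k, laplace ι' ρ' (2 * m) ≠ ⊤)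
    {T : Lp ℝ 2 ρ →L[ℝ] Lp ℝ 2 ρ'} {T' : Lp ℝ 2 ρ' →L[ℝ] Lp ℝ 2 ρ}
    (h : ∀ᶠ n in 𝓝 k, ∀ᶠ m in 𝓝 l, inner ℝ (T (expL2 ι ρ m)) (expL2 ι' ρ' n) =
      inner ℝ (expL2 ι ρ m) (T' (expL2 ι' ρ' n))) : T.adjoint = T' := by
  have hexp : ∀ᶠ n in 𝓝 k, T.adjoint (expL2 ι' ρ' n) = T' (expL2 ι' ρ' n) := by
    filter_upwards [h] with n hn
    refine sub_eq_zero.1 (hι.eq_zero_of_inner_expL2 hρ ?_)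
    filter_upwards [hn] with m hm
    rw [inner_sub_right, ContinuousLinearMap.adjoint_inner_right, hm, sub_self]
  refine ((ContinuousLinearMap.eq_adjoint_iff _ _).2 fun v u => ?_).symm
  rw [← ContinuousLinearMap.adjoint_inner_right]
  refine congrArg (inner ℝ v) (sub_eq_zero.1 (hι'.eq_zero_of_inner_expL2 hρ' ?_))
  filter_upwards [hexp] with n hn
  rw [inner_sub_right, ContinuousLinearMap.adjoint_inner_right, ← hn,
    ContinuousLinearMap.adjoint_inner_left, sub_self]

end Coordinates

/-! ### Invariance of the reference measures -/

section Invariance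

variable {β : ℝ} {l : ℝ}

theorem Gamma_add_natCast (hβ : 0 < β) (n : ℕ) :
    Real.Gamma (β + n) = (∏ k ∈ Finset.range n, (β + (k : ℝ))) * Real.Gamma β := by
  induction n with
  | zero => simp
  | succ n ih =>
    rw [Nat.cast_succ, ← add_assoc, Real.Gamma_add_one (by positivity), ih,
      Finset.prod_range_succ]
    ring

theorem poissonGateway_comp_besselMeasure (hβ : 0 < β) :
    poissonGateway ∘ₘ besselMeasure β = birthDeathMeasure β := by
  refine Measure.ext_of_singleton fun n => ?_
  have hpoisson (x : ℝ≥0) : poissonGateway x {n} = ENNReal.ofReal (1 / (n ! : ℝ)) *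
      ENNReal.ofReal ((x : ℝ) ^ (n : ℝ) * Real.exp (-(1 * x))) := by
    refine (poissonMeasure_singleton x n).trans ?_
    rw [← ENNReal.ofReal_mul (by positivity), Real.rpow_natCast, one_mul]
    congr 1
    ring
  rw [Measure.bind_apply (measurableSet_singleton n) poissonGateway.measurable.aemeasurable,
    birthDeathMeasure, Measure.sum_smul_dirac_singleton, lintegral_congr hpoisson,
    lintegral_const_mul _ (by fun_prop),
    lintegral_rpow_mul_exp_besselMeasure hβ one_pos n.cast_nonneg,
    ← ENNReal.ofReal_mul (by positivity), Gamma_add_natCast hβ, Real.one_rpow, mul_one,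
    mul_div_cancel_right₀ _ (Real.Gamma_pos_of_pos hβ).ne', one_div_mul_eq_div]

theorem laplace_besselMeasure_ne_top (hβ : 0 < β) (hl : 0 < l) :
    laplace (fun x : ℝ≥0 => (x : ℝ)) (besselMeasure β) l ≠ ⊤ :=
  laplace_besselMeasure hβ hl ▸ ENNReal.ofReal_ne_top

theorem laplace_besselKernel_comp_besselMeasure (hβ : 0 < β) (t : ℝ≥0) (hl : 0 < l) :
    laplace (fun x : ℝ≥0 => (x : ℝ)) (besselKernel β t ∘ₘ besselMeasure β) l =
      ENNReal.ofReal (l ^ (-β)) :=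
  calc laplace (fun x : ℝ≥0 => (x : ℝ)) (besselKernel β t ∘ₘ besselMeasure β) l
      = ∫⁻ x, ENNReal.ofReal ((1 + l * t) ^ (-β)) *
          ENNReal.ofReal (Real.exp (-(l / (1 + l * t) * x))) ∂(besselMeasure β) := by
        rw [laplace_bind (by fun_prop)]
        refine lintegral_congr fun x => ?_
        rw [laplace_besselKernel hβ.le t x hl.le, ENNReal.ofReal_mul (by positivity)]
    _ = ENNReal.ofReal ((1 + l * t) ^ (-β)) * ENNReal.ofReal ((l / (1 + l * t)) ^ (-β)) := by
        rw [lintegral_const_mul _ (by fun_prop)]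
        exact congrArg _ (laplace_besselMeasure hβ (by positivity))
    _ = ENNReal.ofReal (l ^ (-β)) := by
        rw [← ENNReal.ofReal_mul (by positivity), ← Real.mul_rpow (by positivity) (by positivity),
          mul_div_cancel₀ _ (by positivity)]

theorem besselKernel_comp_besselMeasure (hβ : 0 < β) (t : ℝ≥0) :
    besselKernel β t ∘ₘ besselMeasure β = besselMeasure β := by
  have hpos : ∀ᶠ l : ℝ in 𝓝 1, 0 < l := Ioi_mem_nhds one_pos
  refine (isCoordinate_nnreal.ext_of_laplace ?_
    (hpos.mono fun l hl => laplace_besselMeasure_ne_top hβ hl)).symm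
  filter_upwards [hpos] with l hl
  rw [laplace_besselKernel_comp_besselMeasure hβ t hl, laplace_besselMeasure hβ hl]

theorem gammaGateway_comp_birthDeathMeasure (hβ : 0 < β) :
    gammaGateway β ∘ₘ birthDeathMeasure β = besselMeasure β := by
  rw [← poissonGateway_comp_besselMeasure hβ, Measure.comp_assoc,
    gammaGateway_comp_poissonGateway hβ.le, besselKernel_comp_besselMeasure hβ]

theorem birthDeathKernel_comp_birthDeathMeasure (hβ : 0 < β) (t : ℝ≥0) :
    birthDeathKernel β t ∘ₘ birthDeathMeasure β = birthDeathMeasure β := by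
  rw [← poissonGateway_comp_besselMeasure hβ, Measure.comp_assoc,
    birthDeathKernel_comp_poissonGateway hβ.le, ← Measure.comp_assoc,
    besselKernel_comp_besselMeasure hβ]

theorem laplace_birthDeathMeasure (hβ : 0 < β) (hl : 0 < l) :
    laplace (fun n : ℕ => (n : ℝ)) (birthDeathMeasure β) l =
      ENNReal.ofReal ((1 - Real.exp (-l)) ^ (-β)) := by
  rw [← poissonGateway_comp_besselMeasure hβ, laplace_bind (by fun_prop)]
  simp only [laplace_poissonGateway]
  exact laplace_besselMeasure hβ (one_sub_exp_neg_mem_Ioo hl).1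

theorem laplace_birthDeathMeasure_ne_top (hβ : 0 < β) (hl : 0 < l) :
    laplace (fun n : ℕ => (n : ℝ)) (birthDeathMeasure β) l ≠ ⊤ :=
  laplace_birthDeathMeasure hβ hl ▸ ENNReal.ofReal_ne_top

end Invariance

/-! ### Unitary equivalence from a factorization of a square -/

section Hilbert

variable {𝕜 H K : Type*} [RCLike 𝕜] [NormedAddCommGroup H] [InnerProductSpace 𝕜 H]
  [NormedAddCommGroup K] [InnerProductSpace 𝕜 K] [CompleteSpace H] [CompleteSpace K]

theorem denseRange_of_injective_adjoint {T : H →L[𝕜] K} (hT : Function.Injective T.adjoint) :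
    DenseRange T := by
  have hclosure : T.range.topologicalClosure = ⊤ := by
    rw [Submodule.topologicalClosure_eq_top_iff, ContinuousLinearMap.orthogonal_range]
    exact LinearMap.ker_eq_bot.2 hT
  exact Submodule.dense_iff_topologicalClosure_eq_top.2 hclosure

theorem norm_adjoint_apply_of_comp_adjoint_eq_sq {A : H →L[𝕜] K} {G : K →L[𝕜] K}
    (hG : IsSelfAdjoint G) (hsq : G ∘L G = A ∘L A.adjoint) (v : K) : ‖A.adjoint v‖ = ‖G v‖ := by
  rw [← sq_eq_sq₀ (norm_nonneg _) (norm_nonneg _),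
    ContinuousLinearMap.apply_norm_sq_eq_inner_adjoint_left,
    ContinuousLinearMap.apply_norm_sq_eq_inner_adjoint_left,
    ContinuousLinearMap.adjoint_adjoint, hG.adjoint_eq, hsq]

-- The unitary operator is the inverse of the isometry extending `G v ↦ A† v`, that is, the partial
-- isometry in the polar decomposition of `A`.
theorem exists_unitary_of_comp_adjoint_eq_sq {ι : Type*} {A : H →L[𝕜] K} {G : K →L[𝕜] K}
    (hG : IsSelfAdjoint G) (hsq : G ∘L G = A ∘L A.adjoint) (hA : Function.Injective A)
    (hA' : Function.Injective A.adjoint) {S : ι → K →L[𝕜] K} {R : ι → H →L[𝕜] H}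
    (hSG : ∀ t, S t ∘L G = G ∘L S t) (hRA : ∀ t, R t ∘L A.adjoint = A.adjoint ∘L S t) :
    ∃ U : H ≃ₗᵢ[𝕜] K, ∀ t f, S t (U f) = U (R t f) := by
  have hnorm := norm_adjoint_apply_of_comp_adjoint_eq_sq hG hsq
  have hGinj : Function.Injective G := by
    refine (injective_iff_map_eq_zero G).2 fun v hv => hA' ?_
    rw [map_zero, ← norm_eq_zero, hnorm, hv, norm_zero]
  have hGdense : DenseRange G := denseRange_of_injective_adjoint (by rwa [hG.adjoint_eq])
  have hAdense : DenseRange A.adjoint :=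
    denseRange_of_injective_adjoint (by rwa [ContinuousLinearMap.adjoint_adjoint])
  let V : K ≃ₗᵢ[𝕜] H := (LinearEquiv.refl 𝕜 K).extendOfIsometry (G : K →ₗ[𝕜] K)
    (A.adjoint : K →ₗ[𝕜] H) hGdense hAdense hnorm
  have hV (v : K) : V (G v) = A.adjoint v := LinearEquiv.extendOfIsometry_eq
    (LinearEquiv.refl 𝕜 K) (G : K →ₗ[𝕜] K) (A.adjoint : K →ₗ[𝕜] H) hGdense hAdense hnorm v
  have hVS (t : ι) (y : K) : V (S t y) = R t (V y) := by
    refine hGdense.induction_on y (isClosed_eq (by fun_prop) (by fun_prop)) fun z => ?_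
    calc V (S t (G z)) = V (G (S t z)) := congrArg V (DFunLike.congr_fun (hSG t) z)
      _ = A.adjoint (S t z) := hV _
      _ = R t (A.adjoint z) := (DFunLike.congr_fun (hRA t) z).symm
      _ = R t (V (G z)) := by rw [hV]
  refine ⟨V.symm, fun t f => V.injective ?_⟩
  rw [hVS, V.apply_symm_apply, V.apply_symm_apply]

end Hilbert

/-! ### The gateways in the Hilbert spaces -/

section HilbertGateways

variable {β l k : ℝ}

/-- The exponential of rate `l` in `L²(μ_β)`. -/
noncomputable def besselExp (β l : ℝ) : Lp ℝ 2 (besselMeasure β) :=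
  expL2 (fun x : ℝ≥0 => (x : ℝ)) (besselMeasure β) l

/-- The geometric sequence of ratio `exp (-l)` in `ℓ²(m_β)`. -/
noncomputable def birthDeathExp (β l : ℝ) : Lp ℝ 2 (birthDeathMeasure β) :=
  expL2 (fun n : ℕ => (n : ℝ)) (birthDeathMeasure β) l

theorem eventually_laplace_besselMeasure_ne_top (hβ : 0 < β) (hl : 0 < l) :
    ∀ᶠ k in 𝓝 l, laplace (fun x : ℝ≥0 => (x : ℝ)) (besselMeasure β) (2 * k) ≠ ⊤ := by
  filter_upwards [Ioi_mem_nhds hl] with k hk using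
    laplace_besselMeasure_ne_top hβ (mul_pos two_pos hk)

theorem eventually_laplace_birthDeathMeasure_ne_top (hβ : 0 < β) (hl : 0 < l) :
    ∀ᶠ k in 𝓝 l, laplace (fun n : ℕ => (n : ℝ)) (birthDeathMeasure β) (2 * k) ≠ ⊤ := by
  filter_upwards [Ioi_mem_nhds hl] with k hk using
    laplace_birthDeathMeasure_ne_top hβ (mul_pos two_pos hk)

theorem inner_besselExp (hβ : 0 < β) (hl : 0 < l) (hk : 0 < k) :
    inner ℝ (besselExp β l) (besselExp β k) = (l + k) ^ (-β) := by
  rw [besselExp, besselExp, inner_expL2_expL2 (by fun_prop)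
    (laplace_besselMeasure_ne_top hβ (by positivity))
    (laplace_besselMeasure_ne_top hβ (by positivity)),
    laplace_besselMeasure hβ (by positivity), ENNReal.toReal_ofReal (by positivity)]

theorem inner_birthDeathExp (hβ : 0 < β) (hl : 0 < l) (hk : 0 < k) :
    inner ℝ (birthDeathExp β l) (birthDeathExp β k) = (1 - Real.exp (-(l + k))) ^ (-β) := by
  have := (one_sub_exp_neg_mem_Ioo (add_pos hl hk)).1
  rw [birthDeathExp, birthDeathExp, inner_expL2_expL2 (by fun_prop)
    (laplace_birthDeathMeasure_ne_top hβ (by positivity))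
    (laplace_birthDeathMeasure_ne_top hβ (by positivity)),
    laplace_birthDeathMeasure hβ (by positivity), ENNReal.toReal_ofReal (by positivity)]

variable {t : ℝ≥0} {L : Lp ℝ 2 (birthDeathMeasure β) →L[ℝ] Lp ℝ 2 (besselMeasure β)}
  {L' : Lp ℝ 2 (besselMeasure β) →L[ℝ] Lp ℝ 2 (birthDeathMeasure β)}
  {S : Lp ℝ 2 (besselMeasure β) →L[ℝ] Lp ℝ 2 (besselMeasure β)}

theorem poissonL2_birthDeathExp (hβ : 0 < β)
    (hL : IsL2Operator poissonGateway (birthDeathMeasure β) (besselMeasure β) L) (hl : 0 < l) :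
    L (birthDeathExp β l) = besselExp β (1 - Real.exp (-l)) := by
  have hlpos := (one_sub_exp_neg_mem_Ioo hl).1
  rw [← one_smul ℝ (besselExp β _)]
  exact hL.apply_expL2 (by fun_prop) (by fun_prop) zero_le_one
    (laplace_birthDeathMeasure_ne_top hβ (by positivity))
    (laplace_besselMeasure_ne_top hβ (mul_pos two_pos hlpos))
    fun x => by rw [laplace_poissonGateway, one_mul]

theorem gammaL2_besselExp (hβ : 0 < β)
    (hL' : IsL2Operator (gammaGateway β) (besselMeasure β) (birthDeathMeasure β) L')
    (hl : 0 < l) : L' (besselExp β l) = (1 + l) ^ (-β) • birthDeathExp β (Real.log (1 + l)) := by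
  refine hL'.apply_expL2 (by fun_prop) (by fun_prop) (by positivity)
    (laplace_besselMeasure_ne_top hβ (by positivity))
    (laplace_birthDeathMeasure_ne_top hβ (mul_pos two_pos (Real.log_pos (by linarith))))
    fun n => ?_
  rw [laplace_gammaGateway hβ.le n (by linarith), mul_comm (Real.log _), ← mul_neg,
    Real.exp_nat_mul, Real.exp_neg, Real.exp_log (by positivity)]

theorem besselL2_besselExp (hβ : 0 < β)
    (hS : IsL2Operator (besselKernel β t) (besselMeasure β) (besselMeasure β) S) (hl : 0 < l) :
    S (besselExp β l) = (1 + l * t) ^ (-β) • besselExp β (l / (1 + l * t)) :=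
  hS.apply_expL2 (by fun_prop) (by fun_prop) (by positivity)
    (laplace_besselMeasure_ne_top hβ (by positivity))
    (laplace_besselMeasure_ne_top hβ (by positivity)) fun x => laplace_besselKernel hβ.le t x hl.le

theorem inner_besselL2_besselExp (hβ : 0 < β)
    (hS : IsL2Operator (besselKernel β t) (besselMeasure β) (besselMeasure β) S) (hl : 0 < l)
    (hk : 0 < k) :
    inner ℝ (S (besselExp β l)) (besselExp β k) = (l + k + l * k * t) ^ (-β) := by
  rw [besselL2_besselExp hβ hS hl, real_inner_smul_left, inner_besselExp hβ (by positivity) hk,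
    ← Real.mul_rpow (by positivity) (by positivity)]
  congr 1
  field_simp
  ring

theorem isSelfAdjoint_besselL2 (hβ : 0 < β)
    (hS : IsL2Operator (besselKernel β t) (besselMeasure β) (besselMeasure β) S) :
    IsSelfAdjoint S := by
  have hfin := eventually_laplace_besselMeasure_ne_top hβ one_pos
  refine isCoordinate_nnreal.adjoint_eq isCoordinate_nnreal hfin hfin ?_
  filter_upwards [Ioi_mem_nhds one_pos] with k hk
  filter_upwards [Ioi_mem_nhds one_pos] with l hl
  refine (inner_besselL2_besselExp hβ hS hl hk).trans ?_
  refine Eq.trans ?_ ((real_inner_comm _ _).trans (inner_besselL2_besselExp hβ hS hk hl)).symm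
  ring_nf

theorem adjoint_poissonL2 (hβ : 0 < β)
    (hL : IsL2Operator poissonGateway (birthDeathMeasure β) (besselMeasure β) L)
    (hL' : IsL2Operator (gammaGateway β) (besselMeasure β) (birthDeathMeasure β) L') :
    L.adjoint = L' := by
  refine isCoordinate_nat.adjoint_eq isCoordinate_nnreal
    (eventually_laplace_birthDeathMeasure_ne_top hβ one_pos)
    (eventually_laplace_besselMeasure_ne_top hβ one_pos) ?_
  filter_upwards [Ioi_mem_nhds one_pos] with k (hk : 0 < k)
  filter_upwards [Ioi_mem_nhds one_pos] with l (hl : 0 < l)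
  change inner ℝ (L (birthDeathExp β l)) (besselExp β k) =
    inner ℝ (birthDeathExp β l) (L' (besselExp β k))
  have hlog : 0 < Real.log (1 + k) := Real.log_pos (by linarith)
  have hexp : 0 < 1 - Real.exp (-l) := (one_sub_exp_neg_mem_Ioo hl).1
  have hexp' := (one_sub_exp_neg_mem_Ioo (add_pos hl hlog)).1
  rw [poissonL2_birthDeathExp hβ hL hl, gammaL2_besselExp hβ hL' hk, inner_besselExp hβ hexp hk,
    real_inner_smul_right, inner_birthDeathExp hβ hl hlog,
    ← Real.mul_rpow (by positivity) hexp'.le]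
  congr 1
  rw [neg_add, Real.exp_add, Real.exp_neg (Real.log _), Real.exp_log (by positivity)]
  field_simp
  ring

theorem injective_adjoint_poissonL2 (hβ : 0 < β)
    (hL : IsL2Operator poissonGateway (birthDeathMeasure β) (besselMeasure β) L) :
    Function.Injective L.adjoint := by
  refine (injective_iff_map_eq_zero L.adjoint).2 fun v hv => ?_
  refine isCoordinate_nnreal.eq_zero_of_inner_expL2
    (eventually_laplace_besselMeasure_ne_top hβ one_half_pos) ?_
  filter_upwards [Ioo_mem_nhds one_half_pos one_half_lt_one] with l hl
  have hlog : 0 < -Real.log (1 - l) :=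
    neg_pos.2 (Real.log_neg (sub_pos.2 hl.2) (sub_lt_self 1 hl.1))
  have hL_exp : L (birthDeathExp β (-Real.log (1 - l))) = besselExp β l := by
    rw [poissonL2_birthDeathExp hβ hL hlog, neg_neg, Real.exp_log (sub_pos.2 hl.2), sub_sub_cancel]
  change inner ℝ (besselExp β l) v = 0
  rw [← hL_exp, ← ContinuousLinearMap.adjoint_inner_right, hv, inner_zero_right]

theorem injective_adjoint_gammaL2 (hβ : 0 < β)
    (hL' : IsL2Operator (gammaGateway β) (besselMeasure β) (birthDeathMeasure β) L') :
    Function.Injective L'.adjoint := by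
  refine (injective_iff_map_eq_zero L'.adjoint).2 fun u hu => ?_
  refine isCoordinate_nat.eq_zero_of_inner_expL2
    (eventually_laplace_birthDeathMeasure_ne_top hβ one_pos) ?_
  filter_upwards [Ioi_mem_nhds one_pos] with l hl
  have hinner : inner ℝ (L' (besselExp β (Real.exp l - 1))) u = 0 := by
    rw [← ContinuousLinearMap.adjoint_inner_right, hu, inner_zero_right]
  rw [gammaL2_besselExp hβ hL' (sub_pos.2 (Real.one_lt_exp_iff.2 hl)), add_sub_cancel,
    Real.log_exp, real_inner_smul_left] at hinner
  exact (mul_eq_zero.1 hinner).resolve_left (Real.rpow_pos_of_pos (Real.exp_pos l) _).ne'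

end HilbertGateways

section IntertwinedOperators

variable {β : ℝ} {t : ℝ≥0}

theorem besselC0_comp_poissonC0 (hβ : 0 ≤ β) {L : C₀(ℕ, ℝ) →L[ℝ] C₀(ℝ≥0, ℝ)}
    {S : C₀(ℝ≥0, ℝ) →L[ℝ] C₀(ℝ≥0, ℝ)} {R : C₀(ℕ, ℝ) →L[ℝ] C₀(ℕ, ℝ)}
    (hL : IsC0Operator poissonGateway L) (hS : IsC0Operator (besselKernel β t) S)
    (hR : IsC0Operator (birthDeathKernel β t) R) : S ∘L L = L ∘L R := by
  have := isMarkovKernel_poissonGateway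
  have := isMarkovKernel_besselKernel hβ t
  have := isMarkovKernel_birthDeathKernel hβ t
  exact (hS.comp hL).eq (birthDeathKernel_comp_poissonGateway hβ t ▸ hL.comp hR)

theorem birthDeathC0_comp_gammaC0 (hβ : 0 ≤ β) {L' : C₀(ℝ≥0, ℝ) →L[ℝ] C₀(ℕ, ℝ)}
    {S : C₀(ℝ≥0, ℝ) →L[ℝ] C₀(ℝ≥0, ℝ)} {R : C₀(ℕ, ℝ) →L[ℝ] C₀(ℕ, ℝ)}
    (hL' : IsC0Operator (gammaGateway β) L') (hS : IsC0Operator (besselKernel β t) S)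
    (hR : IsC0Operator (birthDeathKernel β t) R) : R ∘L L' = L' ∘L S := by
  have := isMarkovKernel_gammaGateway hβ
  have := isMarkovKernel_besselKernel hβ t
  have := isMarkovKernel_birthDeathKernel hβ t
  exact (hR.comp hL').eq (besselKernel_comp_gammaGateway hβ t ▸ hL'.comp hS)

variable {L : Lp ℝ 2 (birthDeathMeasure β) →L[ℝ] Lp ℝ 2 (besselMeasure β)}
  {L' : Lp ℝ 2 (besselMeasure β) →L[ℝ] Lp ℝ 2 (birthDeathMeasure β)}
  {S : ℝ≥0 → Lp ℝ 2 (besselMeasure β) →L[ℝ] Lp ℝ 2 (besselMeasure β)}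
  {R : ℝ≥0 → Lp ℝ 2 (birthDeathMeasure β) →L[ℝ] Lp ℝ 2 (birthDeathMeasure β)}

theorem besselL2_comp_poissonL2 (hβ : 0 ≤ β)
    (hL : IsL2Operator poissonGateway (birthDeathMeasure β) (besselMeasure β) L)
    (hS : IsL2Operator (besselKernel β t) (besselMeasure β) (besselMeasure β) (S t))
    (hR : IsL2Operator (birthDeathKernel β t) (birthDeathMeasure β) (birthDeathMeasure β) (R t)) :
    S t ∘L L = L ∘L R t :=
  (hS.comp hL).eq (birthDeathKernel_comp_poissonGateway hβ t ▸ hL.comp hR)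

theorem birthDeathL2_comp_gammaL2 (hβ : 0 ≤ β)
    (hL' : IsL2Operator (gammaGateway β) (besselMeasure β) (birthDeathMeasure β) L')
    (hS : IsL2Operator (besselKernel β t) (besselMeasure β) (besselMeasure β) (S t))
    (hR : IsL2Operator (birthDeathKernel β t) (birthDeathMeasure β) (birthDeathMeasure β) (R t)) :
    R t ∘L L' = L' ∘L S t :=
  (hR.comp hL').eq (besselKernel_comp_gammaGateway hβ t ▸ hL'.comp hS)

theorem besselL2_comp_besselL2 (hβ : 0 ≤ β)
    (hS : ∀ t, IsL2Operator (besselKernel β t) (besselMeasure β) (besselMeasure β) (S t))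
    (s t : ℝ≥0) : S s ∘L S t = S (s + t) :=
  ((hS s).comp (hS t)).eq
    ((isSquaredBesselSemigroup_besselKernel hβ).feller.add s t ▸ hS (s + t))

theorem isQuasiAffinity_poissonL2 (hβ : 0 < β)
    (hL : IsL2Operator poissonGateway (birthDeathMeasure β) (besselMeasure β) L)
    (hL' : IsL2Operator (gammaGateway β) (besselMeasure β) (birthDeathMeasure β) L') :
    IsQuasiAffinity L := by
  refine ⟨?_, denseRange_of_injective_adjoint (injective_adjoint_poissonL2 hβ hL)⟩
  rw [← L.adjoint_adjoint, adjoint_poissonL2 hβ hL hL']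
  exact injective_adjoint_gammaL2 hβ hL'

theorem exists_unitary_birthDeathL2_besselL2 (hβ : 0 < β)
    (hL : IsL2Operator poissonGateway (birthDeathMeasure β) (besselMeasure β) L)
    (hL' : IsL2Operator (gammaGateway β) (besselMeasure β) (birthDeathMeasure β) L')
    (hS : ∀ t, IsL2Operator (besselKernel β t) (besselMeasure β) (besselMeasure β) (S t))
    (hR : ∀ t, IsL2Operator (birthDeathKernel β t) (birthDeathMeasure β) (birthDeathMeasure β)
      (R t)) :
    ∃ U : Lp ℝ 2 (birthDeathMeasure β) ≃ₗᵢ[ℝ] Lp ℝ 2 (besselMeasure β),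
      ∀ t f, S t (U f) = U (R t f) := by
  have hadj : L.adjoint = L' := adjoint_poissonL2 hβ hL hL'
  have hSS := besselL2_comp_besselL2 hβ.le hS
  have hsq : S (1 / 2) ∘L S (1 / 2) = L ∘L L.adjoint := by
    rw [hSS, add_halves, hadj]
    exact (hS 1).eq (gammaGateway_comp_poissonGateway hβ.le ▸ hL.comp hL')
  refine exists_unitary_of_comp_adjoint_eq_sq (isSelfAdjoint_besselL2 hβ (hS (1 / 2))) hsq
    (isQuasiAffinity_poissonL2 hβ hL hL').1 (injective_adjoint_poissonL2 hβ hL)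
    (fun t => by rw [hSS, hSS, add_comm]) fun t => ?_
  rw [hadj]
  exact birthDeathL2_comp_gammaL2 hβ.le hL' (hS t) (hR t)

end IntertwinedOperators

theorem theorem1 (β : ℝ) (hβ : 0 ≤ β) :
    -- the two semigroups exist and are determined by their generators
    (∃! Q : ℝ≥0 → Kernel ℝ≥0 ℝ≥0, IsSquaredBesselSemigroup β Q) ∧
    (∃! D : ℝ≥0 → Kernel ℕ ℕ, IsBirthDeathSemigroup β D) ∧
    ∀ (Q : ℝ≥0 → Kernel ℝ≥0 ℝ≥0) (D : ℝ≥0 → Kernel ℕ ℕ),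
      IsSquaredBesselSemigroup β Q → IsBirthDeathSemigroup β D →
      -- the intertwinings on functions vanishing at infinity
      (∃ (L : C₀(ℕ, ℝ) →L[ℝ] C₀(ℝ≥0, ℝ)) (L' : C₀(ℝ≥0, ℝ) →L[ℝ] C₀(ℕ, ℝ))
          (S : ℝ≥0 → C₀(ℝ≥0, ℝ) →L[ℝ] C₀(ℝ≥0, ℝ)) (R : ℝ≥0 → C₀(ℕ, ℝ) →L[ℝ] C₀(ℕ, ℝ)),
          IsC0Operator poissonGateway L ∧ IsC0Operator (gammaGateway β) L' ∧
          (∀ t, IsC0Operator (Q t) (S t)) ∧ (∀ t, IsC0Operator (D t) (R t)) ∧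
          (∀ t, S t ∘L L = L ∘L R t) ∧
          (∀ t, R t ∘L L' = L' ∘L S t)) ∧
      -- the intertwinings in the Hilbert spaces, and the unitary equivalence
      (0 < β →
        ∃ (L : Lp ℝ 2 (birthDeathMeasure β) →L[ℝ] Lp ℝ 2 (besselMeasure β))
          (L' : Lp ℝ 2 (besselMeasure β) →L[ℝ] Lp ℝ 2 (birthDeathMeasure β))
          (S : ℝ≥0 → Lp ℝ 2 (besselMeasure β) →L[ℝ] Lp ℝ 2 (besselMeasure β))
          (R : ℝ≥0 → Lp ℝ 2 (birthDeathMeasure β) →L[ℝ] Lp ℝ 2 (birthDeathMeasure β)),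
          IsL2Operator poissonGateway (birthDeathMeasure β) (besselMeasure β) L ∧
          IsL2Operator (gammaGateway β) (besselMeasure β) (birthDeathMeasure β) L' ∧
          (∀ t, IsL2Operator (Q t) (besselMeasure β) (besselMeasure β) (S t)) ∧
          (∀ t, IsL2Operator (D t) (birthDeathMeasure β) (birthDeathMeasure β) (R t)) ∧
          (∀ t, S t ∘L L = L ∘L R t) ∧
          (∀ t, R t ∘L L' = L' ∘L S t) ∧
          IsQuasiAffinity L ∧
          ∃ U : Lp ℝ 2 (birthDeathMeasure β) ≃ₗᵢ[ℝ] Lp ℝ 2 (besselMeasure β),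
            ∀ t f, S t (U f) = U (R t f)) := by
  refine ⟨⟨besselKernel β, isSquaredBesselSemigroup_besselKernel hβ,
    fun Q hQ => hQ.eq_besselKernel hβ⟩, ⟨birthDeathKernel β,
    isBirthDeathSemigroup_birthDeathKernel hβ, fun D hD => hD.eq_birthDeathKernel hβ⟩,
    fun Q D hQ hD => ?_⟩
  obtain rfl := hQ.eq_besselKernel hβ
  obtain rfl := hD.eq_birthDeathKernel hβ
  have := isMarkovKernel_gammaGateway hβ
  have := isMarkovKernel_poissonGateway
  have := isMarkovKernel_besselKernel hβ
  have := isMarkovKernel_birthDeathKernel hβ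
  constructor
  · have hL := isC0Operator_C0Operator C0Preimage_poissonGateway
    have hL' := isC0Operator_C0Operator (C0Preimage_gammaGateway hβ)
    have hS := hQ.feller.isC0Operator_op
    have hR := hD.feller.isC0Operator_op
    exact ⟨_, _, _, _, hL, hL', hS, hR, fun t => besselC0_comp_poissonC0 hβ hL (hS t) (hR t),
      fun t => birthDeathC0_comp_gammaC0 hβ hL' (hS t) (hR t)⟩
  · intro hβ'
    obtain ⟨L, hL⟩ := exists_isL2Operator _ (poissonGateway_comp_besselMeasure hβ')
    obtain ⟨L', hL'⟩ := exists_isL2Operator _ (gammaGateway_comp_birthDeathMeasure hβ')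
    choose S hS using fun t => exists_isL2Operator _ (besselKernel_comp_besselMeasure hβ' t)
    choose R hR using fun t => exists_isL2Operator _ (birthDeathKernel_comp_birthDeathMeasure hβ' t)
    exact ⟨L, L', S, R, hL, hL', hS, hR, fun t => besselL2_comp_poissonL2 hβ hL (hS t) (hR t),
      fun t => birthDeathL2_comp_gammaL2 hβ hL' (hS t) (hR t),
      isQuasiAffinity_poissonL2 hβ' hL hL', exists_unitary_birthDeathL2_besselL2 hβ' hL hL' hS hR⟩
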